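/- **Setting.** Let $L>0$, $\Omega=[0,L]^3$ the periodic torus, $\lambda_1=4\pi^2/L^2$. For $s\ge 0$ let $\dot V_s$ be the space of real, mean-zero, divergence-free fields $u(x)=\sum_{K\in\mathbb Z^3\setminus\{0\}}\hat u_K e^{2\pi i K\cdot x/L}$ with $\|u\|_{\dot V_s}^2=L^3\sum_K(2\pi|K|/L)^{2s}|\hat u_K|^2<\infty$; write $H=\dot V_0$, $V=\dot V_1$, $D(A)=\dot V_2$, so that $\|u\|_{H}=\|u\|$, $\|u\|_V=\|\nabla u\|$, $\|u\|_{D(A)}=\|Au\|$ ($L^2$ norms), where $A=-\Delta$. Let $\mathcal P$ be the Helmholtz–Leray projection, $B(u,v)=\mathcal P[(u\cdot\nabla)v]$, and $P_N$ the projection onto the Fourier modes $0<|K|<N$. Let $c>0$ be a constant for which $\|g\|_{L^3}\le c\|g\|^{1/2}\|\nabla g\|^{1/2}$, $\|g\|_{L^4}\le c\|g\|^{1/4}\|\nabla g\|^{3/4}$ and $\|g\|_{L^6}\le c\|\nabla g\|$ for all $g\in V$. Let $\nu>0$, $0<\alpha_0\le\alpha\le\alpha_1$, $f\in L^\infty([0,\infty);H)$,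 $F=\operatorname{ess\,sup}_{s\ge0}\|f(s)\|$, and let $u$ be a solution on $[0,\infty)$ of $$\frac{dv}{dt}+\nu Av+B(u,u)=f,\qquad v=u+\alpha^2Au,$$ with $u(0)\in D(A)$, $\|u(0)\|\le M_A$, $\|\nabla u(0)\|\le M_B$, $\|Au(0)\|\le M_C$ for positive constants $M_A,M_B,M_C$. Let $0\le t_n<t_{n+1}$, $\beta_n>0$, $\eta_n>0$, let $N_n\ge1$ be an integer, and let $w_n$ be a solution on $[t_n,t_{n+1}]$ of the nudged system $$\frac{dz_n}{dt}+\nu Az_n+B(w_n,w_n)=f-\eta_n(I+\beta_n^2A)\mathcal P(P_{N_n}w_n-P_{N_n}u),\qquad z_n=w_n+\beta_n^2Aw_n .$$ (A solution on an interval $[a,b]$ means a function in $C([a,b];V)\cap L^2(a,b;D(A))$ that satisfies the equation in $D(A)'$; no further condition is placed on $w_n(t_n)\in V$.) Put $$M_1^2(t)=e^{-\nu\lambda_1t}(M_A^2+\alpha_1^2M_B^2)+\frac{F^2}{\lambda_1^2\nu^2},$$ $$M_2^2(t)=e^{-\nu\lambda_1t}(M_B^2+\alpha_1^2M_C^2)+\frac{2c^4}{\alpha_0^5\nu^2\lambda_1}e^{-\nu\lambda_1t}(M_A^2+\alpha_1^2M_B^2)^2+\frac{F^2}{\nu^2\lambda_1}+\frac{2c^4F^4}{\alpha_0^5\nu^6\lambda_1^5},$$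 $$M_3(t)=\frac{\nu}{\alpha_0}M_2(t)+\frac{c^2}{\alpha_0^4\lambda_1^{3/4}}M_1^2(t)+F .$$ **Proposition.** Assume $$\frac{27c^4M_1^4(t_n)}{8\nu^3\alpha_0^4}\le\eta_n\qquad\text{and}\qquad\frac{\eta_n}{N_n^2}\le\frac{\nu\lambda_1}{2}.$$ Then $g_n:=w_n-u$ satisfies, for all $t\in[t_n,t_{n+1}]$, $$\|g_n(t)\|^2+\beta_n^2\|\nabla g_n(t)\|^2\le e^{-\frac{\eta_n}{2}(t-t_n)}\left(\|g_n(t_n)\|^2+\beta_n^2\|\nabla g_n(t_n)\|^2\right)+4\left(\frac1\nu M_3^2(t_n)+\frac{\nu}{\alpha_0^2}M_2^2(t_n)\right)\frac{|\beta_n^2-\alpha^2|^2}{\eta_n\beta_n^2}.$$ -/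

import Mathlib

open MeasureTheory Filter Topology
open scoped ENNReal ComplexConjugate

namespace Bardina

/-- The three-dimensional torus of side `L`, with its volume of total mass `L ^ 3`. -/
abbrev Torus (L : ℝ) : Type := Fin 3 → AddCircle L

/-- A vector field on the torus, given by the family of its (vector-valued) Fourier coefficients:
`u` stands for the Fourier series `u(x) = ∑ K, u K * exp (2 π i K ⬝ x / L)`. -/
abbrev VField : Type := (Fin 3 → ℤ) → EuclideanSpace ℂ (Fin 3)

noncomputable section

/-- The Euclidean length `|K|` of a wave number. -/
def kabs (K : Fin 3 → ℤ) : ℝ := √(∑ i, (K i : ℝ) ^ 2)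

/-- The first eigenvalue `4 π² / L²` of the Stokes operator. -/
def lam (L : ℝ) : ℝ := 4 * Real.pi ^ 2 / L ^ 2

/-- Membership in the space `V_s` of real, mean-zero, divergence-free fields with `s` derivatives
in `L²`. Thus `H = V_0`, `V = V_1`, `D(A) = V_2`. -/
structure InV (s : ℕ) (u : VField) : Prop where
  mean_zero : u 0 = 0
  real : ∀ K i, u (-K) i = conj (u K i)
  div_free : ∀ K, ∑ i, u K i * (K i : ℂ) = 0
  summable : Summable fun K => kabs K ^ (2 * s) * ‖u K‖ ^ 2

/-- The norm of `V_s`. For `s = 0, 1, 2` it is `‖u‖`, `‖∇u‖`, `‖Au‖` (norms in `L²`). -/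
def vnorm (L : ℝ) (s : ℕ) (u : VField) : ℝ :=
  √(L ^ 3 * ∑' K, (2 * Real.pi * kabs K / L) ^ (2 * s) * ‖u K‖ ^ 2)

/-- The Helmholtz-Leray projection. -/
def leray (u : VField) : VField := fun K =>
  if K = 0 then 0 else
    WithLp.toLp 2 fun i => u K i - (K i : ℂ) * (∑ j, u K j * (K j : ℂ)) / ((kabs K ^ 2 : ℝ) : ℂ)

/-- The Stokes operator `A = -Δ`. -/
def stokes (L : ℝ) (u : VField) : VField := fun K => (4 * Real.pi ^ 2 * kabs K ^ 2 / L ^ 2) • u K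

/-- The operator `I + α² A`. -/
def helm (L α : ℝ) (u : VField) : VField := u + α ^ 2 • stokes L u

open Classical in
/-- The projection `P_N` onto the Fourier modes with `0 < |K| < N`. -/
def lowModes (N : ℕ) (u : VField) : VField := fun K =>
  if 0 < kabs K ∧ kabs K < N then u K else 0

/-- The Fourier coefficients of `∂u / ∂x_i`. -/
def partialDeriv (L : ℝ) (i : Fin 3) (u : VField) : VField := fun K =>
  (2 * Real.pi * Complex.I * (K i : ℂ) / (L : ℂ)) • u K

section Torus

variable (L : ℝ) [Fact (0 < L)]

/-- The character `x ↦ exp (2 π i K ⬝ x / L)`. -/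
def mode (K : Fin 3 → ℤ) : C(Torus L, ℂ) where
  toFun x := ∏ i, fourier (K i) (x i)
  continuous_toFun := by fun_prop

/-- The `L²` function `∑ K, a K * exp (2 π i K ⬝ x / L)`, a series converging in `L²`. -/
def series (a : (Fin 3 → ℤ) → ℂ) : Lp ℂ 2 (volume : Measure (Torus L)) :=
  ∑' K, a K • ContinuousMap.toLp 2 (volume : Measure (Torus L)) ℂ (mode L K)

/-- The values of a field: the function on the torus with the given Fourier coefficients. -/
def value (u : VField) (x : Torus L) : EuclideanSpace ℂ (Fin 3) :=
  WithLp.toLp 2 fun j => series L (fun K => u K j) x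

/-- The function `(u ⬝ ∇) v` on the torus. -/
def advect (u v : VField) (x : Torus L) : EuclideanSpace ℂ (Fin 3) :=
  ∑ i, value L u x i • value L (partialDeriv L i v) x

/-- The Fourier coefficients of an integrable function on the torus. -/
def coeff (F : Torus L → EuclideanSpace ℂ (Fin 3)) : VField := fun K =>
  ((L : ℂ) ^ 3)⁻¹ • ∫ x, conj (mode L K x) • F x

/-- The bilinear operator `B(u, v) = P[(u ⬝ ∇) v]`. -/
def bilin (u v : VField) : VField := leray (coeff L (advect L u v))

/-- `c` is a constant for which the three Gagliardo-Nirenberg inequalities hold on `V`. -/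
structure IsGNConst (c : ℝ) : Prop where
  pos : 0 < c
  l3 : ∀ g, InV 1 g → eLpNorm (value L g) 3 volume ≤
    ENNReal.ofReal (c * vnorm L 0 g ^ (1 / 2 : ℝ) * vnorm L 1 g ^ (1 / 2 : ℝ))
  l4 : ∀ g, InV 1 g → eLpNorm (value L g) 4 volume ≤
    ENNReal.ofReal (c * vnorm L 0 g ^ (1 / 4 : ℝ) * vnorm L 1 g ^ (3 / 4 : ℝ))
  l6 : ∀ g, InV 1 g → eLpNorm (value L g) 6 volume ≤ ENNReal.ofReal (c * vnorm L 1 g)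

/-- `u` is a (regular) solution on `[a, b]` of `dv/dt + ν A v + B(u, u) = G`, `v = u + α² A u`:
`u ∈ C([a, b]; V) ∩ L²(a, b; D(A))`, and the equation holds in `D(A)'`, that is, for the
Fourier coefficients, in its form integrated in time. -/
structure IsSolutionOn (ν α : ℝ) (G : ℝ → VField) (a b : ℝ) (u : ℝ → VField) : Prop where
  mem_V : ∀ t ∈ Set.Icc a b, InV 1 (u t)
  continuous_V : ∀ t ∈ Set.Icc a b,
    Tendsto (fun s => vnorm L 1 (u s - u t)) (𝓝[Set.Icc a b] t) (𝓝 0)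
  mem_DA : ∀ᵐ t ∂volume.restrict (Set.Icc a b), InV 2 (u t)
  sq_integrable_DA : IntegrableOn (fun t => vnorm L 2 (u t) ^ 2) (Set.Icc a b)
  equation : ∀ t ∈ Set.Icc a b, ∀ K,
    helm L α (u t) K - helm L α (u a) K =
      ∫ s in a..t, (G s K - ν • stokes L (helm L α (u s)) K - bilin L (u s) (u s) K)

/-- `u` is a solution of the viscous simplified Bardina system on `[0, ∞)`. -/
def IsBardinaSolution (ν α : ℝ) (f u : ℝ → VField) : Prop :=
  ∀ T : ℝ, 0 < T → IsSolutionOn L ν α f 0 T u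

/-- `w` is a solution on `[a, b]` of the nudged system
`dz/dt + ν A z + B(w, w) = f - η (I + β² A) P (P_N w - P_N u)`, `z = w + β² A w`. -/
def IsNudgedSolution (ν β η : ℝ) (N : ℕ) (f u : ℝ → VField) (a b : ℝ) (w : ℝ → VField) : Prop :=
  IsSolutionOn L ν β
    (fun s => f s - η • helm L β (leray (lowModes N (w s) - lowModes N (u s)))) a b w

end Torus

/-- `f ∈ L^∞([0, ∞); H)`. (As `H` is separable, measurability can be tested on coefficients.) -/
structure IsForcing (L : ℝ) (f : ℝ → VField) : Prop where
  measurable : ∀ K, AEStronglyMeasurable (fun t => f t K) (volume.restrict (Set.Ici 0))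
  mem_H : ∀ᵐ t ∂volume.restrict (Set.Ici (0 : ℝ)), InV 0 (f t)
  bounded : ∃ C : ℝ, ∀ᵐ t ∂volume.restrict (Set.Ici (0 : ℝ)), vnorm L 0 (f t) ≤ C

/-- The (essential) supremum of `‖f(s)‖` over `s ≥ 0`. -/
def supNorm (L : ℝ) (f : ℝ → VField) : ℝ :=
  essSup (fun t => vnorm L 0 (f t)) (volume.restrict (Set.Ici (0 : ℝ)))

/-- The square of the function `M_1`; `F` stands for the supremum of `‖f‖`. -/
def M1sq (L ν α₁ MA MB F t : ℝ) : ℝ :=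
  Real.exp (-ν * lam L * t) * (MA ^ 2 + α₁ ^ 2 * MB ^ 2) + 1 / (lam L ^ 2 * ν ^ 2) * F ^ 2

/-- The square of the function `M_2`. -/
def M2sq (L ν c α₀ α₁ MA MB MC F t : ℝ) : ℝ :=
  Real.exp (-ν * lam L * t) * (MB ^ 2 + α₁ ^ 2 * MC ^ 2)
    + 2 * c ^ 4 / (α₀ ^ 5 * ν ^ 2 * lam L) * Real.exp (-ν * lam L * t)
        * (MA ^ 2 + α₁ ^ 2 * MB ^ 2) ^ 2
    + 1 / (ν ^ 2 * lam L) * F ^ 2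
    + 2 * c ^ 4 / (α₀ ^ 5 * ν ^ 6 * lam L ^ 5) * F ^ 4

/-- The function `M_3`. -/
def M3 (L ν c α₀ α₁ MA MB MC F t : ℝ) : ℝ :=
  ν / α₀ * √(M2sq L ν c α₀ α₁ MA MB MC F t)
    + c ^ 2 / (α₀ ^ 4 * lam L ^ (3 / 4 : ℝ)) * M1sq L ν α₁ MA MB F t + F

end

end Bardina

open Bardina

/-! Put g = w - u and k = 2π|K|/L. Dividing mode K of each equation by its own factor 1 + α²k² or 1
+ β²k², subtracting, and pairing with (1 + β²k²)g gives, for E = ‖g‖² + β²‖∇g‖², dE/dt = -2ν(‖∇g‖² +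
β²‖Ag‖²) - 2η(part of E in the modes |K| < N) - 2((g·∇)u, g) - 2(β² - α²)(A(I + α²A)⁻¹(f - B(u,u)),
g).

Half of the viscous term supplies the damping that nudging does not give the modes |K| ≥ N, because
η ≤ νk²/2 there (`lowIndicator_dissipation`). The other half absorbs the gradient part of the
nonlinear term and the ‖Ag‖ part of the residual. What is left is dE/dt ≤ -(η/2)E + (β² -
α²)²M²/(νβ²), and Gronwall concludes.

Two points decide the constants. The nonlinear term is at most ‖g‖²_{L⁴}‖∇u‖, where ‖∇u‖ is
controlled by M_1 (`IsBardinaSolution.energy_le`). Its fourth power contains ∫|g|⁴ twice: one factor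
is bounded with c⁴, the other by Ladyzhenskaya's inequality with constant 1, proved here by Fourier
series (`IsH1.ladyzhenskaya`). This yields the c⁴ of the assumption on η, where c alone would give
c⁸. In the residual, (I + α²A)⁻¹(f - B(u,u)) equals du/dt + νAu, but it is estimated directly from f
and B(u,u): the smoothing operator absorbs the derivative in B (`sum_inner_residual_le`,
`sqrt_fourth_div_le`), so no bound on Au is needed.

Solutions are weak, so E is not differentiated. `energy_le` sums the exact energy identities of the
single modes by dominated convergence, and the pairing with B is identified with an integral over
the torus by `hasSum_inner_bilin`. -/

namespace Bardina

set_option linter.unusedSectionVars false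

/-! ### Characters and Fourier series in L² of the torus. -/

section Modes

variable (L : ℝ) [hL : Fact (0 < L)]

lemma mode_add (K J : Fin 3 → ℤ) (x : Torus L) : mode L (K + J) x = mode L K x * mode L J x := by
  simp only [mode, Pi.add_apply, fourier_add, ContinuousMap.coe_mk, ← Finset.prod_mul_distrib]

lemma mode_neg (K : Fin 3 → ℤ) (x : Torus L) : mode L (-K) x = conj (mode L K x) := by
  simp only [mode, Pi.neg_apply, fourier_neg, ContinuousMap.coe_mk, map_prod]

lemma mode_sub (K J : Fin 3 → ℤ) (x : Torus L) :
    mode L (K - J) x = conj (mode L J x) * mode L K x := by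
  rw [sub_eq_add_neg, mode_add, mode_neg, mul_comm]

lemma norm_mode (K : Fin 3 → ℤ) (x : Torus L) : ‖mode L K x‖ = 1 := by
  rw [mode, ContinuousMap.coe_mk, norm_prod]
  exact Finset.prod_eq_one fun i _ => by rw [fourier_apply, Circle.norm_coe]

lemma integral_fourier_circle (n : ℤ) :
    ∫ x : AddCircle L, fourier n x = if n = 0 then (L : ℂ) else 0 := by
  have h := congrFun (fourierCoeff_fourier (T := L) n) 0
  simp only [fourierCoeff, neg_zero, fourier_zero, one_smul] at h
  rw [AddCircle.volume_eq_smul_haarAddCircle, integral_smul_measure, h,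
    ENNReal.toReal_ofReal hL.out.le]
  by_cases hn : n = 0
  · subst hn; simp
  · simp [hn, Ne.symm hn]

lemma integral_mode (K : Fin 3 → ℤ) :
    ∫ x : Torus L, mode L K x = if K = 0 then (L : ℂ) ^ 3 else 0 := by
  have h : ∫ x : Torus L, mode L K x = ∏ i, ∫ x : AddCircle L, fourier (K i) x :=
    integral_fintype_prod_volume_eq_prod (fun i (x : AddCircle L) => fourier (K i) x)
  rw [h]
  simp only [integral_fourier_circle]
  split_ifs with hK
  · subst hK; simp
  · obtain ⟨i, hi⟩ := Function.ne_iff.1 hK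
    exact Finset.prod_eq_zero (Finset.mem_univ i) (if_neg hi)

noncomputable def modeLp (K : Fin 3 → ℤ) : Lp ℂ 2 (volume : Measure (Torus L)) :=
  ContinuousMap.toLp 2 (volume : Measure (Torus L)) ℂ (mode L K)

lemma coeFn_modeLp (K : Fin 3 → ℤ) : modeLp L K =ᵐ[volume] mode L K :=
  ContinuousMap.coeFn_toLp _ _

lemma inner_modeLp (K J : Fin 3 → ℤ) :
    inner ℂ (modeLp L K) (modeLp L J) = if K = J then (L : ℂ) ^ 3 else 0 := by
  unfold modeLp
  rw [ContinuousMap.inner_toLp]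
  have : (fun x => mode L J x * conj (mode L K x)) = fun x => mode L (J - K) x := by
    ext x; rw [mode_sub, mul_comm]
  rw [this, integral_mode]
  simp [sub_eq_zero, eq_comm]

/-- The side length to the power `3 / 2`, the `L²` norm of a mode. -/
noncomputable def modeNorm : ℝ := √(L ^ 3)

lemma modeNorm_sq : modeNorm L ^ 2 = L ^ 3 := Real.sq_sqrt (pow_pos hL.out 3).le

lemma modeNorm_pos : 0 < modeNorm L := Real.sqrt_pos.2 (pow_pos hL.out 3)

lemma modeNorm_sq_complex : (modeNorm L : ℂ) ^ 2 = (L : ℂ) ^ 3 := by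
  exact_mod_cast modeNorm_sq L

lemma orthonormal_modes :
    Orthonormal ℂ (fun K => ((modeNorm L : ℂ))⁻¹ • modeLp L K) := by
  rw [orthonormal_iff_ite]
  intro K J
  have h0 : (modeNorm L : ℂ) ≠ 0 := by exact_mod_cast (modeNorm_pos L).ne'
  rw [inner_smul_left, inner_smul_right, inner_modeLp, ← modeNorm_sq_complex]
  split_ifs
  · simp; field_simp
  · simp

lemma summable_modeLp {a : (Fin 3 → ℤ) → ℂ} (ha : Summable fun K => ‖a K‖ ^ 2) :
    Summable fun K => a K • modeLp L K := by
  have h0 : (modeNorm L : ℂ) ≠ 0 := by exact_mod_cast (modeNorm_pos L).ne'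
  have h := ((orthonormal_modes L).orthogonalFamily.summable_iff_norm_sq_summable a).2 ha
  have h2 := h.const_smul (modeNorm L : ℂ)
  refine h2.congr fun K => ?_
  simp only [LinearIsometry.toSpanSingleton_apply]
  rw [smul_comm, smul_inv_smul₀ h0]

lemma hasSum_series {a : (Fin 3 → ℤ) → ℂ} (ha : Summable fun K => ‖a K‖ ^ 2) :
    HasSum (fun K => a K • modeLp L K) (series L a) :=
  (summable_modeLp L ha).hasSum

lemma inner_modeLp_series {a : (Fin 3 → ℤ) → ℂ} (ha : Summable fun K => ‖a K‖ ^ 2)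
    (K : Fin 3 → ℤ) : inner ℂ (modeLp L K) (series L a) = (L : ℂ) ^ 3 * a K := by
  have h := (hasSum_series L ha).mapL (innerSL ℂ (modeLp L K))
  simp only [innerSL_apply_apply, inner_smul_right, inner_modeLp] at h
  have h2 : HasSum (fun J => a J * if K = J then (L : ℂ) ^ 3 else 0) (a K * (L : ℂ) ^ 3) := by
    convert hasSum_single (f := fun J => a J * if K = J then (L : ℂ) ^ 3 else 0) K ?_ using 1
    · simp
    · intro J hJ; simp [Ne.symm hJ]
  rw [h.unique h2, mul_comm]

/-- Parseval's identity in bilinear form. -/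
lemma hasSum_integral_series_mul {a : (Fin 3 → ℤ) → ℂ} (ha : Summable fun K => ‖a K‖ ^ 2)
    {φ : Torus L → ℂ} (hφ : MemLp φ 2 volume) :
    HasSum (fun K => a K * ∫ x, mode L K x * φ x) (∫ x, series L a x * φ x) := by
  have key : ∀ ψ : Lp ℂ 2 (volume : Measure (Torus L)),
      inner ℂ (hφ.star.toLp _) ψ = ∫ x, ψ x * φ x := by
    intro ψ
    rw [L2.inner_def]
    refine integral_congr_ae ?_
    filter_upwards [hφ.star.coeFn_toLp] with x hx
    rw [hx]
    simp
  have h := (hasSum_series L ha).mapL (innerSL ℂ (hφ.star.toLp _))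
  simp only [innerSL_apply_apply, inner_smul_right] at h
  simp only [key] at h
  have e : ∀ K, ∫ x, modeLp L K x * φ x = ∫ x, mode L K x * φ x := fun K => by
    refine integral_congr_ae ?_
    filter_upwards [coeFn_modeLp L K] with x hx
    rw [hx]
  simpa only [e] using h

lemma integral_mode_mul_series {a : (Fin 3 → ℤ) → ℂ} (ha : Summable fun K => ‖a K‖ ^ 2)
    (K : Fin 3 → ℤ) : ∫ x, conj (mode L K x) * series L a x = (L : ℂ) ^ 3 * a K := by
  rw [← inner_modeLp_series L ha, L2.inner_def]
  refine integral_congr_ae ?_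
  filter_upwards [coeFn_modeLp L K] with x hx
  simp only [RCLike.inner_apply, hx]; ring

/-- Bessel's inequality. -/
lemma bessel {φ : Torus L → ℂ} (hφ : MemLp φ 2 volume) :
    Summable (fun K => ‖∫ x, conj (mode L K x) * φ x‖ ^ 2) ∧
      ∑' K, ‖∫ x, conj (mode L K x) * φ x‖ ^ 2 ≤ L ^ 3 * ∫ x, ‖φ x‖ ^ 2 := by
  have key : ∀ K, inner ℂ (modeLp L K) (hφ.toLp φ) = ∫ x, conj (mode L K x) * φ x := by
    intro K
    rw [L2.inner_def]
    refine integral_congr_ae ?_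
    filter_upwards [hφ.coeFn_toLp, coeFn_modeLp L K] with x hx hx'
    rw [hx, hx', RCLike.inner_apply, mul_comm]
  have key2 : ∀ K, ‖inner ℂ (((modeNorm L : ℂ))⁻¹ • modeLp L K) (hφ.toLp φ)‖ ^ 2 =
      (L ^ 3)⁻¹ * ‖∫ x, conj (mode L K x) * φ x‖ ^ 2 := by
    intro K
    rw [inner_smul_left, key, norm_mul, mul_pow, ← modeNorm_sq L]
    simp
  have hn : ‖hφ.toLp φ‖ ^ 2 = ∫ x, ‖φ x‖ ^ 2 := by
    have := L2.inner_def (𝕜 := ℂ) (hφ.toLp φ) (hφ.toLp φ)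
    rw [inner_self_eq_norm_sq_to_K] at this
    have h2 : ∫ x, inner ℂ (hφ.toLp φ x) (hφ.toLp φ x) = ((∫ x, ‖φ x‖ ^ 2 : ℝ) : ℂ) := by
      rw [← integral_complex_ofReal]
      refine integral_congr_ae ?_
      filter_upwards [hφ.coeFn_toLp] with x hx
      rw [hx, inner_self_eq_norm_sq_to_K]; simp
    rw [h2] at this
    exact Complex.ofReal_injective (by simpa using this)
  have h3 : (0 : ℝ) < L ^ 3 := pow_pos hL.out 3
  have hs := (orthonormal_modes L).inner_products_summable (hφ.toLp φ)
  have hle := (orthonormal_modes L).tsum_inner_products_le (hφ.toLp φ)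
  simp only [key2] at hs hle
  refine ⟨?_, ?_⟩
  · have := hs.mul_left (L ^ 3)
    refine this.congr fun K => ?_
    rw [mul_inv_cancel_left₀ h3.ne']
  · rw [tsum_mul_left, hn, inv_mul_le_iff₀ h3] at hle
    exact hle

lemma memLp_series (a : (Fin 3 → ℤ) → ℂ) : MemLp (series L a) 2 volume := Lp.memLp _

lemma memLp_mode_mul {φ : Torus L → ℂ} {p : ℝ≥0∞} (hφ : MemLp φ p volume) (K : Fin 3 → ℤ) :
    MemLp (fun x => mode L K x * φ x) p volume :=
  hφ.of_le ((mode L K).continuous.aestronglyMeasurable.mul hφ.1) (ae_of_all _ fun x => by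
    simp [norm_mode])

lemma memLp_conj_mode_mul {φ : Torus L → ℂ} {p : ℝ≥0∞} (hφ : MemLp φ p volume) (K : Fin 3 → ℤ) :
    MemLp (fun x => conj (mode L K x) * φ x) p volume := by
  simpa only [mode_neg] using memLp_mode_mul L hφ (-K)

/-- The Fourier coefficients of a product are given by a convolution. -/
lemma hasSum_integral_mode_mul_mul {a b : (Fin 3 → ℤ) → ℂ} (ha : Summable fun K => ‖a K‖ ^ 2)
    (hb : Summable fun K => ‖b K‖ ^ 2) (K : Fin 3 → ℤ) :
    HasSum (fun J => (L : ℂ) ^ 3 * (a (K - J) * b J))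
      (∫ x, conj (mode L K x) * (series L a x * series L b x)) := by
  have h := hasSum_integral_series_mul L hb (memLp_conj_mode_mul L (memLp_series L a) K)
  convert h using 1
  · ext J
    have : ∀ x, mode L J x * (conj (mode L K x) * series L a x) =
        conj (mode L (K - J) x) * series L a x := by
      intro x; rw [mode_sub]; simp; ring
    simp only [this]
    rw [integral_mode_mul_series L ha]; ring
  · congr 1; ext x; ring

lemma integral_norm_sq_series {a : (Fin 3 → ℤ) → ℂ} (ha : Summable fun K => ‖a K‖ ^ 2) :
    ∫ x, ‖series L a x‖ ^ 2 = L ^ 3 * ∑' K, ‖a K‖ ^ 2 := by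
  have hφ : MemLp (fun x => conj (series L a x)) 2 volume := (memLp_series L a).star
  have h := hasSum_integral_series_mul L ha hφ
  have e1 : ∀ K, a K * ∫ x, mode L K x * conj (series L a x) = ((L ^ 3 * ‖a K‖ ^ 2 : ℝ) : ℂ) := by
    intro K
    have : ∫ x, mode L K x * conj (series L a x) =
        conj (∫ x, conj (mode L K x) * series L a x) := by
      rw [← integral_conj]; congr 1; ext x; simp
    rw [this, integral_mode_mul_series L ha]
    simp only [map_mul, map_pow, Complex.conj_ofReal]
    push_cast
    rw [← Complex.mul_conj']; ring
  have e2 : ∫ x, series L a x * conj (series L a x) = ((∫ x, ‖series L a x‖ ^ 2 : ℝ) : ℂ) := by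
    rw [← integral_complex_ofReal]; congr 1; ext x
    simp [Complex.mul_conj']
  simp only [e1] at h
  rw [e2] at h
  have h' := (Complex.hasSum_ofReal).1 h
  rw [← h'.tsum_eq, tsum_mul_left]

lemma series_sub {a b : (Fin 3 → ℤ) → ℂ} (ha : Summable fun K => ‖a K‖ ^ 2)
    (hb : Summable fun K => ‖b K‖ ^ 2) :
    series L (fun K => a K - b K) = series L a - series L b := by
  have h := (hasSum_series L ha).sub (hasSum_series L hb)
  simp only [← sub_smul] at h
  exact h.tsum_eq

lemma series_finset {a : (Fin 3 → ℤ) → ℂ} {S : Finset (Fin 3 → ℤ)} (ha : ∀ K ∉ S, a K = 0) :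
    series L a =ᵐ[volume] fun x => ∑ K ∈ S, a K * mode L K x := by
  have h : series L a = ∑ K ∈ S, a K • modeLp L K :=
    tsum_eq_sum (f := fun K => a K • modeLp L K) fun K hK => by simp [ha K hK]
  rw [h]
  have h1 : ∀ᵐ x : Torus L, ∀ K ∈ S, (a K • modeLp L K : Lp ℂ 2 _) x = a K * mode L K x := by
    rw [Finset.eventually_all]
    intro K _
    filter_upwards [Lp.coeFn_smul (a K) (modeLp L K), coeFn_modeLp L K] with x hx hx'
    rw [hx, Pi.smul_apply, hx', smul_eq_mul]
  filter_upwards [Lp.coeFn_finsetSum S (fun K => a K • modeLp L K), h1] with x hx hx'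
  rw [hx, Finset.sum_apply]
  exact Finset.sum_congr rfl fun K hK => hx' K hK

end Modes

/-! ### Wave numbers, truncation to cubes, and lattice counting. -/

lemma kabs_nonneg (K : Fin 3 → ℤ) : 0 ≤ kabs K := Real.sqrt_nonneg _

lemma kabs_sq (K : Fin 3 → ℤ) : kabs K ^ 2 = ∑ i, (K i : ℝ) ^ 2 :=
  Real.sq_sqrt (Finset.sum_nonneg fun _ _ => sq_nonneg _)

lemma kabs_zero : kabs 0 = 0 := by simp [kabs]

lemma abs_le_kabs (K : Fin 3 → ℤ) (i : Fin 3) : |(K i : ℝ)| ≤ kabs K := by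
  refine abs_le_of_sq_le_sq ?_ (kabs_nonneg K)
  rw [kabs_sq]
  exact Finset.single_le_sum (f := fun i => (K i : ℝ) ^ 2) (fun _ _ => sq_nonneg _)
    (Finset.mem_univ i)

lemma one_le_kabs {K : Fin 3 → ℤ} (hK : K ≠ 0) : 1 ≤ kabs K := by
  obtain ⟨i, hi⟩ := Function.ne_iff.1 hK
  refine le_trans ?_ (abs_le_kabs K i)
  exact_mod_cast Int.one_le_abs hi

/-- The Sobolev space of mean-zero fields with one derivative in `L²`. -/
structure IsH1 (u : VField) : Prop where
  mean_zero : u 0 = 0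
  summable : Summable fun K => kabs K ^ 2 * ‖u K‖ ^ 2

lemma norm_sq_le_kabs {u : VField} (h0 : u 0 = 0) (K : Fin 3 → ℤ) :
    ‖u K‖ ^ 2 ≤ kabs K ^ 2 * ‖u K‖ ^ 2 := by
  by_cases hK : K = 0
  · subst hK; simp [h0]
  · exact le_mul_of_one_le_left (sq_nonneg _) (one_le_pow₀ (one_le_kabs hK))

lemma IsH1.summable_sq {u : VField} (hu : IsH1 u) : Summable fun K => ‖u K‖ ^ 2 :=
  hu.summable.of_nonneg_of_le (fun _ => sq_nonneg _) (norm_sq_le_kabs hu.mean_zero)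

lemma summable_sq_add {ι E : Type*} [NormedAddCommGroup E] {w : ι → ℝ} (hw : ∀ K, 0 ≤ w K)
    {u v : ι → E} (hu : Summable fun K => w K * ‖u K‖ ^ 2)
    (hv : Summable fun K => w K * ‖v K‖ ^ 2) : Summable fun K => w K * ‖u K + v K‖ ^ 2 := by
  refine ((hu.add hv).mul_left 2).of_nonneg_of_le (fun K => mul_nonneg (hw K) (sq_nonneg _))
    fun K => ?_
  have h1 : ‖u K + v K‖ ^ 2 ≤ 2 * (‖u K‖ ^ 2 + ‖v K‖ ^ 2) := by
    nlinarith [norm_add_le (u K) (v K), norm_nonneg (u K + v K), sq_nonneg (‖u K‖ - ‖v K‖),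
      norm_nonneg (u K), norm_nonneg (v K)]
  nlinarith [hw K]

lemma IsH1.add {u v : VField} (hu : IsH1 u) (hv : IsH1 v) : IsH1 (u + v) :=
  ⟨by simp [hu.mean_zero, hv.mean_zero],
    summable_sq_add (fun _ => sq_nonneg _) hu.summable hv.summable⟩

lemma IsH1.neg {u : VField} (hu : IsH1 u) : IsH1 (-u) :=
  ⟨by simp [hu.mean_zero], by simpa using hu.summable⟩

lemma IsH1.sub {u v : VField} (hu : IsH1 u) (hv : IsH1 v) : IsH1 (u - v) := by
  rw [sub_eq_add_neg]; exact hu.add hv.neg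

lemma norm_coord_le (x : EuclideanSpace ℂ (Fin 3)) (j : Fin 3) : ‖x j‖ ≤ ‖x‖ :=
  PiLp.norm_apply_le x j

lemma summable_coord {u : VField} (hu : Summable fun K => ‖u K‖ ^ 2) (j : Fin 3) :
    Summable fun K => ‖u K j‖ ^ 2 :=
  hu.of_nonneg_of_le (fun _ => sq_nonneg _) fun _ =>
    pow_le_pow_left₀ (norm_nonneg _) (norm_coord_le _ _) 2

/-- The restriction of a field to a set of modes. -/
def restr (S : Finset (Fin 3 → ℤ)) (u : VField) : VField := fun K => if K ∈ S then u K else 0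

lemma norm_restr_le (S : Finset (Fin 3 → ℤ)) (u : VField) (K : Fin 3 → ℤ) :
    ‖restr S u K‖ ≤ ‖u K‖ := by
  unfold restr; split_ifs <;> simp

lemma IsH1.restrict_modes {u : VField} (hu : IsH1 u) (S : Finset (Fin 3 → ℤ)) :
    IsH1 (restr S u) := by
  refine ⟨by simp [restr, hu.mean_zero], hu.summable.of_nonneg_of_le
    (fun _ => by positivity) fun K => ?_⟩
  gcongr
  exact norm_restr_le S u K

/-- The wave numbers with entries of absolute value at most `m`. -/
noncomputable def box (m : ℕ) : Finset (Fin 3 → ℤ) :=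
  Fintype.piFinset fun _ => Finset.Icc (-(m : ℤ)) m

lemma mem_box {m : ℕ} {K : Fin 3 → ℤ} : K ∈ box m ↔ ∀ i, |K i| ≤ m := by
  simp [box, abs_le]

lemma box_mono {m n : ℕ} (h : m ≤ n) : box m ⊆ box n := fun K hK =>
  mem_box.2 fun i => (mem_box.1 hK i).trans (by exact_mod_cast h)

lemma card_box (m : ℕ) : (box m).card = (2 * m + 1) ^ 3 := by
  simp only [box, Fintype.card_piFinset, Int.card_Icc, Finset.prod_const, Finset.card_univ,
    Fintype.card_fin]
  congr 1; omega

lemma tendsto_box : Tendsto box atTop atTop := by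
  refine tendsto_atTop_finset_of_monotone (fun m n h => box_mono h) fun K => ?_
  refine ⟨∑ i, (K i).natAbs, mem_box.2 fun i => ?_⟩
  rw [Int.abs_eq_natAbs]
  exact_mod_cast Finset.single_le_sum (f := fun i => (K i).natAbs) (fun _ _ => Nat.zero_le _)
    (Finset.mem_univ i)

/-- The shell `box (m + 1) \ box m` has 24(m + 1)² + 2 points, all of length at least m + 1, so each
shell adds at most 26. With cubes in place of balls the count is exact. -/
lemma sum_box_inv_sq_le (m : ℕ) : ∑ K ∈ box m, (kabs K ^ 2)⁻¹ ≤ 26 * m := by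
  induction m with
  | zero =>
    refine le_of_eq (Finset.sum_eq_zero fun K hK => ?_) |>.trans (by simp)
    have : K = 0 := by
      ext i
      have := mem_box.1 hK i
      simpa using this
    simp [this, kabs_zero]
  | succ m ih =>
    rw [← Finset.sum_sdiff (box_mono (Nat.le_succ m))]
    have h1 : ∀ K ∈ box (m + 1) \ box m, (kabs K ^ 2)⁻¹ ≤ (((m : ℝ) + 1) ^ 2)⁻¹ := by
      intro K hK
      have hK' := (Finset.mem_sdiff.1 hK).2
      rw [mem_box] at hK'
      push Not at hK'
      obtain ⟨i, hi⟩ := hK'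
      have h2 : (m : ℝ) + 1 ≤ kabs K := by
        refine le_trans ?_ (abs_le_kabs K i)
        exact_mod_cast hi
      gcongr
    have h3 := Finset.sum_le_card_nsmul _ _ _ h1
    have h4 : ((box (m + 1) \ box m).card : ℝ) = 24 * (m + 1) ^ 2 + 2 := by
      rw [Finset.card_sdiff_of_subset (box_mono (Nat.le_succ m)), Nat.cast_sub
        (Finset.card_le_card (box_mono (Nat.le_succ m))), card_box, card_box]
      push_cast; ring
    rw [nsmul_eq_mul, h4] at h3
    have h5 : (24 * ((m : ℝ) + 1) ^ 2 + 2) * (((m : ℝ) + 1) ^ 2)⁻¹ ≤ 26 := by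
      rw [← div_eq_mul_inv, div_le_iff₀ (by positivity)]
      nlinarith [(Nat.cast_nonneg m : (0 : ℝ) ≤ m)]
    push_cast
    linarith

/-- `K` lies outside `box m` exactly when m is below the largest |K i|. Summing the squared
truncation errors over m therefore weights ‖u K‖² by at most |K|, that is, by half a derivative in
each factor. -/
lemma card_filter_notMem_box_le (K : Fin 3 → ℤ) (M : ℕ) :
    (((Finset.range M).filter fun m => K ∉ box m).card : ℝ) ≤ kabs K := by
  obtain ⟨i, -, hi⟩ := Finset.exists_mem_eq_sup Finset.univ Finset.univ_nonempty
    fun i => (K i).natAbs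
  have hle : ((Finset.range M).filter fun m => K ∉ box m) ⊆ Finset.range (K i).natAbs := by
    intro m hm
    have h := (Finset.mem_filter.1 hm).2
    rw [mem_box] at h
    push Not at h
    obtain ⟨j, hj⟩ := h
    rw [Int.abs_eq_natAbs] at hj
    have h2 : (K j).natAbs ≤ (K i).natAbs := hi ▸ Finset.le_sup (f := fun i => (K i).natAbs)
      (Finset.mem_univ j)
    rw [Finset.mem_range]; omega
  have h3 := Finset.card_le_card hle
  rw [Finset.card_range] at h3
  calc _ ≤ (((K i).natAbs : ℕ) : ℝ) := by exact_mod_cast h3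
    _ = |(K i : ℝ)| := by rw [← Int.cast_natCast, Int.natCast_natAbs, Int.cast_abs]
    _ ≤ kabs K := abs_le_kabs K i

/-- A discrete layer-cake bound for the fourth power. -/
lemma pow_four_le_sum {a T : ℝ} (ha : 0 ≤ a) (hT : 0 ≤ T) {d : ℕ → ℝ} (hd : ∀ m, 0 ≤ d m)
    (h : ∀ m : ℕ, a ≤ √(m * T) + d m) {M : ℕ} (hM : a ≤ √(M * T)) :
    a ^ 4 ≤ 6 * T * ∑ m ∈ Finset.range M, d m ^ 2 := by
  -- The polynomial 6a²s² - 8as³ + 3s⁴ is the integral of 12r(a - r)² over [0, s], and it equals a⁴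
  -- at s = a. The knots s = min(√(mT), a) have squares at most T apart, and a - r ≤ a - s ≤ d m
  -- beyond the knot s.
  have key : ∀ m : ℕ, 6 * a ^ 2 * min √(m * T) a ^ 2 - 8 * a * min √(m * T) a ^ 3
      + 3 * min √(m * T) a ^ 4 ≤ 6 * T * ∑ k ∈ Finset.range m, d k ^ 2 := by
    intro m
    induction m with
    | zero => simp [ha]
    | succ m ih =>
      rw [Finset.sum_range_succ]
      set s := min √(m * T) a with hs
      set t := min √(((m + 1 : ℕ) : ℝ) * T) a with ht
      have hs0 : 0 ≤ s := le_min (Real.sqrt_nonneg _) ha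
      have hst : s ≤ t := by
        refine min_le_min_right _ (Real.sqrt_le_sqrt ?_)
        push_cast; nlinarith
      have hta : t ≤ a := min_le_right _ _
      have hts : t ^ 2 - s ^ 2 ≤ T := by
        rcases le_total a √(m * T) with h1 | h1
        · rw [hs, min_eq_right h1]; nlinarith
        · rw [hs, min_eq_left h1, Real.sq_sqrt (by positivity)]
          have h2 : t ^ 2 ≤ ((m + 1 : ℕ) : ℝ) * T := by
            rw [← Real.sq_sqrt (by positivity : 0 ≤ ((m + 1 : ℕ) : ℝ) * T)]
            exact pow_le_pow_left₀ (hs0.trans hst) (min_le_left _ _) 2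
          push_cast at h2; linarith
      have had : a - s ≤ d m := by
        rcases le_total a √(m * T) with h1 | h1
        · rw [hs, min_eq_right h1]; simpa using hd m
        · rw [hs, min_eq_left h1]; linarith [h m]
      have h3 : (6 * a ^ 2 * t ^ 2 - 8 * a * t ^ 3 + 3 * t ^ 4)
          - (6 * a ^ 2 * s ^ 2 - 8 * a * s ^ 3 + 3 * s ^ 4) ≤ 6 * (t ^ 2 - s ^ 2) * (a - s) ^ 2 := by
        clear_value s t
        -- In the increments p = t - s and q = a - t the difference of the two sides is a polynomial
        -- with nonnegative coefficients.
        obtain ⟨p, rfl⟩ : ∃ p, t = s + p := ⟨t - s, by ring⟩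
        obtain ⟨q, rfl⟩ : ∃ q, a = s + p + q := ⟨a - (s + p), by ring⟩
        have hp : 0 ≤ p := by linarith
        have hq : 0 ≤ q := by linarith
        have : 0 ≤ s * (8 * p ^ 3 + 12 * q * p ^ 2) + 5 * p ^ 4 + 8 * q * p ^ 3 := by positivity
        linarith
      have h4 : (t ^ 2 - s ^ 2) * (a - s) ^ 2 ≤ T * d m ^ 2 := by
        have : (a - s) ^ 2 ≤ d m ^ 2 := pow_le_pow_left₀ (by linarith) had 2
        exact mul_le_mul hts this (sq_nonneg _) hT
      linarith
  have := key M
  rw [min_eq_right hM] at this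
  linarith

/-! ### Fields as functions: Parseval, and the fourth power of trigonometric polynomials. -/

section Values

variable (L : ℝ) [hL : Fact (0 < L)]

lemma aestronglyMeasurable_value (u : VField) :
    AEStronglyMeasurable (value L u) (volume : Measure (Torus L)) := by
  have h : AEStronglyMeasurable (fun x => fun j => series L (fun K => u K j) x)
      (volume : Measure (Torus L)) :=
    (aemeasurable_pi_iff.2 fun j => (memLp_series L _).1.aemeasurable).aestronglyMeasurable
  exact (PiLp.continuous_toLp 2 _).comp_aestronglyMeasurable h

lemma memLp_value_coord (u : VField) (j : Fin 3) :
    MemLp (fun x => value L u x j) 2 (volume : Measure (Torus L)) := memLp_series L _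

lemma memLp_of_coord {p : ℝ≥0∞} {f : Torus L → EuclideanSpace ℂ (Fin 3)}
    (hf : AEStronglyMeasurable f volume) (h : ∀ j, MemLp (fun x => f x j) p volume) :
    MemLp f p volume := by
  have h1 : MemLp (fun x => ∑ j, ‖f x j‖) p volume :=
    memLp_finsetSum _ fun j _ => (h j).norm
  refine h1.of_le hf (ae_of_all _ fun x => ?_)
  rw [Real.norm_of_nonneg (Finset.sum_nonneg fun _ _ => norm_nonneg _), EuclideanSpace.norm_eq]
  refine Real.sqrt_le_iff.2 ⟨Finset.sum_nonneg fun _ _ => norm_nonneg _, ?_⟩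
  exact Finset.sum_sq_le_sq_sum_of_nonneg fun _ _ => norm_nonneg _

lemma memLp_value (u : VField) : MemLp (value L u) 2 (volume : Measure (Torus L)) :=
  memLp_of_coord L (aestronglyMeasurable_value L u) (memLp_value_coord L u)

lemma integral_norm_sq_value {u : VField} (hu : Summable fun K => ‖u K‖ ^ 2) :
    ∫ x : Torus L, ‖value L u x‖ ^ 2 = L ^ 3 * ∑' K, ‖u K‖ ^ 2 := by
  simp only [EuclideanSpace.norm_sq_eq]
  rw [integral_finsetSum _ fun j _ => (memLp_value_coord L u j).integrable_norm_pow two_ne_zero,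
    Summable.tsum_finsetSum fun j _ => summable_coord hu j, Finset.mul_sum]
  exact Finset.sum_congr rfl fun j _ => integral_norm_sq_series L (summable_coord hu j)

lemma value_sub {u v : VField} (hu : Summable fun K => ‖u K‖ ^ 2)
    (hv : Summable fun K => ‖v K‖ ^ 2) :
    value L (u - v) =ᵐ[volume] fun x => value L u x - value L v x := by
  have h : ∀ j : Fin 3, ∀ᵐ x : Torus L, value L (u - v) x j = value L u x j - value L v x j := by
    intro j
    have := series_sub L (summable_coord hu j) (summable_coord hv j)
    filter_upwards [Lp.coeFn_sub (series L fun K => u K j) (series L fun K => v K j)] with x hx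
    rw [← this] at hx
    exact hx
  filter_upwards [ae_all_iff.2 h] with x hx
  ext j; exact hx j

lemma value_finset {u : VField} {S : Finset (Fin 3 → ℤ)} (hu : ∀ K ∉ S, u K = 0) :
    value L u =ᵐ[volume] fun x => ∑ K ∈ S, mode L K x • u K := by
  have h : ∀ j : Fin 3, ∀ᵐ x : Torus L, value L u x j = ∑ K ∈ S, u K j * mode L K x :=
    fun j => series_finset L fun K hK => by simp [hu K hK]
  filter_upwards [ae_all_iff.2 h] with x hx
  ext j
  rw [hx j]
  simp [mul_comm]

/-- Cauchy–Schwarz against the weights |K|⁻¹, whose squares sum to at most 26m over the cube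
(`sum_box_inv_sq_le`). -/
lemma norm_value_le {u : VField} (h0 : u 0 = 0) {m : ℕ} (hu : ∀ K ∉ box m, u K = 0) {D : ℝ}
    (hD : ∑ K ∈ box m, kabs K ^ 2 * ‖u K‖ ^ 2 ≤ D) :
    ∀ᵐ x : Torus L, ‖value L u x‖ ≤ √(m * (26 * D)) := by
  filter_upwards [value_finset L hu] with x hx
  rw [hx]
  refine Real.le_sqrt_of_sq_le ?_
  have h1 : ‖∑ K ∈ box m, mode L K x • u K‖ ≤ ∑ K ∈ box m, (kabs K)⁻¹ * (kabs K * ‖u K‖) := by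
    refine (norm_sum_le _ _).trans (Finset.sum_le_sum fun K _ => ?_)
    rw [norm_smul, norm_mode, one_mul]
    by_cases hK : K = 0
    · subst hK; simp [h0]
    · rw [inv_mul_cancel_left₀ (by linarith [one_le_kabs hK])]
  calc ‖∑ K ∈ box m, mode L K x • u K‖ ^ 2
      ≤ (∑ K ∈ box m, (kabs K)⁻¹ * (kabs K * ‖u K‖)) ^ 2 :=
        pow_le_pow_left₀ (norm_nonneg _) h1 2
    _ ≤ (∑ K ∈ box m, (kabs K)⁻¹ ^ 2) * ∑ K ∈ box m, (kabs K * ‖u K‖) ^ 2 :=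
        Finset.sum_mul_sq_le_sq_mul_sq _ _ _
    _ ≤ (26 * m) * D := by
        refine mul_le_mul ?_ ?_ (Finset.sum_nonneg fun _ _ => sq_nonneg _) (by positivity)
        · simpa only [inv_pow] using sum_box_inv_sq_le m
        · simpa only [mul_pow] using hD
    _ = _ := by ring

/-- Writing u as its truncation to `box m` plus a remainder gives |u| ≤ √(26mD) + |remainder|
pointwise. `pow_four_le_sum` with T = 26D bounds |u|⁴ by the squared remainders summed over m, whose
integrals add up to at most L³ ∑ |K|‖u K‖². Cauchy–Schwarz finishes; 156 = 6 · 26. -/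
lemma integral_pow_four_le_of_finite {u : VField} (h0 : u 0 = 0) {M : ℕ}
    (hu : ∀ K ∉ box M, u K = 0) :
    MemLp (value L u) 4 (volume : Measure (Torus L)) ∧
    ∫ x : Torus L, ‖value L u x‖ ^ 4 ≤
      156 * L ^ 3 * √(∑ K ∈ box M, ‖u K‖ ^ 2) * √(∑ K ∈ box M, kabs K ^ 2 * ‖u K‖ ^ 2) ^ 3 := by
  set D := ∑ K ∈ box M, kabs K ^ 2 * ‖u K‖ ^ 2 with hD
  have hD0 : 0 ≤ D := Finset.sum_nonneg fun _ _ => by positivity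
  have hsum : ∀ v : VField, (∀ K, ‖v K‖ ≤ ‖u K‖) → Summable fun K => ‖v K‖ ^ 2 := fun v hv =>
    summable_of_hasFiniteSupport ((box M).finite_toSet.subset fun K hK => by
      by_contra hK'
      apply hK
      have := hv K
      rw [hu K hK', norm_zero] at this
      simp [le_antisymm this (norm_nonneg _)])
  have hbd := norm_value_le L h0 hu le_rfl
  have hmem : MemLp (value L u) 4 (volume : Measure (Torus L)) :=
    MemLp.of_bound (aestronglyMeasurable_value L u) _ hbd
  refine ⟨hmem, ?_⟩
  have hsub : ∀ m K, ‖(u - restr (box m) u) K‖ ≤ ‖u K‖ := by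
    intro m K
    simp only [Pi.sub_apply, restr]; split_ifs <;> simp
  have hres : ∀ m : ℕ, ∀ᵐ x : Torus L,
      ‖value L u x‖ ≤ √(m * (26 * D)) + ‖value L (u - restr (box m) u) x‖ := by
    intro m
    have h1 : ∑ K ∈ box m, kabs K ^ 2 * ‖restr (box m) u K‖ ^ 2 ≤ D := by
      calc ∑ K ∈ box m, kabs K ^ 2 * ‖restr (box m) u K‖ ^ 2
          ≤ ∑ K ∈ box m ∪ box M, kabs K ^ 2 * ‖u K‖ ^ 2 := by
            refine (Finset.sum_le_sum fun K _ => ?_).trans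
              (Finset.sum_le_sum_of_subset_of_nonneg Finset.subset_union_left
                fun _ _ _ => by positivity)
            gcongr
            exact norm_restr_le _ _ _
        _ = D := by
            refine (Finset.sum_subset Finset.subset_union_right fun K _ hK => ?_).symm
            simp [hu K hK]
    filter_upwards [norm_value_le L (u := restr (box m) u) (by simp [restr, h0])
      (fun K hK => by simp [restr, hK]) h1, value_sub L (hsum u fun _ => le_rfl)
      (hsum _ (norm_restr_le (box m) u))] with x hx1 hx2
    rw [hx2]
    have := norm_add_le (value L (restr (box m) u) x) (value L u x - value L (restr (box m) u) x)
    rw [add_sub_cancel] at this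
    linarith
  have hpt : ∀ᵐ x : Torus L, ‖value L u x‖ ^ 4 ≤ 6 * (26 * D) *
      ∑ m ∈ Finset.range M, ‖value L (u - restr (box m) u) x‖ ^ 2 := by
    filter_upwards [ae_all_iff.2 hres, hbd] with x hx1 hx2
    exact pow_four_le_sum (norm_nonneg _) (by positivity) (fun _ => norm_nonneg _) hx1 hx2
  have hint : ∀ m, Integrable (fun x : Torus L => ‖value L (u - restr (box m) u) x‖ ^ 2) :=
    fun m => (memLp_value L _).integrable_norm_pow two_ne_zero
  have h2 : ∑ m ∈ Finset.range M, ∑' K, ‖(u - restr (box m) u) K‖ ^ 2 ≤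
      ∑ K ∈ box M, ‖u K‖ * (kabs K * ‖u K‖) := by
    have h3 : ∀ m, ∑' K, ‖(u - restr (box m) u) K‖ ^ 2 =
        ∑ K ∈ box M, if K ∉ box m then ‖u K‖ ^ 2 else 0 := by
      intro m
      rw [tsum_eq_sum (s := box M) fun K hK => by simp [restr, hu K hK]]
      refine Finset.sum_congr rfl fun K _ => ?_
      by_cases hK : K ∈ box m <;> simp [restr, hK]
    simp only [h3]
    rw [Finset.sum_comm]
    refine Finset.sum_le_sum fun K _ => ?_
    rw [← Finset.sum_filter, Finset.sum_const, nsmul_eq_mul]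
    nlinarith [card_filter_notMem_box_le K M, sq_nonneg ‖u K‖]
  have h4 : ∑ K ∈ box M, ‖u K‖ * (kabs K * ‖u K‖) ≤ √(∑ K ∈ box M, ‖u K‖ ^ 2) * √D := by
    have := Real.sum_mul_le_sqrt_mul_sqrt (box M) (fun K => ‖u K‖) (fun K => kabs K * ‖u K‖)
    simpa only [mul_pow] using this
  calc ∫ x : Torus L, ‖value L u x‖ ^ 4
      ≤ ∫ x : Torus L, 6 * (26 * D) *
        ∑ m ∈ Finset.range M, ‖value L (u - restr (box m) u) x‖ ^ 2 :=
        integral_mono_ae (hmem.integrable_norm_pow four_ne_zero)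
          ((integrable_finsetSum _ fun m _ => hint m).const_mul _) hpt
    _ = 6 * (26 * D) * (L ^ 3 *
        ∑ m ∈ Finset.range M, ∑' K, ‖(u - restr (box m) u) K‖ ^ 2) := by
        rw [integral_const_mul, integral_finsetSum _ fun m _ => hint m, Finset.mul_sum (a := L ^ 3)]
        congr 1
        exact Finset.sum_congr rfl fun m _ => integral_norm_sq_value L (hsum _ (hsub m))
    _ ≤ 6 * (26 * D) * (L ^ 3 * (√(∑ K ∈ box M, ‖u K‖ ^ 2) * √D)) := by
        have := hL.out
        gcongr
        exact h2.trans h4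
    _ = _ := by
        nth_rewrite 1 [← Real.sq_sqrt hD0]
        ring

end Values

/-! ### The norms of H and V as Fourier sums. -/

section Norms

variable (L : ℝ) [hL : Fact (0 < L)]

lemma vnorm_nonneg (s : ℕ) (u : VField) : 0 ≤ vnorm L s u := Real.sqrt_nonneg _

lemma vnorm_sq (s : ℕ) (u : VField) :
    vnorm L s u ^ 2 = L ^ 3 * ∑' K, (2 * Real.pi * kabs K / L) ^ (2 * s) * ‖u K‖ ^ 2 := by
  refine Real.sq_sqrt (mul_nonneg (pow_pos hL.out 3).le (tsum_nonneg fun K => ?_))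
  rw [pow_mul]; positivity

lemma vnorm_zero_sq (u : VField) : vnorm L 0 u ^ 2 = L ^ 3 * ∑' K, ‖u K‖ ^ 2 := by
  rw [vnorm_sq]; simp

lemma vnorm_one_sq (u : VField) :
    vnorm L 1 u ^ 2 = L ^ 3 * ((2 * Real.pi / L) ^ 2 * ∑' K, kabs K ^ 2 * ‖u K‖ ^ 2) := by
  rw [vnorm_sq, ← tsum_mul_left (a := (2 * Real.pi / L) ^ 2)]
  exact congrArg _ (tsum_congr fun K => by ring)

lemma vnorm_zero_eq (u : VField) : vnorm L 0 u = √(L ^ 3) * √(∑' K, ‖u K‖ ^ 2) := by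
  rw [← Real.sqrt_mul (pow_pos hL.out 3).le, ← vnorm_zero_sq, Real.sqrt_sq (vnorm_nonneg L 0 u)]

lemma vnorm_one_eq (u : VField) :
    vnorm L 1 u = √(L ^ 3) * (2 * Real.pi / L) * √(∑' K, kabs K ^ 2 * ‖u K‖ ^ 2) := by
  have h1 : 0 ≤ 2 * Real.pi / L := div_nonneg (by positivity) hL.out.le
  have h2 : vnorm L 1 u = √(vnorm L 1 u ^ 2) := (Real.sqrt_sq (vnorm_nonneg L 1 u)).symm
  rw [h2, vnorm_one_sq, Real.sqrt_mul (pow_pos hL.out 3).le, Real.sqrt_mul (sq_nonneg _),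
    Real.sqrt_sq h1]
  ring

end Norms

/-! ### Ladyzhenskaya's inequality. -/

section FourthPower

lemma eLpNorm_four_eq {α E : Type*} [MeasurableSpace α] {μ : Measure α} [NormedAddCommGroup E]
    {f : α → E} (hf : MemLp f 4 μ) :
    eLpNorm f 4 μ = ENNReal.ofReal ((∫ x, ‖f x‖ ^ 4 ∂μ) ^ (1 / 4 : ℝ)) := by
  rw [hf.eLpNorm_eq_integral_rpow_norm (by norm_num) (by norm_num)]
  norm_num

lemma integral_pow_four_le_of_eLpNorm_le {α E : Type*} [MeasurableSpace α] {μ : Measure α}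
    [NormedAddCommGroup E] {f : α → E} (hf : AEStronglyMeasurable f μ) {B : ℝ} (hB : 0 ≤ B)
    (h : eLpNorm f 4 μ ≤ ENNReal.ofReal B) : MemLp f 4 μ ∧ ∫ x, ‖f x‖ ^ 4 ∂μ ≤ B ^ 4 := by
  have hm : MemLp f 4 μ := ⟨hf, h.trans_lt ENNReal.ofReal_lt_top⟩
  refine ⟨hm, ?_⟩
  rw [eLpNorm_four_eq hm, ENNReal.ofReal_le_ofReal_iff hB] at h
  have h0 : 0 ≤ ∫ x, ‖f x‖ ^ 4 ∂μ := integral_nonneg fun x => by positivity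
  have := pow_le_pow_left₀ (Real.rpow_nonneg h0 _) h 4
  rwa [← Real.rpow_natCast, ← Real.rpow_mul h0, Nat.cast_ofNat, one_div_mul_cancel (by norm_num),
    Real.rpow_one] at this

variable (L : ℝ) [hL : Fact (0 < L)]

/-- Ladyzhenskaya's inequality on the torus, with constant `1`. -/
lemma IsH1.ladyzhenskaya {u : VField} (hu : IsH1 u) :
    MemLp (value L u) 4 (volume : Measure (Torus L)) ∧
      ∫ x : Torus L, ‖value L u x‖ ^ 4 ≤ vnorm L 0 u * vnorm L 1 u ^ 3 := by
  have hLpos := hL.out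
  set N := ∑' K, ‖u K‖ ^ 2 with hN
  set D := ∑' K, kabs K ^ 2 * ‖u K‖ ^ 2 with hD
  set C := 156 * L ^ 3 * √N * √D ^ 3 with hC
  have hC0 : 0 ≤ C := by positivity
  have hsq := hu.summable_sq
  have hfin : ∀ M, eLpNorm (value L (restr (box M) u)) 4 (volume : Measure (Torus L)) ≤
      ENNReal.ofReal (C ^ (1 / 4 : ℝ)) := by
    intro M
    obtain ⟨h1, h2⟩ := integral_pow_four_le_of_finite L (u := restr (box M) u) (M := M)
      (by simp [restr, hu.mean_zero]) (fun K hK => by simp [restr, hK])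
    rw [eLpNorm_four_eq h1]
    refine ENNReal.ofReal_le_ofReal (Real.rpow_le_rpow
      (integral_nonneg fun x => by positivity) (h2.trans ?_) (by norm_num))
    have e1 : ∑ K ∈ box M, ‖restr (box M) u K‖ ^ 2 ≤ N :=
      (Finset.sum_le_sum fun K _ => pow_le_pow_left₀ (norm_nonneg _) (norm_restr_le _ _ _) 2).trans
        (hsq.sum_le_tsum _ fun _ _ => by positivity)
    have e2 : ∑ K ∈ box M, kabs K ^ 2 * ‖restr (box M) u K‖ ^ 2 ≤ D :=
      (Finset.sum_le_sum fun K _ => mul_le_mul_of_nonneg_left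
        (pow_le_pow_left₀ (norm_nonneg _) (norm_restr_le _ _ _) 2) (sq_nonneg _)).trans
        (hu.summable.sum_le_tsum _ fun _ _ => by positivity)
    rw [hC]; gcongr
  have hlim : Tendsto (fun M => eLpNorm (value L (restr (box M) u) - value L u) 2
      (volume : Measure (Torus L))) atTop (𝓝 0) := by
    have hres : ∀ M, Summable fun K => ‖restr (box M) u K‖ ^ 2 :=
      fun M => (hu.restrict_modes (box M)).summable_sq
    have h1 : ∀ M, eLpNorm (value L (restr (box M) u) - value L u) 2
        (volume : Measure (Torus L)) =
        ENNReal.ofReal (√(L ^ 3 * (N - ∑ K ∈ box M, ‖u K‖ ^ 2))) := by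
      intro M
      have e1 : value L (restr (box M) u) - value L u =ᵐ[volume]
          value L (restr (box M) u - u) := (value_sub L (hres M) hsq).symm
      rw [eLpNorm_congr_ae e1, (memLp_value L _).eLpNorm_eq_integral_rpow_norm (by norm_num)
        (by norm_num)]
      have hle : ∀ K, ‖(restr (box M) u - u) K‖ ≤ ‖u K‖ := by
        intro K
        simp only [Pi.sub_apply, restr]; split_ifs <;> simp
      have e2 := integral_norm_sq_value L (u := restr (box M) u - u)
        (hsq.of_nonneg_of_le (fun _ => by positivity)
          fun K => pow_le_pow_left₀ (norm_nonneg _) (hle K) 2)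
      have e3 : ∑' K, ‖(restr (box M) u - u) K‖ ^ 2 = N - ∑ K ∈ box M, ‖u K‖ ^ 2 := by
        rw [hN, ← hsq.sum_add_tsum_compl (s := box M), add_sub_cancel_left,
          ← tsum_subtype_eq_of_support_subset (s := ((box M : Finset _) : Set (Fin 3 → ℤ))ᶜ)]
        · refine tsum_congr fun K => ?_
          have hK : (K : Fin 3 → ℤ) ∉ box M := fun h => K.2 (Finset.mem_coe.2 h)
          simp [restr, hK]
        · intro K hK hK'
          apply hK
          have hK' : K ∈ box M := by simpa using hK'
          simp [restr, hK']
      rw [e3] at e2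
      rw [← e2, Real.sqrt_eq_rpow]
      norm_num
    simp only [h1]
    have h2 : Tendsto (fun M => ∑ K ∈ box M, ‖u K‖ ^ 2) atTop (𝓝 N) :=
      hsq.hasSum.comp tendsto_box
    have h3 := (((tendsto_const_nhds (x := N)).sub h2).const_mul (L ^ 3)).sqrt
    have h4 := ENNReal.tendsto_ofReal h3
    simpa using h4
  -- L² convergence of the truncations gives a subsequence converging almost everywhere, along which
  -- Fatou's lemma carries the uniform L⁴ bound over to u.
  obtain ⟨ns, hns, hae⟩ := (tendstoInMeasure_of_tendsto_eLpNorm two_ne_zero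
    (fun M => aestronglyMeasurable_value L (restr (box M) u)) (aestronglyMeasurable_value L u)
    hlim).exists_seq_tendsto_ae
  have hle : eLpNorm (value L u) 4 (volume : Measure (Torus L)) ≤
      ENNReal.ofReal (C ^ (1 / 4 : ℝ)) := by
    refine (Lp.eLpNorm_lim_le_liminf_eLpNorm
      (fun n => aestronglyMeasurable_value L (restr (box (ns n)) u)) _ hae).trans ?_
    exact liminf_le_of_le (by isBoundedDefault) fun b hb => by
      obtain ⟨n, hn⟩ := hb.exists
      exact hn.trans (hfin _)
  obtain ⟨hm, hb⟩ := integral_pow_four_le_of_eLpNorm_le (aestronglyMeasurable_value L u)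
    (Real.rpow_nonneg hC0 _) hle
  refine ⟨hm, hb.trans ?_⟩
  rw [← Real.rpow_natCast, ← Real.rpow_mul hC0, Nat.cast_ofNat, one_div_mul_cancel (by norm_num),
    Real.rpow_one, vnorm_zero_eq, vnorm_one_eq, hC]
  have e : √(L ^ 3) * √N * (√(L ^ 3) * (2 * Real.pi / L) * √D) ^ 3 =
      8 * Real.pi ^ 3 * L ^ 3 * √N * √D ^ 3 := by
    have h4 : √(L ^ 3) ^ 4 = L ^ 6 := by
      rw [show (4 : ℕ) = 2 * 2 by norm_num, pow_mul, Real.sq_sqrt (by positivity)]; ring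
    calc _ = √(L ^ 3) ^ 4 * √N * (2 * Real.pi / L) ^ 3 * √D ^ 3 := by ring
      _ = _ := by rw [h4]; field_simp; ring
  rw [e]
  -- Expressed in the norms of H and V the constant is 156/(8π³), which is below 1 since π > 3 gives
  -- 8π³ > 216.
  have hpi : 156 ≤ 8 * Real.pi ^ 3 := by
    have := pow_le_pow_left₀ (by norm_num) Real.pi_gt_three.le 3
    linarith
  gcongr

lemma IsGNConst.integral_pow_four_le {c : ℝ} (hc : IsGNConst L c) {u : VField} (hu : InV 1 u) :
    ∫ x : Torus L, ‖value L u x‖ ^ 4 ≤ c ^ 4 * vnorm L 0 u * vnorm L 1 u ^ 3 := by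
  have h0 := vnorm_nonneg L 0 u
  have h1 := vnorm_nonneg L 1 u
  have hc0 := hc.pos.le
  refine (integral_pow_four_le_of_eLpNorm_le (aestronglyMeasurable_value L u) (by positivity)
    (hc.l4 u hu)).2.trans (le_of_eq ?_)
  rw [mul_pow, mul_pow, ← Real.rpow_natCast (_ ^ (1 / 4 : ℝ)), ← Real.rpow_mul h0,
    ← Real.rpow_natCast (_ ^ (3 / 4 : ℝ)), ← Real.rpow_mul h1]
  norm_num

lemma InV.isH1 {u : VField} (hu : InV 1 u) : IsH1 u := ⟨hu.mean_zero, by simpa using hu.summable⟩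

end FourthPower

lemma sq_integral_mul_le {α : Type*} [MeasurableSpace α] {μ : Measure α} {f g : α → ℝ}
    (hf : MemLp f 2 μ) (hg : MemLp g 2 μ) :
    (∫ x, f x * g x ∂μ) ^ 2 ≤ (∫ x, f x ^ 2 ∂μ) * ∫ x, g x ^ 2 ∂μ := by
  have key : ∀ {f g : α → ℝ} (hf : MemLp f 2 μ) (hg : MemLp g 2 μ),
      inner ℝ (hf.toLp f) (hg.toLp g) = ∫ x, f x * g x ∂μ := by
    intro f g hf hg
    rw [L2.inner_def]
    refine integral_congr_ae ?_
    filter_upwards [hf.coeFn_toLp, hg.coeFn_toLp] with x hx hx'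
    rw [hx, hx']
    simp [mul_comm]
  have h := real_inner_mul_inner_self_le (hf.toLp f) (hg.toLp g)
  simp only [key] at h
  simpa only [← sq] using h

instance holderTriple_four_four_two : ENNReal.HolderTriple 4 4 2 where
  inv_add_inv_eq_inv := by
    rw [← two_mul, show (4 : ℝ≥0∞) = 2 * 2 by norm_num,
      ENNReal.mul_inv (Or.inl two_ne_zero) (Or.inl ENNReal.ofNat_ne_top), ← mul_assoc,
      ENNReal.mul_inv_cancel two_ne_zero ENNReal.ofNat_ne_top, one_mul]

/-! ### The trilinear form and its cancellation. -/

section Trilinear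

variable (L : ℝ) [hL : Fact (0 < L)]

lemma partialDeriv_apply (i j : Fin 3) (u : VField) (K : Fin 3 → ℤ) :
    partialDeriv L i u K j = 2 * Real.pi * Complex.I * (K i : ℂ) / (L : ℂ) * u K j := rfl

lemma norm_partialDeriv_sq (i : Fin 3) (u : VField) (K : Fin 3 → ℤ) :
    ‖partialDeriv L i u K‖ ^ 2 = (2 * Real.pi / L) ^ 2 * ((K i : ℝ) ^ 2 * ‖u K‖ ^ 2) := by
  have h : ‖2 * Real.pi * Complex.I * (K i : ℂ) / (L : ℂ)‖ = 2 * Real.pi / L * |(K i : ℝ)| := by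
    have hi : ‖(K i : ℂ)‖ = |(K i : ℝ)| := by
      rw [← Complex.ofReal_intCast, Complex.norm_real, Real.norm_eq_abs]
    simp only [norm_div, norm_mul, Complex.norm_I, hi, Complex.norm_real, Real.norm_eq_abs,
      abs_of_pos hL.out, abs_of_pos Real.pi_pos, Complex.norm_ofNat]
    ring
  rw [partialDeriv, norm_smul, h, mul_pow, mul_pow, sq_abs]
  ring

lemma IsH1.summable_partialDeriv {u : VField} (hu : IsH1 u) (i : Fin 3) :
    Summable fun K => ‖partialDeriv L i u K‖ ^ 2 := by
  simp only [norm_partialDeriv_sq]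
  refine (hu.summable.of_nonneg_of_le (fun _ => by positivity) fun K => ?_).mul_left _
  have h := pow_le_pow_left₀ (abs_nonneg _) (abs_le_kabs K i) 2
  rw [sq_abs] at h
  gcongr

/-- The norm of the gradient of a field. -/
noncomputable def gradNorm (u : VField) (x : Torus L) : ℝ :=
  √(∑ i, ‖value L (partialDeriv L i u) x‖ ^ 2)

lemma gradNorm_sq (u : VField) (x : Torus L) :
    gradNorm L u x ^ 2 = ∑ i, ‖value L (partialDeriv L i u) x‖ ^ 2 :=
  Real.sq_sqrt (Finset.sum_nonneg fun _ _ => sq_nonneg _)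

lemma memLp_gradNorm (u : VField) : MemLp (gradNorm L u) 2 (volume : Measure (Torus L)) := by
  have hm : AEStronglyMeasurable (gradNorm L u) (volume : Measure (Torus L)) := by
    refine (AEMeasurable.sqrt ?_).aestronglyMeasurable
    exact Finset.aemeasurable_fun_sum _ fun i _ =>
      ((aestronglyMeasurable_value L _).norm.aemeasurable.pow_const 2)
  rw [memLp_two_iff_integrable_sq hm]
  simp only [gradNorm_sq]
  exact integrable_finsetSum _ fun i _ => (memLp_value L _).integrable_norm_pow two_ne_zero

lemma IsH1.integral_gradNorm_sq {u : VField} (hu : IsH1 u) :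
    ∫ x : Torus L, gradNorm L u x ^ 2 = vnorm L 1 u ^ 2 := by
  simp only [gradNorm_sq]
  rw [integral_finsetSum _ fun i _ => (memLp_value L _).integrable_norm_pow two_ne_zero,
    Finset.sum_congr rfl fun i _ => integral_norm_sq_value L (hu.summable_partialDeriv L i),
    ← Finset.mul_sum, ← Summable.tsum_finsetSum fun i _ => hu.summable_partialDeriv L i,
    vnorm_one_sq, ← tsum_mul_left (a := (2 * Real.pi / L) ^ 2)]
  refine congrArg _ (tsum_congr fun K => ?_)
  simp only [norm_partialDeriv_sq]
  rw [← Finset.mul_sum, ← Finset.sum_mul, ← kabs_sq]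

lemma IsH1.memLp_coord_four {u : VField} (hu : IsH1 u) (j : Fin 3) :
    MemLp (fun x => value L u x j) 4 (volume : Measure (Torus L)) :=
  (hu.ladyzhenskaya L).1.of_le (memLp_value_coord L u j).1
    (ae_of_all _ fun _ => norm_coord_le _ j)

lemma IsH1.memLp_mul {u v : VField} (hu : IsH1 u) (hv : IsH1 v) (i j : Fin 3) :
    MemLp (fun x => value L u x i * value L v x j) 2 (volume : Measure (Torus L)) :=
  (hv.memLp_coord_four L j).mul (hu.memLp_coord_four L i)

lemma IsH1.integrable_tri {u v : VField} (hu : IsH1 u) (hv : IsH1 v) (w : VField)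
    (i j : Fin 3) : Integrable (fun x : Torus L =>
      value L u x i * value L v x j * value L (partialDeriv L i w) x j) volume :=
  (hu.memLp_mul L hv i j).integrable_mul (memLp_value_coord L _ j)

/-- The trilinear form `∫ (u ⬝ ∇) w ⬝ v`. -/
noncomputable def tri (u v w : VField) : ℂ :=
  ∑ i, ∑ j, ∫ x : Torus L, value L u x i * value L v x j * value L (partialDeriv L i w) x j

lemma partialDeriv_sub (i : Fin 3) (u v : VField) :
    partialDeriv L i (u - v) = partialDeriv L i u - partialDeriv L i v := by
  ext K; simp [partialDeriv, smul_sub]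

lemma tri_sub_left {u u' v w : VField} (hu : IsH1 u) (hu' : IsH1 u') (hv : IsH1 v) :
    tri L (u - u') v w = tri L u v w - tri L u' v w := by
  simp only [tri, ← Finset.sum_sub_distrib]
  refine Finset.sum_congr rfl fun i _ => Finset.sum_congr rfl fun j _ => ?_
  rw [← integral_sub (hu.integrable_tri L hv w i j) (hu'.integrable_tri L hv w i j)]
  refine integral_congr_ae ?_
  filter_upwards [value_sub L hu.summable_sq hu'.summable_sq] with x hx
  rw [hx, PiLp.sub_apply]; ring

lemma tri_sub_mid {u v v' w : VField} (hu : IsH1 u) (hv : IsH1 v) (hv' : IsH1 v') :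
    tri L u (v - v') w = tri L u v w - tri L u v' w := by
  simp only [tri, ← Finset.sum_sub_distrib]
  refine Finset.sum_congr rfl fun i _ => Finset.sum_congr rfl fun j _ => ?_
  rw [← integral_sub (hu.integrable_tri L hv w i j) (hu.integrable_tri L hv' w i j)]
  refine integral_congr_ae ?_
  filter_upwards [value_sub L hv.summable_sq hv'.summable_sq] with x hx
  rw [hx, PiLp.sub_apply]; ring

lemma tri_sub_right {u v w w' : VField} (hu : IsH1 u) (hv : IsH1 v) (hw : IsH1 w)
    (hw' : IsH1 w') : tri L u v (w - w') = tri L u v w - tri L u v w' := by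
  simp only [tri, ← Finset.sum_sub_distrib]
  refine Finset.sum_congr rfl fun i _ => Finset.sum_congr rfl fun j _ => ?_
  rw [← integral_sub (hu.integrable_tri L hv w i j) (hu.integrable_tri L hv w' i j)]
  refine integral_congr_ae ?_
  rw [partialDeriv_sub]
  filter_upwards [value_sub L (hw.summable_partialDeriv L i) (hw'.summable_partialDeriv L i)]
    with x hx
  rw [hx, PiLp.sub_apply]; ring

lemma norm_sum_sum_mul_le (a b : EuclideanSpace ℂ (Fin 3))
    (m : Fin 3 → EuclideanSpace ℂ (Fin 3)) :
    ‖∑ i, ∑ j, a i * b j * m i j‖ ≤ ‖a‖ * ‖b‖ * √(∑ i, ‖m i‖ ^ 2) := by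
  have h1 : ∀ i, ‖∑ j, b j * m i j‖ ≤ ‖b‖ * ‖m i‖ := by
    intro i
    refine (norm_sum_le _ _).trans ?_
    simp only [norm_mul]
    have := Real.sum_mul_le_sqrt_mul_sqrt Finset.univ (fun j => ‖b j‖) fun j => ‖m i j‖
    rwa [← EuclideanSpace.norm_eq, ← EuclideanSpace.norm_eq] at this
  calc ‖∑ i, ∑ j, a i * b j * m i j‖ ≤ ∑ i, ‖a i‖ * (‖b‖ * ‖m i‖) := by
        refine (norm_sum_le _ _).trans (Finset.sum_le_sum fun i _ => ?_)
        simp only [mul_assoc]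
        rw [← Finset.mul_sum, norm_mul]
        gcongr
        exact h1 i
    _ = ‖b‖ * ∑ i, ‖a i‖ * ‖m i‖ := by
        rw [Finset.mul_sum]
        exact Finset.sum_congr rfl fun i _ => by ring
    _ ≤ ‖b‖ * (‖a‖ * √(∑ i, ‖m i‖ ^ 2)) := by
        gcongr
        have := Real.sum_mul_le_sqrt_mul_sqrt Finset.univ (fun j => ‖a j‖) fun j => ‖m j‖
        rwa [← EuclideanSpace.norm_eq] at this
    _ = _ := by ring

/-- The integral of the fourth power of a field. -/
noncomputable def fourth (u : VField) : ℝ := ∫ x : Torus L, ‖value L u x‖ ^ 4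

lemma fourth_nonneg (u : VField) : 0 ≤ fourth L u := integral_nonneg fun _ => by positivity

lemma IsH1.memLp_norm_mul {u v : VField} (hu : IsH1 u) (hv : IsH1 v) :
    MemLp (fun x => ‖value L u x‖ * ‖value L v x‖) 2 (volume : Measure (Torus L)) :=
  (hv.ladyzhenskaya L).1.norm.mul (hu.ladyzhenskaya L).1.norm

lemma IsH1.memLp_norm_sq {u : VField} (hu : IsH1 u) :
    MemLp (fun x => ‖value L u x‖ ^ 2) 2 (volume : Measure (Torus L)) := by
  simpa only [sq] using hu.memLp_norm_mul L hu

/-- Hölder's inequality L⁴ · L⁴ · L², in fourth powers to avoid roots. The two L⁴ factors stay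
separate, so that each can later be bounded with a different constant. -/
lemma norm_tri_pow_four_le {u v w : VField} (hu : IsH1 u) (hv : IsH1 v) (hw : IsH1 w) :
    ‖tri L u v w‖ ^ 4 ≤ fourth L u * fourth L v * vnorm L 1 w ^ 4 := by
  have h1 : tri L u v w = ∫ x : Torus L, ∑ i, ∑ j,
      value L u x i * value L v x j * value L (partialDeriv L i w) x j := by
    rw [tri, integral_finsetSum _ fun i _ =>
      integrable_finsetSum _ fun j _ => hu.integrable_tri L hv w i j]
    refine Finset.sum_congr rfl fun i _ => ?_
    rw [integral_finsetSum _ fun j _ => hu.integrable_tri L hv w i j]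
  have h2 : ‖tri L u v w‖ ≤ ∫ x : Torus L, (‖value L u x‖ * ‖value L v x‖) * gradNorm L w x := by
    rw [h1]
    refine norm_integral_le_of_norm_le
      ((hu.memLp_norm_mul L hv).integrable_mul (memLp_gradNorm L w)) (ae_of_all _ fun x => ?_)
    exact norm_sum_sum_mul_le _ _ fun i => value L (partialDeriv L i w) x
  have h3 := sq_integral_mul_le (hu.memLp_norm_mul L hv) (memLp_gradNorm L w)
  rw [hw.integral_gradNorm_sq L] at h3
  have h4 : (∫ x : Torus L, (‖value L u x‖ * ‖value L v x‖) ^ 2) ^ 2 ≤ fourth L u * fourth L v := by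
    have := sq_integral_mul_le (hu.memLp_norm_sq L) (hv.memLp_norm_sq L)
    simpa only [← mul_pow, ← pow_mul, fourth] using this
  have h5 := pow_le_pow_left₀ (norm_nonneg _) h2 2
  calc ‖tri L u v w‖ ^ 4 = (‖tri L u v w‖ ^ 2) ^ 2 := by ring
    _ ≤ ((∫ x : Torus L, (‖value L u x‖ * ‖value L v x‖) ^ 2) * vnorm L 1 w ^ 2) ^ 2 :=
        pow_le_pow_left₀ (sq_nonneg _) (h5.trans h3) 2
    _ ≤ fourth L u * fourth L v * vnorm L 1 w ^ 4 := by
        rw [mul_pow, ← pow_mul]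
        exact mul_le_mul_of_nonneg_right h4 (pow_nonneg (vnorm_nonneg L 1 w) _)

lemma restr_apply_of_notMem {S : Finset (Fin 3 → ℤ)} {u : VField} {K : Fin 3 → ℤ} (h : K ∉ S) :
    restr S u K = 0 := if_neg h

lemma sum_sum_mul_mul (κ : ℂ) (f g : Fin 3 → ℂ) :
    ∑ i, ∑ j, κ * f i * g j = κ * (∑ i, f i) * ∑ j, g j := by
  rw [mul_assoc, Finset.sum_mul_sum, Finset.mul_sum]
  refine Finset.sum_congr rfl fun i _ => ?_
  rw [Finset.mul_sum]
  exact Finset.sum_congr rfl fun j _ => by ring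

/-- In the double sum over modes, the terms (J, K) and (K, J) carry the factors w₋₍J₊K₎·K and
w₋₍J₊K₎·J and are otherwise equal. The two factors add up to w₋₍J₊K₎·(J + K) = 0, so the sum equals
its own negative. -/
lemma tri_self_of_finite {w v : VField} (hw : IsH1 w) (hdiv : ∀ K, ∑ i, w K i * (K i : ℂ) = 0)
    {S : Finset (Fin 3 → ℤ)} (hv : ∀ K ∉ S, v K = 0) : tri L w v v = 0 := by
  have hc : ∀ i, ∀ K, ∫ x : Torus L, value L w x i * mode L K x = (L : ℂ) ^ 3 * w (-K) i := by
    intro i K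
    rw [← integral_mode_mul_series L (summable_coord hw.summable_sq i)]
    congr 1; ext x
    rw [mode_neg, Complex.conj_conj, mul_comm]; rfl
  have hint : ∀ i, ∀ K, Integrable fun x : Torus L => value L w x i * mode L K x := by
    intro i K
    have := (memLp_mode_mul L (memLp_value_coord L w i) K).integrable one_le_two
    simpa only [mul_comm] using this
  have h1 : ∀ i j, ∫ x : Torus L, value L w x i * value L v x j *
      value L (partialDeriv L i v) x j = ∑ J ∈ S, ∑ K ∈ S, (L : ℂ) ^ 3 *
        (2 * Real.pi * Complex.I / L) * (w (-(J + K)) i * (K i : ℂ)) * (v J j * v K j) := by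
    intro i j
    have e : (fun x : Torus L => value L w x i * value L v x j * value L (partialDeriv L i v) x j)
        =ᵐ[volume] fun x => ∑ J ∈ S, ∑ K ∈ S, ((2 * Real.pi * Complex.I / L) * (K i : ℂ) *
          (v J j * v K j)) * (value L w x i * mode L (J + K) x) := by
      filter_upwards [value_finset L hv, value_finset L (u := partialDeriv L i v) (S := S)
        fun K hK => by simp [partialDeriv, hv K hK]] with x hx hx'
      rw [hx, hx']
      simp only [WithLp.ofLp_sum, Finset.sum_apply, PiLp.smul_apply, smul_eq_mul,
        partialDeriv_apply]
      rw [mul_assoc, Finset.sum_mul_sum, Finset.mul_sum]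
      refine Finset.sum_congr rfl fun J _ => ?_
      rw [Finset.mul_sum]
      refine Finset.sum_congr rfl fun K _ => ?_
      rw [mode_add]; ring
    rw [integral_congr_ae e, integral_finsetSum _ fun J _ =>
      integrable_finsetSum _ fun K _ => (hint i (J + K)).const_mul _]
    refine Finset.sum_congr rfl fun J _ => ?_
    rw [integral_finsetSum _ fun K _ => (hint i (J + K)).const_mul _]
    refine Finset.sum_congr rfl fun K _ => ?_
    rw [integral_const_mul, hc]; ring
  have h2 : tri L w v v = ∑ J ∈ S, ∑ K ∈ S, (L : ℂ) ^ 3 * (2 * Real.pi * Complex.I / L) *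
      (∑ i, w (-(J + K)) i * (K i : ℂ)) * ∑ j, v J j * v K j := by
    simp only [tri, h1, Finset.sum_comm (s := Finset.univ) (t := S)]
    refine Finset.sum_congr rfl fun J _ => Finset.sum_congr rfl fun K _ => ?_
    exact sum_sum_mul_mul _ _ _
  have h3 : tri L w v v + tri L w v v = 0 := by
    have h2' := h2
    rw [Finset.sum_comm] at h2'
    nth_rewrite 1 [h2']
    rw [h2, ← Finset.sum_add_distrib]
    refine Finset.sum_eq_zero fun J _ => ?_
    rw [← Finset.sum_add_distrib]
    refine Finset.sum_eq_zero fun K _ => ?_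
    have h4 := hdiv (-(J + K))
    have h5 : ∑ i, w (-(K + J)) i * (J i : ℂ) = -∑ i, w (-(J + K)) i * (K i : ℂ) := by
      rw [eq_neg_iff_add_eq_zero, ← Finset.sum_add_distrib, ← neg_eq_zero, ← h4,
        ← Finset.sum_neg_distrib]
      refine Finset.sum_congr rfl fun i _ => ?_
      rw [add_comm K J]
      push_cast [Pi.neg_apply, Pi.add_apply]; ring
    have h6 : ∑ j, v K j * v J j = ∑ j, v J j * v K j :=
      Finset.sum_congr rfl fun j _ => mul_comm _ _
    rw [h5, h6]; ring
  exact add_self_eq_zero.1 h3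

lemma IsH1.vnorm_zero_le {u : VField} (hu : IsH1 u) :
    2 * Real.pi / L * vnorm L 0 u ≤ vnorm L 1 u := by
  rw [vnorm_zero_eq, vnorm_one_eq]
  have hL0 := hL.out
  have h : √(∑' K, ‖u K‖ ^ 2) ≤ √(∑' K, kabs K ^ 2 * ‖u K‖ ^ 2) :=
    Real.sqrt_le_sqrt (hu.summable_sq.tsum_le_tsum (norm_sq_le_kabs hu.mean_zero) hu.summable)
  calc _ = √(L ^ 3) * (2 * Real.pi / L) * √(∑' K, ‖u K‖ ^ 2) := by ring
    _ ≤ _ := by gcongr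

/-- Makes the trilinear form bounded on V. This is what passes from finitely many modes to all of V,
and what bounds ∫|u|⁴ uniformly along a continuous path in V. -/
lemma IsH1.fourth_le {u : VField} (hu : IsH1 u) :
    fourth L u ≤ L / (2 * Real.pi) * vnorm L 1 u ^ 4 := by
  have hL0 := hL.out
  have h1 : vnorm L 0 u ≤ L / (2 * Real.pi) * vnorm L 1 u := by
    have h2 := hu.vnorm_zero_le L
    calc vnorm L 0 u = L / (2 * Real.pi) * (2 * Real.pi / L * vnorm L 0 u) := by
          have := Real.pi_pos; field_simp
      _ ≤ _ := by gcongr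
  have := vnorm_nonneg L 1 u
  calc fourth L u ≤ vnorm L 0 u * vnorm L 1 u ^ 3 := (hu.ladyzhenskaya L).2
    _ ≤ L / (2 * Real.pi) * vnorm L 1 u * vnorm L 1 u ^ 3 := by gcongr
    _ = _ := by ring

lemma vnorm_one_restr_le {u : VField} (hu : IsH1 u) (S : Finset (Fin 3 → ℤ)) :
    vnorm L 1 (restr S u) ≤ vnorm L 1 u := by
  rw [vnorm_one_eq, vnorm_one_eq]
  have hL0 := hL.out
  gcongr with K
  · exact (hu.restrict_modes S).summable
  · exact hu.summable
  · exact norm_restr_le S u K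

lemma tendsto_vnorm_one_restr {u : VField} (hu : IsH1 u) :
    Tendsto (fun M => vnorm L 1 (u - restr (box M) u)) atTop (𝓝 0) := by
  have h1 : ∀ M, ∑' K, kabs K ^ 2 * ‖(u - restr (box M) u) K‖ ^ 2 =
      ∑' K, kabs K ^ 2 * ‖u K‖ ^ 2 - ∑ K ∈ box M, kabs K ^ 2 * ‖u K‖ ^ 2 := by
    intro M
    rw [← hu.summable.sum_add_tsum_compl (s := box M), add_sub_cancel_left,
      ← tsum_subtype_eq_of_support_subset (s := ((box M : Finset _) : Set (Fin 3 → ℤ))ᶜ)]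
    · refine tsum_congr fun K => ?_
      have hK : (K : Fin 3 → ℤ) ∉ box M := fun h => K.2 (Finset.mem_coe.2 h)
      simp [restr, hK]
    · intro K hK hK'
      apply hK
      have hK' : K ∈ box M := by simpa using hK'
      simp [restr, hK']
  simp only [vnorm_one_eq, h1]
  have h2 : Tendsto (fun M => ∑ K ∈ box M, kabs K ^ 2 * ‖u K‖ ^ 2) atTop
      (𝓝 (∑' K, kabs K ^ 2 * ‖u K‖ ^ 2)) := hu.summable.hasSum.comp tendsto_box
  have h3 := (((tendsto_const_nhds
    (x := ∑' K, kabs K ^ 2 * ‖u K‖ ^ 2)).sub h2).sqrt).const_mul (√(L ^ 3) * (2 * Real.pi / L))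
  simpa using h3

/-- The trilinear form is antisymmetric in its last two arguments: diagonal version. -/
lemma tri_self {w v : VField} (hw : IsH1 w) (hdiv : ∀ K, ∑ i, w K i * (K i : ℂ) = 0)
    (hv : IsH1 v) : tri L w v v = 0 := by
  have hL0 := hL.out
  set C := fourth L w * (L / (2 * Real.pi)) * vnorm L 1 v ^ 4 with hC
  have hC0 : 0 ≤ C := by have := fourth_nonneg L w; positivity
  have hr := fun M => hv.restrict_modes (box M)
  have hd := fun M => hv.sub (hr M)
  -- After splitting v into truncation and remainder, the term with two truncations vanishes. Each
  -- of the others has a remainder as one factor, which tends to 0 in V.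
  have h1 : ∀ M, tri L w v v = tri L w (v - restr (box M) v) v +
      tri L w (restr (box M) v) (v - restr (box M) v) := by
    intro M
    rw [tri_sub_mid L hw hv (hr M), tri_sub_right L hw (hr M) hv (hr M),
      tri_self_of_finite L hw hdiv (v := restr (box M) v) (S := box M)
        fun K hK => restr_apply_of_notMem hK]
    ring
  have h2 : ∀ M, ‖tri L w (v - restr (box M) v) v‖ ^ 4 ≤
      C * vnorm L 1 (v - restr (box M) v) ^ 4 := by
    intro M
    have := fourth_nonneg L w
    calc _ ≤ fourth L w * fourth L (v - restr (box M) v) * vnorm L 1 v ^ 4 :=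
          norm_tri_pow_four_le L hw (hd M) hv
      _ ≤ fourth L w * (L / (2 * Real.pi) * vnorm L 1 (v - restr (box M) v) ^ 4) *
          vnorm L 1 v ^ 4 := by gcongr; exact (hd M).fourth_le L
      _ = _ := by rw [hC]; ring
  have h3 : ∀ M, ‖tri L w (restr (box M) v) (v - restr (box M) v)‖ ^ 4 ≤
      C * vnorm L 1 (v - restr (box M) v) ^ 4 := by
    intro M
    have := fourth_nonneg L w
    calc _ ≤ fourth L w * fourth L (restr (box M) v) * vnorm L 1 (v - restr (box M) v) ^ 4 :=
          norm_tri_pow_four_le L hw (hr M) (hd M)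
      _ ≤ fourth L w * (L / (2 * Real.pi) * vnorm L 1 v ^ 4) *
          vnorm L 1 (v - restr (box M) v) ^ 4 := by
          gcongr
          refine ((hr M).fourth_le L).trans ?_
          gcongr
          · exact vnorm_nonneg _ _ _
          · exact vnorm_one_restr_le L hv _
      _ = _ := by rw [hC]; ring
  have h4 : ∀ M, ‖tri L w v v‖ ^ 4 ≤ 16 * (C * vnorm L 1 (v - restr (box M) v) ^ 4) := by
    intro M
    set t := C * vnorm L 1 (v - restr (box M) v) ^ 4 with ht
    have h5 := norm_add_le (tri L w (v - restr (box M) v) v)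
      (tri L w (restr (box M) v) (v - restr (box M) v))
    rw [← h1 M] at h5
    have h6 : ‖tri L w v v‖ ≤ 2 * max ‖tri L w (v - restr (box M) v) v‖
        ‖tri L w (restr (box M) v) (v - restr (box M) v)‖ := by
      linarith [le_max_left ‖tri L w (v - restr (box M) v) v‖
        ‖tri L w (restr (box M) v) (v - restr (box M) v)‖,
        le_max_right ‖tri L w (v - restr (box M) v) v‖
        ‖tri L w (restr (box M) v) (v - restr (box M) v)‖]
    have h7 := pow_le_pow_left₀ (norm_nonneg _) h6 4
    rw [mul_pow] at h7
    refine h7.trans ?_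
    norm_num
    rcases max_choice ‖tri L w (v - restr (box M) v) v‖
      ‖tri L w (restr (box M) v) (v - restr (box M) v)‖ with h | h <;> rw [h]
    · exact h2 M
    · exact h3 M
  have h8 : Tendsto (fun M => 16 * (C * vnorm L 1 (v - restr (box M) v) ^ 4)) atTop (𝓝 0) := by
    have := (((tendsto_vnorm_one_restr L hv).pow 4).const_mul C).const_mul 16
    simpa using this
  have h9 : ‖tri L w v v‖ ^ 4 ≤ 0 := ge_of_tendsto' h8 h4
  have h10 : ‖tri L w v v‖ ^ 4 = 0 := le_antisymm h9 (by positivity)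
  exact norm_eq_zero.1 (pow_eq_zero_iff four_ne_zero |>.1 h10)

end Trilinear

/-! ### The Leray projection on single modes. -/

section Leray

lemma leray_zero (X : VField) : leray X 0 = 0 := if_pos rfl

lemma leray_apply (X : VField) {K : Fin 3 → ℤ} (hK : K ≠ 0) (i : Fin 3) :
    leray X K i = X K i - (K i : ℂ) * (∑ j, X K j * (K j : ℂ)) / ((kabs K ^ 2 : ℝ) : ℂ) := by
  rw [leray, if_neg hK]

/-- The projection changes a coefficient only along K, which y does not see. This removes the
projection from pairings with divergence-free fields; with y the conjugate of the projected
coefficient, it also gives the contraction property. -/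
lemma sum_leray_mul (X : VField) {K : Fin 3 → ℤ} (hK : K ≠ 0) {y : Fin 3 → ℂ}
    (hy : ∑ j, y j * (K j : ℂ) = 0) : ∑ j, leray X K j * y j = ∑ j, X K j * y j := by
  have h : ∀ j, leray X K j * y j = X K j * y j -
      (∑ j, X K j * (K j : ℂ)) / ((kabs K ^ 2 : ℝ) : ℂ) * (y j * (K j : ℂ)) := by
    intro j; rw [leray_apply X hK]; ring
  simp only [h]
  rw [Finset.sum_sub_distrib, ← Finset.mul_sum, hy, mul_zero, sub_zero]

lemma sum_sq_wave (K : Fin 3 → ℤ) : ∑ i, (K i : ℂ) * (K i : ℂ) = ((kabs K ^ 2 : ℝ) : ℂ) := by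
  rw [kabs_sq]; push_cast
  exact Finset.sum_congr rfl fun i _ => (sq _).symm

lemma norm_leray_le (X : VField) (K : Fin 3 → ℤ) : ‖leray X K‖ ≤ ‖X K‖ := by
  by_cases hK : K = 0
  · subst hK; rw [leray_zero, norm_zero]; exact norm_nonneg _
  have hk : ((kabs K ^ 2 : ℝ) : ℂ) ≠ 0 := by
    have := one_le_kabs hK
    exact_mod_cast (by positivity : kabs K ^ 2 ≠ 0)
  have hdiv : ∑ j, conj (leray X K j) * (K j : ℂ) = 0 := by
    have h1 : ∑ j, leray X K j * (K j : ℂ) = 0 := by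
      simp only [leray_apply X hK, sub_mul]
      rw [Finset.sum_sub_distrib, sub_eq_zero]
      have : ∀ i, (K i : ℂ) * (∑ j, X K j * (K j : ℂ)) / ((kabs K ^ 2 : ℝ) : ℂ) * (K i : ℂ) =
          (∑ j, X K j * (K j : ℂ)) / ((kabs K ^ 2 : ℝ) : ℂ) * ((K i : ℂ) * (K i : ℂ)) := by
        intro i; ring
      simp only [this]
      rw [← Finset.mul_sum, sum_sq_wave, div_mul_cancel₀ _ hk]
    have := congrArg conj h1
    simpa using this
  have h2 := sum_leray_mul X hK hdiv
  have h3 : ((‖leray X K‖ ^ 2 : ℝ) : ℂ) = inner ℂ (leray X K) (X K) := by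
    rw [EuclideanSpace.norm_sq_eq, PiLp.inner_apply]
    simp only [RCLike.inner_apply]
    rw [← h2]
    push_cast
    exact Finset.sum_congr rfl fun j _ => by rw [Complex.mul_conj']
  have h4 : ‖leray X K‖ ^ 2 ≤ ‖leray X K‖ * ‖X K‖ := by
    have h5 := norm_inner_le_norm (𝕜 := ℂ) (leray X K) (X K)
    rw [← h3, Complex.norm_real, Real.norm_of_nonneg (sq_nonneg _)] at h5
    exact h5
  by_contra! h
  nlinarith [norm_nonneg (X K)]

lemma leray_eq_self {X : VField} {K : Fin 3 → ℤ} (h0 : X 0 = 0)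
    (hdiv : ∑ j, X K j * (K j : ℂ) = 0) : leray X K = X K := by
  by_cases hK : K = 0
  · subst hK; rw [leray_zero, h0]
  · ext i; rw [leray_apply X hK, hdiv]; simp

lemma ContinuousOn.leray {X : ℝ → VField} {K : Fin 3 → ℤ} {S : Set ℝ}
    (hX : ContinuousOn (fun s => X s K) S) : ContinuousOn (fun s => leray (X s) K) S := by
  have hj : ∀ j, ContinuousOn (fun s => X s K j) S := fun j =>
    (EuclideanSpace.proj (𝕜 := ℂ) j).continuous.comp_continuousOn hX
  by_cases hK : K = 0
  · subst hK; simp only [leray_zero]; exact continuousOn_const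
  · simp only [Bardina.leray, if_neg hK]
    refine (PiLp.continuous_toLp 2 _).comp_continuousOn (continuousOn_pi.2 fun i => ?_)
    exact (hj i).sub ((continuousOn_const.mul (continuousOn_finsetSum _ fun j _ =>
      (hj j).mul continuousOn_const)).div_const _)

end Leray

/-! ### The nonlinear term in divergence form. -/

section Bilinear

variable (L : ℝ) [hL : Fact (0 < L)]

/-- The length `2 π |K| / L` of a wave vector. -/
noncomputable def wave (K : Fin 3 → ℤ) : ℝ := 2 * Real.pi * kabs K / L

lemma wave_nonneg (K : Fin 3 → ℤ) : 0 ≤ wave L K :=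
  div_nonneg (mul_nonneg (by positivity) (kabs_nonneg K)) hL.out.le

/-- The unnormalised Fourier coefficients of the products of the components of a field. -/
noncomputable def quad (u : VField) (i j : Fin 3) (K : Fin 3 → ℤ) : ℂ :=
  ∫ x : Torus L, conj (mode L K x) * (value L u x i * value L u x j)

/-- This is (u·∇)u = div(u ⊗ u) on coefficients. Both sides are convolutions, and u(K - J)·(K - J) =
0 allows the J coming from the derivative to be replaced by K, which leaves the sum. -/
lemma coeff_advect {u : VField} (hu : IsH1 u) (hdiv : ∀ K, ∑ i, u K i * (K i : ℂ) = 0)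
    (K : Fin 3 → ℤ) (j : Fin 3) : coeff L (advect L u u) K j =
      ((L : ℂ) ^ 3)⁻¹ * ∑ i, 2 * Real.pi * Complex.I * (K i : ℂ) / L * quad L u i j K := by
  have hi1 : ∀ i j, Integrable (fun x : Torus L =>
      conj (mode L K x) * (value L u x i * value L (partialDeriv L i u) x j)) := by
    intro i j
    have h := (memLp_conj_mode_mul L (memLp_value_coord L u i) K).integrable_mul
      (memLp_value_coord L (partialDeriv L i u) j)
    refine h.congr (ae_of_all _ fun x => ?_)
    simp only [Pi.mul_apply]; ring
  have happ : ∀ x j, (conj (mode L K x) • advect L u u x) j =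
      ∑ i, conj (mode L K x) * (value L u x i * value L (partialDeriv L i u) x j) := by
    intro x j
    simp [advect, Finset.mul_sum]
  have hmeas : AEStronglyMeasurable (fun x : Torus L => conj (mode L K x) • advect L u u x)
      volume := by
    have : (fun x : Torus L => conj (mode L K x) • advect L u u x) = fun x => WithLp.toLp 2
        fun j => (conj (mode L K x) • advect L u u x) j := rfl
    rw [this]
    refine (PiLp.continuous_toLp 2 _).comp_aestronglyMeasurable
      (aemeasurable_pi_iff.2 fun j => ?_).aestronglyMeasurable
    simp only [happ]
    exact (integrable_finsetSum _ fun i _ => hi1 i j).1.aemeasurable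
  have hint : Integrable (fun x : Torus L => conj (mode L K x) • advect L u u x) := by
    rw [← memLp_one_iff_integrable]
    refine memLp_of_coord L hmeas fun j => ?_
    rw [memLp_one_iff_integrable]
    simp only [happ]
    exact integrable_finsetSum _ fun i _ => hi1 i j
  have h1 : coeff L (advect L u u) K j = ((L : ℂ) ^ 3)⁻¹ * ∑ i, ∫ x : Torus L,
      conj (mode L K x) * (value L u x i * value L (partialDeriv L i u) x j) := by
    rw [coeff, PiLp.smul_apply, smul_eq_mul]
    congr 1
    have h2 : (∫ x : Torus L, conj (mode L K x) • advect L u u x) j =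
        ∫ x : Torus L, (conj (mode L K x) • advect L u u x) j :=
      ((EuclideanSpace.proj (𝕜 := ℂ) j).integral_comp_comm hint).symm
    rw [h2, ← integral_finsetSum _ fun i _ => hi1 i j]
    simp only [happ]
  rw [h1]
  congr 1
  have hs1 := hasSum_sum (s := Finset.univ) fun i (_ : i ∈ Finset.univ) =>
    hasSum_integral_mode_mul_mul L (summable_coord hu.summable_sq i)
      (summable_coord (hu.summable_partialDeriv L i) j) K
  have hs2 := hasSum_sum (s := Finset.univ) fun i (_ : i ∈ Finset.univ) =>
    (hasSum_integral_mode_mul_mul L (summable_coord hu.summable_sq i)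
      (summable_coord hu.summable_sq j) K).mul_left (2 * Real.pi * Complex.I * (K i : ℂ) / L)
  refine hs1.unique (Eq.mpr (congrArg (HasSum · _) (funext fun J => ?_)) hs2)
  have h2 : ∑ i, u (K - J) i * (J i : ℂ) = ∑ i, u (K - J) i * (K i : ℂ) := by
    have := hdiv (K - J)
    simp only [Pi.sub_apply, Int.cast_sub, mul_sub] at this
    rw [Finset.sum_sub_distrib, sub_eq_zero] at this
    exact this.symm
  simp only [partialDeriv_apply]
  calc _ = (L : ℂ) ^ 3 * (2 * Real.pi * Complex.I / L) * u J j *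
        ∑ i, u (K - J) i * (J i : ℂ) := by
        rw [Finset.mul_sum]; exact Finset.sum_congr rfl fun i _ => by ring
    _ = _ := by
        rw [h2, Finset.mul_sum]; exact Finset.sum_congr rfl fun i _ => by ring

/-- The size of the Fourier coefficients of `u ⊗ u`. -/
noncomputable def quadNorm (u : VField) (K : Fin 3 → ℤ) : ℝ :=
  (L ^ 3)⁻¹ * √(∑ j, ∑ i, ‖quad L u i j K‖ ^ 2)

lemma quadNorm_nonneg (u : VField) (K : Fin 3 → ℤ) : 0 ≤ quadNorm L u K :=
  mul_nonneg (inv_nonneg.2 (pow_pos hL.out 3).le) (Real.sqrt_nonneg _)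

lemma norm_bilin_le {u : VField} (hu : IsH1 u) (hdiv : ∀ K, ∑ i, u K i * (K i : ℂ) = 0)
    (K : Fin 3 → ℤ) : ‖bilin L u u K‖ ≤ wave L K * quadNorm L u K := by
  have hL0 := hL.out
  refine (norm_leray_le _ K).trans ?_
  rw [EuclideanSpace.norm_eq]
  refine Real.sqrt_le_iff.2 ⟨mul_nonneg (wave_nonneg L K) (quadNorm_nonneg L u K), ?_⟩
  have h1 : ∀ j, ‖coeff L (advect L u u) K j‖ ^ 2 ≤
      (L ^ 3)⁻¹ ^ 2 * wave L K ^ 2 * ∑ i, ‖quad L u i j K‖ ^ 2 := by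
    intro j
    have h2 : ‖∑ i, 2 * Real.pi * Complex.I * (K i : ℂ) / L * quad L u i j K‖ ≤
        2 * Real.pi / L * ∑ i, |(K i : ℝ)| * ‖quad L u i j K‖ := by
      rw [Finset.mul_sum]
      refine (norm_sum_le _ _).trans (Finset.sum_le_sum fun i _ => le_of_eq ?_)
      have hi : ‖(K i : ℂ)‖ = |(K i : ℝ)| := by
        rw [← Complex.ofReal_intCast, Complex.norm_real, Real.norm_eq_abs]
      simp only [norm_div, norm_mul, Complex.norm_I, hi, Complex.norm_real, Real.norm_eq_abs,
        abs_of_pos hL0, abs_of_pos Real.pi_pos, Complex.norm_ofNat]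
      ring
    have h3 := Finset.sum_mul_sq_le_sq_mul_sq Finset.univ (fun i => |(K i : ℝ)|)
      fun i => ‖quad L u i j K‖
    simp only [sq_abs] at h3
    rw [← kabs_sq] at h3
    rw [coeff_advect L hu hdiv, norm_mul, mul_pow, norm_inv, norm_pow, Complex.norm_real,
      Real.norm_of_nonneg hL0.le, mul_assoc ((L ^ 3)⁻¹ ^ 2)]
    refine mul_le_mul_of_nonneg_left ?_ (by positivity)
    calc _ ≤ (2 * Real.pi / L * ∑ i, |(K i : ℝ)| * ‖quad L u i j K‖) ^ 2 :=
          pow_le_pow_left₀ (norm_nonneg _) h2 2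
      _ = (2 * Real.pi / L) ^ 2 * (∑ i, |(K i : ℝ)| * ‖quad L u i j K‖) ^ 2 := mul_pow _ _ _
      _ ≤ (2 * Real.pi / L) ^ 2 * (kabs K ^ 2 * ∑ i, ‖quad L u i j K‖ ^ 2) := by gcongr
      _ = _ := by rw [wave]; ring
  calc ∑ j, ‖coeff L (advect L u u) K j‖ ^ 2
      ≤ ∑ j, (L ^ 3)⁻¹ ^ 2 * wave L K ^ 2 * ∑ i, ‖quad L u i j K‖ ^ 2 :=
        Finset.sum_le_sum fun j _ => h1 j
    _ = _ := by
        have h4 : 0 ≤ ∑ j, ∑ i, ‖quad L u i j K‖ ^ 2 := by positivity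
        rw [← Finset.mul_sum, quadNorm, mul_pow, mul_pow, Real.sq_sqrt h4]
        ring

/-- Bessel's inequality for the products u_i u_j, which lie in L² because u lies in L⁴; the sum of
|u_i u_j|² over i, j is |u|⁴. With `norm_bilin_le` it places B(u,u) in the dual of V, with norm at
most the square of the L⁴ norm. -/
lemma quadNorm_summable {u : VField} (hu : IsH1 u) :
    (Summable fun K => quadNorm L u K ^ 2) ∧ L ^ 3 * ∑' K, quadNorm L u K ^ 2 ≤ fourth L u := by
  have hL0 := hL.out
  have e : ∀ K, quadNorm L u K ^ 2 = (L ^ 3)⁻¹ ^ 2 * ∑ j, ∑ i, ‖quad L u i j K‖ ^ 2 := by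
    intro K
    have h : 0 ≤ ∑ j, ∑ i, ‖quad L u i j K‖ ^ 2 := by positivity
    rw [quadNorm, mul_pow, Real.sq_sqrt h]
  have hb := fun i j => bessel L (hu.memLp_mul L hu i j)
  have hs : ∀ j, Summable fun K => ∑ i, ‖quad L u i j K‖ ^ 2 := fun j =>
    summable_sum fun i _ => (hb i j).1
  have hint : ∀ i j, Integrable fun x : Torus L => ‖value L u x i * value L u x j‖ ^ 2 :=
    fun i j => (hu.memLp_mul L hu i j).integrable_norm_pow two_ne_zero
  refine ⟨by simp only [e]; exact (summable_sum fun j _ => hs j).mul_left _, ?_⟩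
  have h1 : ∑' K, ∑ j, ∑ i, ‖quad L u i j K‖ ^ 2 ≤ L ^ 3 * fourth L u := by
    rw [Summable.tsum_finsetSum fun j _ => hs j]
    calc _ = ∑ j, ∑ i, ∑' K, ‖quad L u i j K‖ ^ 2 :=
          Finset.sum_congr rfl fun j _ => Summable.tsum_finsetSum fun i _ => (hb i j).1
      _ ≤ ∑ j, ∑ i, L ^ 3 * ∫ x : Torus L, ‖value L u x i * value L u x j‖ ^ 2 :=
          Finset.sum_le_sum fun j _ => Finset.sum_le_sum fun i _ => (hb i j).2
      _ = L ^ 3 * fourth L u := by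
          simp only [← Finset.mul_sum]
          congr 1
          rw [fourth, Finset.sum_congr rfl fun j _ =>
            (integral_finsetSum (Finset.univ) fun i _ => hint i j).symm,
            ← integral_finsetSum _ fun j _ => integrable_finsetSum _ fun i _ => hint i j]
          congr 1; ext x
          rw [show ‖value L u x‖ ^ 4 = ‖value L u x‖ ^ 2 * ‖value L u x‖ ^ 2 by ring,
            EuclideanSpace.norm_sq_eq, Finset.sum_mul_sum, Finset.sum_comm]
          simp only [norm_mul, mul_pow]
  simp only [e]
  rw [tsum_mul_left]
  calc _ = (L ^ 3)⁻¹ * ∑' K, ∑ j, ∑ i, ‖quad L u i j K‖ ^ 2 := by field_simp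
    _ ≤ (L ^ 3)⁻¹ * (L ^ 3 * fourth L u) := by gcongr
    _ = _ := by field_simp

/-- The nonlinear term tested against a field. -/
lemma hasSum_inner_bilin {u g : VField} (hu : IsH1 u) (hdiv : ∀ K, ∑ i, u K i * (K i : ℂ) = 0)
    (hg : InV 1 g) :
    HasSum (fun K => L ^ 3 * (inner ℂ (g K) (bilin L u u K)).re) (-(tri L u u g).re) := by
  have hL0 := hL.out
  have hLc : (L : ℂ) ^ 3 ≠ 0 := by exact_mod_cast (pow_pos hL0 3).ne'
  have hg1 := hg.isH1
  have h1 : ∀ i j, HasSum (fun K => 2 * Real.pi * Complex.I * (K i : ℂ) / L * g (-K) j *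
      quad L u i j K) (-∫ x : Torus L, value L u x i * value L u x j *
        value L (partialDeriv L i g) x j) := by
    intro i j
    have h2 := (hasSum_integral_series_mul L (summable_coord (hg1.summable_partialDeriv L i) j)
      (hu.memLp_mul L hu i j)).neg
    rw [← (Equiv.neg (Fin 3 → ℤ)).hasSum_iff] at h2
    have e1 : (fun K => 2 * Real.pi * Complex.I * (K i : ℂ) / L * g (-K) j * quad L u i j K) =
        (fun K => -(partialDeriv L i g K j * ∫ x : Torus L, mode L K x *
          (value L u x i * value L u x j))) ∘ Equiv.neg (Fin 3 → ℤ) := by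
      funext K
      simp only [Function.comp, Equiv.neg_apply, partialDeriv_apply, quad, mode_neg, Pi.neg_apply]
      push_cast; ring
    have e2 : ∫ x : Torus L, value L u x i * value L u x j * value L (partialDeriv L i g) x j =
        ∫ x : Torus L, series L (fun K => partialDeriv L i g K j) x *
          (value L u x i * value L u x j) := by
      congr 1; ext x
      rw [mul_comm]; rfl
    rw [e1, e2]
    exact h2
  have h3 : HasSum (fun K => ∑ i, ∑ j, 2 * Real.pi * Complex.I * (K i : ℂ) / L * g (-K) j *
      quad L u i j K) (-tri L u u g) := by
    rw [tri, ← Finset.sum_neg_distrib]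
    refine hasSum_sum fun i _ => ?_
    rw [← Finset.sum_neg_distrib]
    exact hasSum_sum fun j _ => h1 i j
  have h4 := Complex.hasSum_re h3
  rw [Complex.neg_re] at h4
  convert h4 using 1
  ext K
  by_cases hK : K = 0
  · subst hK; simp [hg.mean_zero]
  have hgdiv : ∑ j, g (-K) j * (K j : ℂ) = 0 := by
    have := hg.div_free (-K)
    simpa using this
  -- Reality turns the conjugate of `g K` into `g (-K)`, and orthogonality to K removes the Leray
  -- projection.
  have h5 : inner ℂ (g K) (bilin L u u K) = ∑ j, coeff L (advect L u u) K j * g (-K) j := by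
    rw [← sum_leray_mul _ hK hgdiv, PiLp.inner_apply]
    refine Finset.sum_congr rfl fun j _ => ?_
    rw [RCLike.inner_apply, hg.real]; rfl
  have h6 : (L : ℂ) ^ 3 * inner ℂ (g K) (bilin L u u K) =
      ∑ i, ∑ j, 2 * Real.pi * Complex.I * (K i : ℂ) / L * g (-K) j * quad L u i j K := by
    rw [h5, Finset.sum_comm, Finset.mul_sum]
    refine Finset.sum_congr rfl fun j _ => ?_
    rw [coeff_advect L hu hdiv, ← mul_assoc, mul_inv_cancel_left₀ hLc, Finset.sum_mul]
    exact Finset.sum_congr rfl fun i _ => by ring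
  rw [← h6, ← Complex.re_ofReal_mul]
  push_cast; rfl

lemma vnorm_zero_sq_eq_integral {u : VField} (hu : Summable fun K => ‖u K‖ ^ 2) :
    vnorm L 0 u ^ 2 = ∫ x : Torus L, ‖value L u x‖ ^ 2 := by
  rw [vnorm_zero_sq, integral_norm_sq_value L hu]

lemma integral_norm_mul_le {u v : VField} (hu : Summable fun K => ‖u K‖ ^ 2)
    (hv : Summable fun K => ‖v K‖ ^ 2) :
    ∫ x : Torus L, ‖value L u x‖ * ‖value L v x‖ ≤ vnorm L 0 u * vnorm L 0 v := by
  have h := sq_integral_mul_le (memLp_value L u).norm (memLp_value L v).norm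
  rw [← vnorm_zero_sq_eq_integral L hu, ← vnorm_zero_sq_eq_integral L hv, ← mul_pow] at h
  exact le_of_sq_le_sq h (mul_nonneg (vnorm_nonneg _ _ _) (vnorm_nonneg _ _ _))

/-- From u_i u_j - v_i v_j = u_i (u - v)_j + (u - v)_i v_j. It yields continuity in time of each
mode of B(u,u). -/
lemma norm_quad_sub_le {u v : VField} (hu : IsH1 u) (hv : IsH1 v) (i j : Fin 3)
    (K : Fin 3 → ℤ) : ‖quad L u i j K - quad L v i j K‖ ≤
      vnorm L 0 u * vnorm L 0 (u - v) + vnorm L 0 (u - v) * vnorm L 0 v := by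
  have hd := hu.sub hv
  have hint : ∀ u v : VField, Integrable fun x : Torus L => ‖value L u x‖ * ‖value L v x‖ :=
    fun u v => (memLp_value L u).norm.integrable_mul (memLp_value L v).norm
  have hq : ∀ {u : VField}, IsH1 u → Integrable fun x : Torus L =>
      conj (mode L K x) * (value L u x i * value L u x j) := fun hu =>
    (memLp_conj_mode_mul L (hu.memLp_mul L hu i j) K).integrable one_le_two
  refine le_trans ?_ (add_le_add (integral_norm_mul_le L hu.summable_sq hd.summable_sq)
    (integral_norm_mul_le L hd.summable_sq hv.summable_sq))
  rw [quad, quad, ← integral_sub (hq hu) (hq hv), ← integral_add (hint _ _) (hint _ _)]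
  refine norm_integral_le_of_norm_le ((hint _ _).add (hint _ _)) ?_
  filter_upwards [value_sub L hu.summable_sq hv.summable_sq] with x hx
  have e : conj (mode L K x) * (value L u x i * value L u x j) -
      conj (mode L K x) * (value L v x i * value L v x j) =
      conj (mode L K x) * (value L u x i * value L (u - v) x j +
        value L (u - v) x i * value L v x j) := by
    rw [hx, PiLp.sub_apply, PiLp.sub_apply]; ring
  rw [e, norm_mul, RCLike.norm_conj, norm_mode, one_mul]
  refine (norm_add_le _ _).trans ?_
  rw [norm_mul, norm_mul]
  gcongr <;> exact norm_coord_le _ _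

end Bilinear

/-! ### From the equations of the modes to an energy inequality. -/

section Energy

/-- The product rule for absolutely continuous functions, as h is merely integrable. The primitive
`X` stands in for x, about which nothing is known outside [a, b]. -/
lemma sq_sub_sq_eq_integral {x h : ℝ → ℝ} {a b : ℝ} (hab : a ≤ b)
    (hh : IntervalIntegrable h volume a b)
    (hx : ∀ t ∈ Set.Icc a b, x t - x a = ∫ s in a..t, h s) :
    x b ^ 2 - x a ^ 2 = ∫ s in a..b, 2 * (x s * h s) := by
  set X : ℝ → ℝ := fun t => (∫ s in a..t, h s) + x a with hX
  have hXx : ∀ t ∈ Set.Icc a b, X t = x t := fun t ht => by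
    simp only [hX]; rw [← hx t ht]; ring
  have hac : AbsolutelyContinuousOnInterval X a b := by
    refine (hh.absolutelyContinuousOnInterval_intervalIntegral (c := a) (by simp)).add ?_
    exact (LipschitzWith.const (x a)).lipschitzOnWith.absolutelyContinuousOnInterval
  have h1 := AbsolutelyContinuousOnInterval.integral_deriv_mul_eq_sub hac hac
  rw [hXx b ⟨hab, le_rfl⟩, hXx a ⟨le_rfl, hab⟩] at h1
  rw [sq, sq, ← h1]
  refine intervalIntegral.integral_congr_ae ?_
  filter_upwards [hh.ae_hasDerivAt_integral] with t ht hmem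
  rw [Set.uIoc_of_le hab] at hmem
  have hmem' : t ∈ Set.Icc a b := Set.Ioc_subset_Icc_self hmem
  have hd : HasDerivAt X (h t) t :=
    (ht (by rwa [Set.uIcc_of_le hab]) a (by simp)).add_const _
  rw [hd.deriv, hXx t hmem']; ring

lemma norm_sq_sub_norm_sq_eq_integral {y h : ℝ → EuclideanSpace ℂ (Fin 3)} {a b : ℝ}
    (hab : a ≤ b) (hh : IntervalIntegrable h volume a b)
    (hy : ∀ t ∈ Set.Icc a b, y t - y a = ∫ s in a..t, h s) :
    ‖y b‖ ^ 2 - ‖y a‖ ^ 2 = ∫ s in a..b, 2 * (inner ℂ (y s) (h s)).re := by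
  have hj : ∀ (T : EuclideanSpace ℂ (Fin 3) →L[ℝ] ℝ),
      T (y b) ^ 2 - T (y a) ^ 2 = ∫ s in a..b, 2 * (T (y s) * T (h s)) := by
    intro T
    refine sq_sub_sq_eq_integral (x := fun s => T (y s)) (h := fun s => T (h s)) hab
      ⟨T.integrable_comp hh.1, T.integrable_comp hh.2⟩
      fun t ht => ?_
    rw [← map_sub, hy t ht, T.intervalIntegral_comp_comm]
    refine hh.mono_set ?_
    rw [Set.uIcc_of_le ht.1, Set.uIcc_of_le hab]
    exact Set.Icc_subset_Icc_right ht.2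
  have hyc : ContinuousOn y (Set.Icc a b) := by
    have h1 : ContinuousOn (fun t => (∫ s in a..t, h s) + y a) (Set.Icc a b) := by
      have := intervalIntegral.continuousOn_primitive_interval (μ := volume) (f := h) (a := a)
        (b := b) (by
          rw [Set.uIcc_of_le hab]
          exact (intervalIntegrable_iff_integrableOn_Icc_of_le hab).1 hh)
      rw [Set.uIcc_of_le hab] at this
      exact this.add continuousOn_const
    exact h1.congr fun t ht => by simp only; rw [← hy t ht]; abel
  let re : Fin 3 → EuclideanSpace ℂ (Fin 3) →L[ℝ] ℝ := fun j =>
    Complex.reCLM.comp ((EuclideanSpace.proj (𝕜 := ℂ) j).restrictScalars ℝ)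
  let im : Fin 3 → EuclideanSpace ℂ (Fin 3) →L[ℝ] ℝ := fun j =>
    Complex.imCLM.comp ((EuclideanSpace.proj (𝕜 := ℂ) j).restrictScalars ℝ)
  have hre : ∀ j x, re j x = (x j).re := fun _ _ => rfl
  have him : ∀ j x, im j x = (x j).im := fun _ _ => rfl
  have hnorm : ∀ x : EuclideanSpace ℂ (Fin 3), ‖x‖ ^ 2 = ∑ j, (re j x ^ 2 + im j x ^ 2) := by
    intro x
    rw [EuclideanSpace.norm_sq_eq]
    refine Finset.sum_congr rfl fun j _ => ?_
    rw [hre, him, ← Complex.normSq_eq_norm_sq, Complex.normSq_apply]; ring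
  have hinner : ∀ x z : EuclideanSpace ℂ (Fin 3), 2 * (inner ℂ x z).re =
      ∑ j, (2 * (re j x * re j z) + 2 * (im j x * im j z)) := by
    intro x z
    rw [PiLp.inner_apply, Complex.re_sum, Finset.mul_sum]
    refine Finset.sum_congr rfl fun j _ => ?_
    rw [hre, him, hre, him, RCLike.inner_apply, Complex.mul_re, Complex.conj_re, Complex.conj_im]
    ring
  have hint : ∀ (T : EuclideanSpace ℂ (Fin 3) →L[ℝ] ℝ),
      IntervalIntegrable (fun s => 2 * (T (y s) * T (h s))) volume a b := by
    intro T
    have h1 : IntervalIntegrable (fun s => T (h s)) volume a b :=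
      ⟨T.integrable_comp hh.1, T.integrable_comp hh.2⟩
    refine (h1.continuousOn_mul ?_).const_mul 2
    rw [Set.uIcc_of_le hab]
    exact T.continuous.comp_continuousOn hyc
  simp only [hnorm, hinner]
  rw [intervalIntegral.integral_finsetSum fun j _ => (hint (re j)).add (hint (im j)),
    ← Finset.sum_sub_distrib]
  refine Finset.sum_congr rfl fun j _ => ?_
  rw [intervalIntegral.integral_add (hint _) (hint _), ← hj, ← hj]; ring

/-- By continuity of E, the inequality on short intervals [x, z] bounds the right difference
quotients of E at x by any number above -kE(x) + R, which is all that Gronwall's lemma needs. The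
negative term -(R/k)exp(-k(t - a)) is dropped. -/
lemma le_exp_of_integral_le {E : ℝ → ℝ} {a b k R : ℝ} (hk : 0 < k) (hR : 0 ≤ R)
    (hc : ContinuousOn E (Set.Icc a b))
    (h : ∀ s t, a ≤ s → s ≤ t → t ≤ b → E t - E s ≤ ∫ r in s..t, (-k * E r + R)) :
    ∀ t ∈ Set.Icc a b, E t ≤ Real.exp (-k * (t - a)) * E a + R / k := by
  have hcf : ContinuousOn (fun r => -k * E r + R) (Set.Icc a b) :=
    (continuousOn_const.mul hc).add continuousOn_const
  intro t ht
  have hg := le_gronwallBound_of_liminf_deriv_right_le (f := E) (f' := fun r => -k * E r + R)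
    (δ := E a) (K := -k) (ε := R) hc ?_ le_rfl (fun _ _ => le_rfl) t ht
  · rw [gronwallBound_of_K_ne_0 (neg_ne_zero.2 hk.ne')] at hg
    have h1 : R / -k * (Real.exp (-k * (t - a)) - 1) ≤ R / k := by
      have h2 : R / -k * (Real.exp (-k * (t - a)) - 1) =
          R / k - R / k * Real.exp (-k * (t - a)) := by
        rw [div_neg]; ring
      have h3 : 0 ≤ R / k * Real.exp (-k * (t - a)) := by positivity
      linarith
    simp only at hg
    linarith
  · intro x hx r hr
    obtain ⟨r', hr1, hr2⟩ := exists_between hr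
    have h1 : ∀ᶠ z in 𝓝[≥] x, -k * E z + R < r' := by
      have h2 : ContinuousWithinAt (fun r => -k * E r + R) (Set.Ico x b) x :=
        (hcf x ⟨hx.1, hx.2.le⟩).mono fun z hz => ⟨hx.1.trans hz.1, hz.2.le⟩
      have h3 := h2.eventually (gt_mem_nhds hr1)
      rwa [nhdsWithin_Ico_eq_nhdsGE hx.2] at h3
    obtain ⟨c, hc1, hc2⟩ := (mem_nhdsGE_iff_exists_Ico_subset).1 h1
    refine Eventually.frequently ?_
    have h4 : Set.Ioo x (min c b) ∈ 𝓝[>] x := Ioo_mem_nhdsGT (lt_min hc1 hx.2)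
    filter_upwards [h4] with z hz
    have hzc : z < c := hz.2.trans_le (min_le_left _ _)
    have hzb : z ≤ b := (hz.2.trans_le (min_le_right _ _)).le
    have hxz : 0 < z - x := sub_pos.2 hz.1
    have h5 : ∫ r in x..z, (-k * E r + R) ≤ ∫ _ in x..z, r' := by
      refine intervalIntegral.integral_mono_on hz.1.le ?_ intervalIntegrable_const fun s hs =>
        (hc2 ⟨hs.1, hs.2.trans_lt hzc⟩).le
      refine (hcf.mono ?_).intervalIntegrable
      rw [Set.uIcc_of_le hz.1.le]
      exact Set.Icc_subset_Icc hx.1 hzb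
    rw [intervalIntegral.integral_const, smul_eq_mul] at h5
    have h6 := (h x z hx.1 hz.1.le hzb).trans h5
    rw [inv_mul_lt_iff₀ hxz]
    nlinarith

/-- An energy estimate for a system of countably many modes. -/
lemma energy_le {ι : Type*} [Countable ι] {a b k R : ℝ} (hk : 0 < k) (hR : 0 ≤ R)
    {m : ι → ℝ} {y h : ι → ℝ → EuclideanSpace ℂ (Fin 3)}
    (hh : ∀ K, IntervalIntegrable (h K) volume a b)
    (hy : ∀ K, ∀ t ∈ Set.Icc a b, y K t - y K a = ∫ s in a..t, h K s)
    {E : ℝ → ℝ} (hE : ∀ t ∈ Set.Icc a b, HasSum (fun K => m K * ‖y K t‖ ^ 2) (E t))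
    (hEc : ContinuousOn E (Set.Icc a b)) {Φ : ℝ → ℝ} (hΦ : IntegrableOn Φ (Set.Icc a b))
    (hD : ∀ᵐ s ∂volume.restrict (Set.Icc a b), ∃ d,
      HasSum (fun K => m K * (2 * (inner ℂ (y K s) (h K s)).re)) d ∧ d ≤ -k * E s + R ∧
      ∀ S : Finset ι, |∑ K ∈ S, m K * (2 * (inner ℂ (y K s) (h K s)).re)| ≤ Φ s) :
    ∀ t ∈ Set.Icc a b, E t ≤ Real.exp (-k * (t - a)) * E a + R / k := by
  refine le_exp_of_integral_le hk hR hEc fun s t has hst htb => ?_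
  have hsub : Set.Icc s t ⊆ Set.Icc a b := Set.Icc_subset_Icc has htb
  have hab : a ≤ b := has.trans (hst.trans htb)
  have hhs : ∀ K, IntervalIntegrable (h K) volume s t := fun K => (hh K).mono_set (by
    rw [Set.uIcc_of_le hst, Set.uIcc_of_le hab]; exact hsub)
  have hys : ∀ K, ∀ r ∈ Set.Icc s t, y K r - y K s = ∫ q in s..r, h K q := by
    intro K r hr
    have i1 : ∀ c ∈ Set.Icc a b, IntervalIntegrable (h K) volume a c := fun c hc =>
      (hh K).mono_set (by
        rw [Set.uIcc_of_le hc.1, Set.uIcc_of_le hab]; exact Set.Icc_subset_Icc_right hc.2)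
    rw [← intervalIntegral.integral_interval_sub_left (i1 r (hsub hr)) (i1 s ⟨has, hst.trans htb⟩),
      ← hy K r (hsub hr), ← hy K s ⟨has, hst.trans htb⟩]
    abel
  set G : ι → ℝ → ℝ := fun K r => m K * (2 * (inner ℂ (y K r) (h K r)).re) with hG
  have hyc : ∀ K, ContinuousOn (y K) (Set.Icc s t) := by
    intro K
    have h1 : ContinuousOn (fun r => (∫ q in s..r, h K q) + y K s) (Set.Icc s t) := by
      have := intervalIntegral.continuousOn_primitive_interval (μ := volume) (f := h K) (a := s)
        (b := t) (by
          rw [Set.uIcc_of_le hst]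
          exact (intervalIntegrable_iff_integrableOn_Icc_of_le hst).1 (hhs K))
      rw [Set.uIcc_of_le hst] at this
      exact this.add continuousOn_const
    exact h1.congr fun r hr => by simp only; rw [← hys K r hr]; abel
  have hGm : ∀ K, AEStronglyMeasurable (G K) (volume.restrict (Set.Ioc s t)) := by
    intro K
    have h1 : AEStronglyMeasurable (y K) (volume.restrict (Set.Ioc s t)) :=
      ((hyc K).mono Set.Ioc_subset_Icc_self).aestronglyMeasurable measurableSet_Ioc
    have h2 := h1.inner (𝕜 := ℂ) (hhs K).1.1
    exact ((Complex.continuous_re.comp_aestronglyMeasurable h2).const_mul 2).const_mul (m K)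
  have hae : ∀ᵐ r ∂volume.restrict (Set.Ioc s t), ∃ d, HasSum (fun K => G K r) d ∧
      d ≤ -k * E r + R ∧ ∀ S : Finset ι, |∑ K ∈ S, G K r| ≤ Φ r :=
    ae_restrict_of_ae_restrict_of_subset (Set.Ioc_subset_Icc_self.trans hsub) hD
  have hΦs : Integrable Φ (volume.restrict (Set.Ioc s t)) :=
    hΦ.mono_set (Set.Ioc_subset_Icc_self.trans hsub)
  have hGi : ∀ K, Integrable (G K) (volume.restrict (Set.Ioc s t)) := by
    intro K
    refine hΦs.mono' (hGm K) ?_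
    filter_upwards [hae] with r ⟨d, _, _, hd⟩
    simpa using hd {K}
  set D : ℝ → ℝ := fun r => ∑' K, G K r with hDdef
  have hlim : ∀ᵐ r ∂volume.restrict (Set.Ioc s t),
      Tendsto (fun S : Finset ι => ∑ K ∈ S, G K r) atTop (𝓝 (D r)) := by
    filter_upwards [hae] with r ⟨d, hd, _, _⟩
    exact hd.summable.hasSum
  have hSm : ∀ S : Finset ι, AEStronglyMeasurable (fun r => ∑ K ∈ S, G K r)
      (volume.restrict (Set.Ioc s t)) := fun S =>
    (integrable_finsetSum S fun K _ => hGi K).1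
  have hDi : Integrable D (volume.restrict (Set.Ioc s t)) := by
    refine hΦs.mono' (aestronglyMeasurable_of_tendsto_ae atTop hSm hlim) ?_
    filter_upwards [hae, hlim] with r ⟨d, _, _, hd⟩ hr
    exact le_of_tendsto hr.norm (Eventually.of_forall hd)
  -- The integrals of the finite sums have two limits: the integral of `D`, by domination by Φ, and
  -- E t - E s, by the energy identity of each mode. Countability of ι makes the filter on finite
  -- sets countably generated, as dominated convergence requires.
  have h1 : Tendsto (fun S : Finset ι => ∫ r in Set.Ioc s t, ∑ K ∈ S, G K r) atTop
      (𝓝 (∫ r in Set.Ioc s t, D r)) := by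
    refine tendsto_integral_filter_of_dominated_convergence Φ (Eventually.of_forall hSm)
      (Eventually.of_forall fun S => ?_) hΦs hlim
    filter_upwards [hae] with r ⟨d, _, _, hd⟩
    exact hd S
  have h2 : Tendsto (fun S : Finset ι => ∫ r in Set.Ioc s t, ∑ K ∈ S, G K r) atTop
      (𝓝 (E t - E s)) := by
    refine ((hE t ⟨has.trans hst, htb⟩).sub (hE s ⟨has, hst.trans htb⟩)).congr fun S => ?_
    rw [integral_finsetSum S fun K _ => hGi K]
    refine Finset.sum_congr rfl fun K _ => ?_
    change m K * ‖y K t‖ ^ 2 - m K * ‖y K s‖ ^ 2 = _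
    rw [← mul_sub, norm_sq_sub_norm_sq_eq_integral hst (hhs K) (hys K),
      intervalIntegral.integral_of_le hst, ← integral_const_mul]
  rw [tendsto_nhds_unique h2 h1, intervalIntegral.integral_of_le hst]
  refine integral_mono_ae hDi ?_ ?_
  · refine ContinuousOn.integrableOn_Icc ?_ |>.mono_set Set.Ioc_subset_Icc_self
    exact ((continuousOn_const.mul hEc).add continuousOn_const).mono hsub
  · filter_upwards [hae] with r ⟨d, hd, hd2, _⟩
    rw [hDdef]
    simp only
    rw [hd.tsum_eq]
    exact hd2

end Energy

/-! ### Norms as ℓ² sums of amplitudes, and absolute bounds for the pairings. -/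

section Amplitudes

variable (L : ℝ) [hL : Fact (0 < L)]

/-- The amplitude of a mode of a field, as it enters the norm of `V_s`. -/
noncomputable def amp (s : ℕ) (u : VField) (K : Fin 3 → ℤ) : ℝ :=
  modeNorm L * wave L K ^ s * ‖u K‖

lemma amp_nonneg (s : ℕ) (u : VField) (K : Fin 3 → ℤ) : 0 ≤ amp L s u K :=
  mul_nonneg (mul_nonneg (modeNorm_pos L).le (pow_nonneg (wave_nonneg L K) s)) (norm_nonneg _)

lemma amp_sq (s : ℕ) (u : VField) (K : Fin 3 → ℤ) :
    amp L s u K ^ 2 = L ^ 3 * (wave L K ^ (2 * s) * ‖u K‖ ^ 2) := by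
  rw [amp, mul_pow, mul_pow, modeNorm_sq]; ring

lemma amp_add_le (s : ℕ) (u v : VField) (K : Fin 3 → ℤ) :
    amp L s (u + v) K ≤ amp L s u K + amp L s v K := by
  rw [amp, amp, amp, ← mul_add]
  exact mul_le_mul_of_nonneg_left (norm_add_le _ _)
    (mul_nonneg (modeNorm_pos L).le (pow_nonneg (wave_nonneg L K) s))

lemma amp_neg (s : ℕ) (u : VField) (K : Fin 3 → ℤ) : amp L s (-u) K = amp L s u K := by
  simp [amp]

lemma vnorm_neg (s : ℕ) (u : VField) : vnorm L s (-u) = vnorm L s u := by simp [vnorm]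

lemma vnorm_sq_eq_tsum_amp (s : ℕ) (u : VField) : vnorm L s u ^ 2 = ∑' K, amp L s u K ^ 2 := by
  rw [vnorm_sq, ← tsum_mul_left]
  exact tsum_congr fun K => by rw [amp_sq, wave]

lemma InV.summable_amp {s : ℕ} {u : VField} (hu : InV s u) :
    Summable fun K => amp L s u K ^ 2 := by
  refine (hu.summable.mul_left (L ^ 3 * (2 * Real.pi / L) ^ (2 * s))).congr fun K => ?_
  rw [amp_sq, wave, mul_div_right_comm, mul_pow]; ring

lemma hasSum_amp {s : ℕ} {u : VField} (hu : Summable fun K => amp L s u K ^ 2) :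
    HasSum (fun K => amp L s u K ^ 2) (vnorm L s u ^ 2) := by
  rw [vnorm_sq_eq_tsum_amp]; exact hu.hasSum

lemma IsH1.summable_amp_zero {u : VField} (hu : IsH1 u) : Summable fun K => amp L 0 u K ^ 2 := by
  refine (hu.summable_sq.mul_left (L ^ 3)).congr fun K => ?_
  rw [amp_sq]; simp

lemma sum_mul_le_of_hasSum {ι : Type*} {a b : ι → ℝ} {A B : ℝ} (hA : 0 ≤ A) (hB : 0 ≤ B)
    (ha : HasSum (fun i => a i ^ 2) (A ^ 2)) (hb : HasSum (fun i => b i ^ 2) (B ^ 2))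
    (S : Finset ι) : ∑ i ∈ S, a i * b i ≤ A * B := by
  refine (Real.sum_mul_le_sqrt_mul_sqrt S a b).trans ?_
  refine mul_le_mul ?_ ?_ (Real.sqrt_nonneg _) hA
  · exact Real.sqrt_le_iff.2 ⟨hA, sum_le_hasSum S (fun _ _ => sq_nonneg _) ha⟩
  · exact Real.sqrt_le_iff.2 ⟨hB, sum_le_hasSum S (fun _ _ => sq_nonneg _) hb⟩

lemma sum_amp_mul_amp_le {s r : ℕ} {u v : VField} (hu : Summable fun K => amp L s u K ^ 2)
    (hv : Summable fun K => amp L r v K ^ 2) (S : Finset (Fin 3 → ℤ)) :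
    ∑ K ∈ S, amp L s u K * amp L r v K ≤ vnorm L s u * vnorm L r v :=
  sum_mul_le_of_hasSum (vnorm_nonneg _ _ _) (vnorm_nonneg _ _ _) (hasSum_amp L hu)
    (hasSum_amp L hv) S

lemma summable_amp_add {s : ℕ} {u v : VField} (hu : Summable fun K => amp L s u K ^ 2)
    (hv : Summable fun K => amp L s v K ^ 2) : Summable fun K => amp L s (u + v) K ^ 2 := by
  refine ((hu.add hv).mul_left 2).of_nonneg_of_le (fun _ => sq_nonneg _) fun K => ?_
  nlinarith [amp_add_le L s u v K, amp_nonneg L s (u + v) K, amp_nonneg L s u K,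
    amp_nonneg L s v K, sq_nonneg (amp L s u K - amp L s v K)]

lemma summable_amp_sub {s : ℕ} {u v : VField} (hu : Summable fun K => amp L s u K ^ 2)
    (hv : Summable fun K => amp L s v K ^ 2) : Summable fun K => amp L s (u - v) K ^ 2 := by
  rw [sub_eq_add_neg]
  exact summable_amp_add L hu (by simpa only [amp_neg] using hv)

lemma vnorm_add_le {s : ℕ} {u v : VField} (hu : Summable fun K => amp L s u K ^ 2)
    (hv : Summable fun K => amp L s v K ^ 2) :
    vnorm L s (u + v) ≤ vnorm L s u + vnorm L s v := by
  refine le_of_sq_le_sq ?_ (add_nonneg (vnorm_nonneg _ _ _) (vnorm_nonneg _ _ _))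
  rw [vnorm_sq_eq_tsum_amp]
  refine (summable_amp_add L hu hv).tsum_le_of_sum_le fun S => ?_
  have h1 := sum_amp_mul_amp_le L hu hv S
  have h2 := sum_le_hasSum S (fun _ _ => sq_nonneg _) (hasSum_amp L hu)
  have h3 := sum_le_hasSum S (fun _ _ => sq_nonneg _) (hasSum_amp L hv)
  calc ∑ K ∈ S, amp L s (u + v) K ^ 2 ≤ ∑ K ∈ S, (amp L s u K + amp L s v K) ^ 2 :=
        Finset.sum_le_sum fun K _ => pow_le_pow_left₀ (amp_nonneg _ _ _ _) (amp_add_le L s u v K) 2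
    _ = ∑ K ∈ S, amp L s u K ^ 2 + 2 * ∑ K ∈ S, amp L s u K * amp L s v K +
        ∑ K ∈ S, amp L s v K ^ 2 := by
        rw [Finset.mul_sum, ← Finset.sum_add_distrib, ← Finset.sum_add_distrib]
        exact Finset.sum_congr rfl fun K _ => by ring
    _ ≤ (vnorm L s u + vnorm L s v) ^ 2 := by nlinarith

lemma vnorm_sub_le {s : ℕ} {u v : VField} (hu : Summable fun K => amp L s u K ^ 2)
    (hv : Summable fun K => amp L s v K ^ 2) :
    vnorm L s (u - v) ≤ vnorm L s u + vnorm L s v := by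
  rw [sub_eq_add_neg, ← vnorm_neg L s v]
  exact vnorm_add_le L hu (by simpa only [amp_neg] using hv)

lemma abs_vnorm_sub_le {s : ℕ} {u v : VField} (hu : Summable fun K => amp L s u K ^ 2)
    (hv : Summable fun K => amp L s v K ^ 2) :
    |vnorm L s u - vnorm L s v| ≤ vnorm L s (u - v) := by
  have hd := summable_amp_sub L hu hv
  have h1 := vnorm_add_le L hv hd
  have h2 := vnorm_sub_le L hu hd
  rw [add_sub_cancel] at h1
  rw [sub_sub_cancel] at h2
  rw [abs_le]
  constructor <;> linarith

lemma lam_pos : 0 < lam L := by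
  have := hL.out
  have := Real.pi_pos
  unfold lam; positivity

lemma lam_le_wave_sq {K : Fin 3 → ℤ} (hK : K ≠ 0) : lam L ≤ wave L K ^ 2 := by
  have h : wave L K ^ 2 = lam L * kabs K ^ 2 := by rw [wave, lam]; ring
  rw [h]
  exact le_mul_of_one_le_right (lam_pos L).le (one_le_pow₀ (one_le_kabs hK))

lemma lam_mul_vnorm_sq_le {s : ℕ} {u : VField} (h0 : u 0 = 0)
    (hu : Summable fun K => amp L s u K ^ 2) (hu' : Summable fun K => amp L (s + 1) u K ^ 2) :
    lam L * vnorm L s u ^ 2 ≤ vnorm L (s + 1) u ^ 2 := by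
  refine hasSum_le (fun K => ?_) ((hasSum_amp L hu).mul_left (lam L)) (hasSum_amp L hu')
  by_cases hK : K = 0
  · subst hK; simp [amp, h0]
  · have h1 : amp L (s + 1) u K ^ 2 = wave L K ^ 2 * amp L s u K ^ 2 := by
      rw [amp_sq, amp_sq]; ring
    rw [h1]
    exact mul_le_mul_of_nonneg_right (lam_le_wave_sq L hK) (sq_nonneg _)

lemma norm_le_vnorm_zero {u : VField} (hu : Summable fun K => amp L 0 u K ^ 2)
    (K : Fin 3 → ℤ) : ‖u K‖ ≤ (modeNorm L)⁻¹ * vnorm L 0 u := by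
  rw [inv_mul_eq_div, le_div_iff₀ (modeNorm_pos L)]
  refine le_of_sq_le_sq ?_ (vnorm_nonneg _ _ _)
  have h := le_hasSum (hasSum_amp L hu) K fun _ _ => sq_nonneg _
  refine le_trans (le_of_eq ?_) h
  rw [amp]; ring

lemma InV.sub {s : ℕ} {u v : VField} (hu : InV s u) (hv : InV s v) : InV s (u - v) where
  mean_zero := by simp [hu.mean_zero, hv.mean_zero]
  real K i := by simp [hu.real, hv.real]
  div_free K := by
    simp only [Pi.sub_apply, PiLp.sub_apply, sub_mul]
    rw [Finset.sum_sub_distrib, hu.div_free, hv.div_free, sub_zero]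
  summable := by
    simp only [Pi.sub_apply, sub_eq_add_neg]
    refine summable_sq_add (fun K => pow_nonneg (kabs_nonneg K) _) hu.summable ?_
    simpa only [norm_neg] using hv.summable

/-- The nonlinear term paired with a field, summed absolutely. -/
lemma sum_inner_bilin_le {u g : VField} (hu : InV 1 u) (hg : Summable fun K => amp L 1 g K ^ 2)
    (S : Finset (Fin 3 → ℤ)) :
    ∑ K ∈ S, |L ^ 3 * (inner ℂ (g K) (bilin L u u K)).re| ≤ √(fourth L u) * vnorm L 1 g := by
  obtain ⟨h1, h2⟩ := quadNorm_summable L hu.isH1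
  have hL3 : (0 : ℝ) ≤ L ^ 3 := (pow_pos hL.out 3).le
  have h3 : HasSum (fun K => (modeNorm L * quadNorm L u K) ^ 2)
      (√(L ^ 3 * ∑' K, quadNorm L u K ^ 2) ^ 2) := by
    rw [Real.sq_sqrt (mul_nonneg hL3 (tsum_nonneg fun _ => sq_nonneg _))]
    simp only [mul_pow, modeNorm_sq]
    exact h1.hasSum.mul_left _
  calc _ ≤ ∑ K ∈ S, modeNorm L * quadNorm L u K * amp L 1 g K := by
        refine Finset.sum_le_sum fun K _ => ?_
        rw [abs_mul, abs_of_nonneg hL3, ← modeNorm_sq]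
        have h4 := (Complex.abs_re_le_norm _).trans (norm_inner_le_norm (𝕜 := ℂ) (g K)
          (bilin L u u K))
        have h5 := norm_bilin_le L hu.isH1 hu.div_free K
        calc _ ≤ modeNorm L ^ 2 * (‖g K‖ * (wave L K * quadNorm L u K)) := by
              gcongr; exact h4.trans (by gcongr)
          _ = _ := by rw [amp]; ring
    _ ≤ √(L ^ 3 * ∑' K, quadNorm L u K ^ 2) * vnorm L 1 g :=
        sum_mul_le_of_hasSum (Real.sqrt_nonneg _) (vnorm_nonneg _ _ _) h3 (hasSum_amp L hg) S
    _ ≤ _ := mul_le_mul_of_nonneg_right (Real.sqrt_le_sqrt h2) (vnorm_nonneg _ _ _)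

/-- The residual `f - B(u, u)`, smoothed by `(I + α² A)⁻¹`, paired with `A g`. -/
lemma sum_inner_residual_le {α : ℝ} (hα : 0 < α) {u g f : VField} (hu : InV 1 u)
    (hg : Summable fun K => amp L 2 g K ^ 2) (hf : Summable fun K => amp L 0 f K ^ 2)
    (S : Finset (Fin 3 → ℤ)) :
    ∑ K ∈ S, |L ^ 3 * (wave L K ^ 2 / (1 + α ^ 2 * wave L K ^ 2) *
      (inner ℂ (g K) (f K - bilin L u u K)).re)| ≤
      (vnorm L 0 f + √(fourth L u) / (α ^ 2 * √(lam L))) * vnorm L 2 g := by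
  obtain ⟨h1, h2⟩ := quadNorm_summable L hu.isH1
  have hL3 : (0 : ℝ) ≤ L ^ 3 := (pow_pos hL.out 3).le
  have hl : 0 < √(lam L) := Real.sqrt_pos.2 (lam_pos L)
  have h3 : HasSum (fun K => (modeNorm L * quadNorm L u K) ^ 2)
      (√(L ^ 3 * ∑' K, quadNorm L u K ^ 2) ^ 2) := by
    rw [Real.sq_sqrt (mul_nonneg hL3 (tsum_nonneg fun _ => sq_nonneg _))]
    simp only [mul_pow, modeNorm_sq]
    exact h1.hasSum.mul_left _
  have h4 : ∀ K, |L ^ 3 * (wave L K ^ 2 / (1 + α ^ 2 * wave L K ^ 2) *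
      (inner ℂ (g K) (f K - bilin L u u K)).re)| ≤ amp L 0 f K * amp L 2 g K +
      (α ^ 2 * √(lam L))⁻¹ * (modeNorm L * quadNorm L u K * amp L 2 g K) := by
    intro K
    have hd : 0 < 1 + α ^ 2 * wave L K ^ 2 := by positivity
    have h5 := (Complex.abs_re_le_norm _).trans (norm_inner_le_norm (𝕜 := ℂ) (g K)
      (f K - bilin L u u K))
    have h6 := norm_bilin_le L hu.isH1 hu.div_free K
    -- The factor 1 + α²k² is at least 1, which serves f, and at least α²√λ₁ k because k ≥ √λ₁ off
    -- the zero mode, which absorbs the one derivative in B(u,u).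
    have h7 : ‖f K - bilin L u u K‖ ≤ (1 + α ^ 2 * wave L K ^ 2) *
        (‖f K‖ + (α ^ 2 * √(lam L))⁻¹ * quadNorm L u K) := by
      refine (norm_sub_le _ _).trans ?_
      rw [mul_add]
      refine add_le_add (le_mul_of_one_le_left (norm_nonneg _)
        (by nlinarith [sq_nonneg (α * wave L K)])) ?_
      rw [← mul_assoc]
      refine h6.trans (mul_le_mul_of_nonneg_right ?_ (quadNorm_nonneg L u K))
      rw [← div_eq_mul_inv, le_div_iff₀ (by positivity)]
      by_cases hK : K = 0
      · subst hK; simp [wave, kabs_zero]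
      · have h8 : √(lam L) ≤ wave L K :=
          Real.sqrt_le_iff.2 ⟨wave_nonneg L K, lam_le_wave_sq L hK⟩
        have h9 : wave L K * (α ^ 2 * √(lam L)) ≤ wave L K * (α ^ 2 * wave L K) := by
          have := wave_nonneg L K
          gcongr
        linarith
    rw [abs_mul, abs_mul, abs_of_nonneg hL3, abs_of_nonneg (by positivity), ← modeNorm_sq]
    calc _ ≤ modeNorm L ^ 2 * (wave L K ^ 2 / (1 + α ^ 2 * wave L K ^ 2) *
          (‖g K‖ * ((1 + α ^ 2 * wave L K ^ 2) *
            (‖f K‖ + (α ^ 2 * √(lam L))⁻¹ * quadNorm L u K)))) := by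
          gcongr; exact h5.trans (by gcongr)
      _ = _ := by rw [amp, amp]; field_simp
  calc _ ≤ ∑ K ∈ S, (amp L 0 f K * amp L 2 g K +
        (α ^ 2 * √(lam L))⁻¹ * (modeNorm L * quadNorm L u K * amp L 2 g K)) :=
        Finset.sum_le_sum fun K _ => h4 K
    _ = ∑ K ∈ S, amp L 0 f K * amp L 2 g K +
        (α ^ 2 * √(lam L))⁻¹ * ∑ K ∈ S, modeNorm L * quadNorm L u K * amp L 2 g K := by
        rw [Finset.sum_add_distrib, Finset.mul_sum]
    _ ≤ vnorm L 0 f * vnorm L 2 g + (α ^ 2 * √(lam L))⁻¹ *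
        (√(L ^ 3 * ∑' K, quadNorm L u K ^ 2) * vnorm L 2 g) := by
        gcongr
        · exact sum_amp_mul_amp_le L hf hg S
        · exact sum_mul_le_of_hasSum (Real.sqrt_nonneg _) (vnorm_nonneg _ _ _) h3
            (hasSum_amp L hg) S
    _ ≤ vnorm L 0 f * vnorm L 2 g + (α ^ 2 * √(lam L))⁻¹ *
        (√(fourth L u) * vnorm L 2 g) := by
        have := vnorm_nonneg L 2 g
        gcongr
    _ = _ := by rw [div_eq_inv_mul]; ring

lemma sum_inner_le {f g : VField} (hf : Summable fun K => amp L 0 f K ^ 2)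
    (hg : Summable fun K => amp L 0 g K ^ 2) (S : Finset (Fin 3 → ℤ)) :
    ∑ K ∈ S, |L ^ 3 * (inner ℂ (g K) (f K)).re| ≤ vnorm L 0 f * vnorm L 0 g := by
  refine (Finset.sum_le_sum fun K _ => ?_).trans (sum_amp_mul_amp_le L hf hg S)
  rw [abs_mul, abs_of_nonneg (pow_pos hL.out 3).le, ← modeNorm_sq]
  calc _ ≤ modeNorm L ^ 2 * (‖g K‖ * ‖f K‖) := by
        gcongr
        exact (Complex.abs_re_le_norm _).trans (norm_inner_le_norm (𝕜 := ℂ) _ _)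
    _ = _ := by rw [amp, amp]; ring

lemma abs_tsum_le_of_sum_abs_le {ι : Type*} {a : ι → ℝ} {A : ℝ}
    (h : ∀ S : Finset ι, ∑ i ∈ S, |a i| ≤ A) : Summable a ∧ |∑' i, a i| ≤ A := by
  have hs : Summable fun i => |a i| := summable_of_sum_le (fun _ => abs_nonneg _) h
  refine ⟨hs.of_abs, ?_⟩
  have h1 := norm_tsum_le_tsum_norm (f := a) (by simpa using hs)
  exact h1.trans (hs.tsum_le_of_sum_le h)

end Amplitudes

lemma re_inner_real_smul (r : ℝ) (x y : EuclideanSpace ℂ (Fin 3)) :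
    (inner ℂ x (r • y)).re = r * (inner ℂ x y).re := by
  rw [← Complex.coe_smul, inner_smul_right, Complex.re_ofReal_mul]

lemma re_inner_self (x : EuclideanSpace ℂ (Fin 3)) : (inner ℂ x x).re = ‖x‖ ^ 2 := by
  rw [inner_self_eq_norm_sq_to_K]
  norm_cast

/-! ### Continuity in time of the norms, the modes and the nonlinear term. -/

section Paths

variable (L : ℝ) [hL : Fact (0 < L)]

/-- `u` is a continuous function on `I` with values in `V`. -/
structure IsPath (I : Set ℝ) (u : ℝ → VField) : Prop where
  mem : ∀ t ∈ I, InV 1 (u t)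
  tendsto : ∀ t ∈ I, Tendsto (fun s => vnorm L 1 (u s - u t)) (𝓝[I] t) (𝓝 0)

variable {L}

lemma IsSolutionOn.isPath {ν α : ℝ} {G : ℝ → VField} {a b : ℝ} {u : ℝ → VField}
    (hu : IsSolutionOn L ν α G a b u) : IsPath L (Set.Icc a b) u := ⟨hu.mem_V, hu.continuous_V⟩

lemma IsPath.mono {I J : Set ℝ} {u : ℝ → VField} (hu : IsPath L I u) (h : J ⊆ I) :
    IsPath L J u :=
  ⟨fun t ht => hu.mem t (h ht), fun t ht => (hu.tendsto t (h ht)).mono_left (nhdsWithin_mono t h)⟩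

lemma IsPath.sub {I : Set ℝ} {u v : ℝ → VField} (hu : IsPath L I u) (hv : IsPath L I v) :
    IsPath L I (fun t => u t - v t) := by
  refine ⟨fun t ht => (hu.mem t ht).sub (hv.mem t ht), fun t ht => ?_⟩
  have h := (hu.tendsto t ht).add (hv.tendsto t ht)
  rw [add_zero] at h
  refine squeeze_zero' (Eventually.of_forall fun _ => vnorm_nonneg _ _ _) ?_ h
  filter_upwards [self_mem_nhdsWithin] with s hs
  rw [sub_sub_sub_comm]
  exact vnorm_sub_le L (((hu.mem s hs).sub (hu.mem t ht)).summable_amp L)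
    (((hv.mem s hs).sub (hv.mem t ht)).summable_amp L)

lemma IsPath.tendsto_zero {I : Set ℝ} {u : ℝ → VField} (hu : IsPath L I u) {t : ℝ} (ht : t ∈ I) :
    Tendsto (fun s => vnorm L 0 (u s - u t)) (𝓝[I] t) (𝓝 0) := by
  have hLp := hL.out
  have h := (hu.tendsto t ht).const_mul (L / (2 * Real.pi))
  rw [mul_zero] at h
  refine squeeze_zero' (Eventually.of_forall fun _ => vnorm_nonneg _ _ _) ?_ h
  filter_upwards [self_mem_nhdsWithin] with s hs
  have h2 := ((hu.mem s hs).sub (hu.mem t ht)).isH1.vnorm_zero_le L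
  calc vnorm L 0 (u s - u t) = L / (2 * Real.pi) * (2 * Real.pi / L * vnorm L 0 (u s - u t)) := by
        have := Real.pi_pos; field_simp
    _ ≤ _ := by gcongr

lemma IsPath.continuousOn_vnorm_zero {I : Set ℝ} {u : ℝ → VField} (hu : IsPath L I u) :
    ContinuousOn (fun s => vnorm L 0 (u s)) I := by
  intro t ht
  refine tendsto_iff_dist_tendsto_zero.2 (squeeze_zero' (Eventually.of_forall fun _ => dist_nonneg)
    ?_ (hu.tendsto_zero ht))
  filter_upwards [self_mem_nhdsWithin] with s hs
  exact abs_vnorm_sub_le L ((hu.mem s hs).isH1.summable_amp_zero L)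
    ((hu.mem t ht).isH1.summable_amp_zero L)

lemma IsPath.continuousOn_vnorm_one {I : Set ℝ} {u : ℝ → VField} (hu : IsPath L I u) :
    ContinuousOn (fun s => vnorm L 1 (u s)) I := by
  intro t ht
  refine tendsto_iff_dist_tendsto_zero.2 (squeeze_zero' (Eventually.of_forall fun _ => dist_nonneg)
    ?_ (hu.tendsto t ht))
  filter_upwards [self_mem_nhdsWithin] with s hs
  exact abs_vnorm_sub_le L ((hu.mem s hs).summable_amp L) ((hu.mem t ht).summable_amp L)

lemma IsPath.continuousOn_mode {I : Set ℝ} {u : ℝ → VField} (hu : IsPath L I u)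
    (K : Fin 3 → ℤ) : ContinuousOn (fun s => u s K) I := by
  intro t ht
  have h := (hu.tendsto_zero ht).const_mul (modeNorm L)⁻¹
  rw [mul_zero] at h
  refine tendsto_iff_dist_tendsto_zero.2 (squeeze_zero' (Eventually.of_forall fun _ => dist_nonneg)
    ?_ h)
  filter_upwards [self_mem_nhdsWithin] with s hs
  rw [dist_eq_norm]
  exact norm_le_vnorm_zero L (((hu.mem s hs).sub (hu.mem t ht)).isH1.summable_amp_zero L) K

lemma IsPath.continuousOn_quad {I : Set ℝ} {u : ℝ → VField} (hu : IsPath L I u) (i j : Fin 3)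
    (K : Fin 3 → ℤ) : ContinuousOn (fun s => quad L (u s) i j K) I := by
  intro t ht
  have h0 := hu.tendsto_zero ht
  have h1 : Tendsto (fun s => vnorm L 0 (u s)) (𝓝[I] t) (𝓝 (vnorm L 0 (u t))) :=
    hu.continuousOn_vnorm_zero t ht
  have h := (h1.mul h0).add (h0.mul_const (vnorm L 0 (u t)))
  rw [mul_zero, zero_mul, add_zero] at h
  refine tendsto_iff_dist_tendsto_zero.2 (squeeze_zero' (Eventually.of_forall fun _ => dist_nonneg)
    ?_ h)
  filter_upwards [self_mem_nhdsWithin] with s hs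
  rw [dist_eq_norm]
  exact norm_quad_sub_le L (hu.mem s hs).isH1 (hu.mem t ht).isH1 i j K

lemma IsPath.continuousOn_bilin {I : Set ℝ} {u : ℝ → VField} (hu : IsPath L I u)
    (K : Fin 3 → ℤ) : ContinuousOn (fun s => bilin L (u s) (u s) K) I := by
  unfold bilin
  refine ContinuousOn.leray ?_
  have h : ContinuousOn (fun s => WithLp.toLp 2 fun j =>
      ((L : ℂ) ^ 3)⁻¹ * ∑ i, 2 * Real.pi * Complex.I * (K i : ℂ) / L * quad L (u s) i j K) I := by
    refine (PiLp.continuous_toLp 2 _).comp_continuousOn (continuousOn_pi.2 fun j => ?_)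
    exact continuousOn_const.mul (continuousOn_finsetSum _ fun i _ =>
      continuousOn_const.mul (hu.continuousOn_quad i j K))
  refine h.congr fun s hs => ?_
  ext j
  exact coeff_advect L (hu.mem s hs).isH1 (hu.mem s hs).div_free K j

/-- Supplies the constants in the majorants Φ required by `energy_le`. -/
lemma IsPath.exists_bound {a b : ℝ} {u : ℝ → VField} (hu : IsPath L (Set.Icc a b) u) :
    ∃ C, 0 ≤ C ∧ ∀ s ∈ Set.Icc a b,
      vnorm L 0 (u s) ≤ C ∧ vnorm L 1 (u s) ≤ C ∧ √(fourth L (u s)) ≤ C := by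
  obtain ⟨C0, hC0⟩ := isCompact_Icc.exists_bound_of_continuousOn hu.continuousOn_vnorm_zero
  obtain ⟨C1, hC1⟩ := isCompact_Icc.exists_bound_of_continuousOn hu.continuousOn_vnorm_one
  obtain ⟨C2, hC2⟩ := isCompact_Icc.exists_bound_of_continuousOn
    ((hu.continuousOn_vnorm_one.pow 4).const_mul (L / (2 * Real.pi))).sqrt
  refine ⟨max 0 (max C0 (max C1 C2)), le_max_left _ _, fun s hs => ⟨?_, ?_, ?_⟩⟩
  · exact (le_abs_self _).trans ((hC0 s hs).trans (by simp))
  · exact (le_abs_self _).trans ((hC1 s hs).trans (by simp))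
  · exact (Real.sqrt_le_sqrt ((hu.mem s hs).isH1.fourth_le L)).trans
      ((le_abs_self _).trans ((hC2 s hs).trans (by simp)))

end Paths

/-! ### The equations of the modes, and the forcing. -/

section Modes

variable (L : ℝ) [hL : Fact (0 < L)]

lemma stokes_apply (u : VField) (K : Fin 3 → ℤ) : stokes L u K = wave L K ^ 2 • u K := by
  rw [stokes, wave]; congr 1; ring

lemma helm_apply (α : ℝ) (u : VField) (K : Fin 3 → ℤ) :
    helm L α u K = (1 + α ^ 2 * wave L K ^ 2) • u K := by
  rw [helm, Pi.add_apply, Pi.smul_apply, stokes_apply, smul_smul, add_smul, one_smul]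

lemma one_add_mul_wave_pos (α : ℝ) (K : Fin 3 → ℤ) : 0 < 1 + α ^ 2 * wave L K ^ 2 := by
  positivity

/-- The right-hand side of the equation for a Fourier mode, solved for the time derivative. -/
noncomputable def modeRhs (ν α : ℝ) (G : VField) (u : VField) (K : Fin 3 → ℤ) :
    EuclideanSpace ℂ (Fin 3) :=
  (1 + α ^ 2 * wave L K ^ 2)⁻¹ • (G K - bilin L u u K) - (ν * wave L K ^ 2) • u K

variable {L}

lemma IsSolutionOn.intervalIntegrable_modeRhs {ν α : ℝ} {G : ℝ → VField} {a b : ℝ}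
    {u : ℝ → VField} (hu : IsSolutionOn L ν α G a b u) {K : Fin 3 → ℤ}
    (hG : IntervalIntegrable (fun s => G s K) volume a b) {s t : ℝ} (has : a ≤ s) (hst : s ≤ t)
    (htb : t ≤ b) : IntervalIntegrable (fun r => modeRhs L ν α (G r) (u r) K) volume s t := by
  have hsub : Set.uIcc s t ⊆ Set.Icc a b := by
    rw [Set.uIcc_of_le hst]; exact Set.Icc_subset_Icc has htb
  have h1 : IntervalIntegrable (fun r => G r K) volume s t :=
    hG.mono_set (by rwa [Set.uIcc_of_le (has.trans (hst.trans htb))])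
  have h2 := ((hu.isPath.continuousOn_bilin K).mono hsub).intervalIntegrable (μ := volume)
  have h3 := ((hu.isPath.continuousOn_mode K).mono hsub).intervalIntegrable (μ := volume)
  have h4 := (h1.sub h2).smul (1 + α ^ 2 * wave L K ^ 2)⁻¹
  have h5 := h3.smul (ν * wave L K ^ 2)
  exact h4.sub h5

/-- Dividing each mode by 1 + α²k² puts the equations for u and w, which have different filters α
and β, into a form in which they can be subtracted. -/
lemma IsSolutionOn.mode_sub_eq {ν α : ℝ} {G : ℝ → VField} {a b : ℝ}
    {u : ℝ → VField} (hu : IsSolutionOn L ν α G a b u) {K : Fin 3 → ℤ}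
    (hG : IntervalIntegrable (fun s => G s K) volume a b) {s t : ℝ} (has : a ≤ s) (hst : s ≤ t)
    (htb : t ≤ b) : u t K - u s K = ∫ r in s..t, modeRhs L ν α (G r) (u r) K := by
  have hp := one_add_mul_wave_pos L α K
  have key : ∀ t ∈ Set.Icc a b, u t K - u a K = ∫ r in a..t, modeRhs L ν α (G r) (u r) K := by
    intro t ht
    have h := congrArg (fun x => (1 + α ^ 2 * wave L K ^ 2)⁻¹ • x) (hu.equation t ht K)
    simp only [helm_apply, stokes_apply] at h
    rw [← smul_sub, inv_smul_smul₀ hp.ne', ← intervalIntegral.integral_smul] at h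
    rw [h]
    congr 1; ext1 r
    rw [modeRhs, sub_right_comm, smul_sub (_)⁻¹ (G r K - bilin L (u r) (u r) K)]
    congr 1
    rw [smul_comm (wave L K ^ 2), smul_comm ν, inv_smul_smul₀ hp.ne', smul_smul]
  rw [← intervalIntegral.integral_interval_sub_left
    (hu.intervalIntegrable_modeRhs hG le_rfl (has.trans hst) htb)
    (hu.intervalIntegrable_modeRhs hG le_rfl has (hst.trans htb)),
    ← key t ⟨has.trans hst, htb⟩, ← key s ⟨has, hst.trans htb⟩]
  abel

lemma IsForcing.intervalIntegrable {f : ℝ → VField} (hf : IsForcing L f) (K : Fin 3 → ℤ)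
    {a b : ℝ} (ha : 0 ≤ a) (hab : a ≤ b) :
    IntervalIntegrable (fun s => f s K) volume a b := by
  obtain ⟨C, hC⟩ := hf.bounded
  rw [intervalIntegrable_iff_integrableOn_Icc_of_le hab]
  have hsub : Set.Icc a b ⊆ Set.Ici 0 := fun s hs => ha.trans hs.1
  refine Integrable.of_bound ((hf.measurable K).mono_set hsub) ((modeNorm L)⁻¹ * C) ?_
  refine ae_restrict_of_ae_restrict_of_subset hsub ?_
  filter_upwards [hC, hf.mem_H] with s hs hs'
  refine (norm_le_vnorm_zero L (hs'.summable_amp L) K).trans ?_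
  have := modeNorm_pos L
  gcongr

lemma IsForcing.ae_le_supNorm {f : ℝ → VField} (hf : IsForcing L f) :
    ∀ᵐ t ∂volume.restrict (Set.Ici (0 : ℝ)), vnorm L 0 (f t) ≤ supNorm L f := by
  obtain ⟨C, hC⟩ := hf.bounded
  exact ae_le_essSup ⟨C, eventually_map.2 hC⟩

lemma IsForcing.supNorm_nonneg {f : ℝ → VField} (hf : IsForcing L f) : 0 ≤ supNorm L f := by
  have : (ae (volume.restrict (Set.Ici (0 : ℝ)))).NeBot := by
    rw [ae_neBot, Ne, Measure.restrict_eq_zero]; simp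
  obtain ⟨t, ht⟩ := hf.ae_le_supNorm.exists
  exact (vnorm_nonneg _ _ _).trans ht

end Modes

/-! ### The energy estimate for the Bardina system. -/

section BardinaEnergy

variable {L : ℝ} [hL : Fact (0 < L)]

lemma InV.hasSum_energy {u : VField} (hu : InV 1 u) (α : ℝ) :
    HasSum (fun K => L ^ 3 * (1 + α ^ 2 * wave L K ^ 2) * ‖u K‖ ^ 2)
      (vnorm L 0 u ^ 2 + α ^ 2 * vnorm L 1 u ^ 2) := by
  have h := (hasSum_amp L (hu.isH1.summable_amp_zero L)).add
    ((hasSum_amp L (hu.summable_amp L)).mul_left (α ^ 2))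
  refine h.congr_fun fun K => ?_
  rw [amp_sq, amp_sq]; ring

end BardinaEnergy

section BardinaBound

variable {L : ℝ} [hL : Fact (0 < L)]

lemma InV.tri_self {u : VField} (hu : InV 1 u) : tri L u u u = 0 :=
  Bardina.tri_self L hu.isH1 hu.div_free hu.isH1

lemma energy_density_bardina (ν α : ℝ) (f u : VField) (K : Fin 3 → ℤ) :
    L ^ 3 * (1 + α ^ 2 * wave L K ^ 2) * (2 * (inner ℂ (u K) (modeRhs L ν α f u K)).re) =
      2 * (L ^ 3 * (inner ℂ (u K) (f K)).re) - 2 * (L ^ 3 * (inner ℂ (u K) (bilin L u u K)).re)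
        - 2 * ν * (amp L 1 u K ^ 2 + α ^ 2 * amp L 2 u K ^ 2) := by
  have hp := (one_add_mul_wave_pos L α K).ne'
  rw [modeRhs, inner_sub_right, Complex.sub_re, re_inner_real_smul, re_inner_real_smul,
    inner_sub_right, Complex.sub_re, re_inner_self, amp_sq, amp_sq]
  field_simp
  ring

/-- The energy estimate for the viscous simplified Bardina system. -/
lemma IsSolutionOn.energy_bardina_le {ν α T : ℝ} (hν : 0 < ν) {f u : ℝ → VField}
    (hf : IsForcing L f) (hT : 0 ≤ T) (hu : IsSolutionOn L ν α f 0 T u) :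
    vnorm L 0 (u T) ^ 2 + α ^ 2 * vnorm L 1 (u T) ^ 2 ≤
      Real.exp (-ν * lam L * T) * (vnorm L 0 (u 0) ^ 2 + α ^ 2 * vnorm L 1 (u 0) ^ 2) +
        1 / (lam L ^ 2 * ν ^ 2) * supNorm L f ^ 2 := by
  have hl := lam_pos L
  have hF := hf.supNorm_nonneg
  set F := supNorm L f with hFdef
  obtain ⟨C, hC0, hC⟩ := hu.isPath.exists_bound
  have hsub : Set.Icc 0 T ⊆ Set.Ici (0 : ℝ) := fun s hs => hs.1
  have main := energy_le (k := ν * lam L) (R := F ^ 2 / (ν * lam L)) (by positivity) (by positivity)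
    (m := fun K => L ^ 3 * (1 + α ^ 2 * wave L K ^ 2)) (y := fun K s => u s K)
    (h := fun K s => modeRhs L ν α (f s) (u s) K)
    (fun K => hu.intervalIntegrable_modeRhs (hf.intervalIntegrable K le_rfl hT) le_rfl hT le_rfl)
    (fun K t ht => hu.mode_sub_eq (hf.intervalIntegrable K le_rfl hT) le_rfl ht.1 ht.2)
    (E := fun t => vnorm L 0 (u t) ^ 2 + α ^ 2 * vnorm L 1 (u t) ^ 2)
    (fun t ht => (hu.mem_V t ht).hasSum_energy α)
    ((hu.isPath.continuousOn_vnorm_zero.pow 2).add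
      (continuousOn_const.mul (hu.isPath.continuousOn_vnorm_one.pow 2)))
    (Φ := fun s => 2 * (F * C) + 2 * (C * C) + 2 * ν * (C ^ 2 + α ^ 2 * vnorm L 2 (u s) ^ 2))
    ?_ ?_ T ⟨hT, le_rfl⟩
  · refine main.trans (le_of_eq ?_)
    simp only [sub_zero]
    congr 2
    · congr 1; ring
    · field_simp
  · have h1 : ∀ c : ℝ, IntegrableOn (fun _ : ℝ => c) (Set.Icc 0 T) := fun c =>
      integrableOn_const (by simp) (by simp)
    exact (h1 _).add (((h1 _).add (hu.sq_integrable_DA.const_mul _)).const_mul _)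
  · filter_upwards [hu.mem_DA, ae_restrict_of_ae_restrict_of_subset hsub hf.mem_H,
      ae_restrict_of_ae_restrict_of_subset hsub hf.ae_le_supNorm,
      ae_restrict_mem measurableSet_Icc] with s h2 hfH hfF hs
    have hV := hu.mem_V s hs
    obtain ⟨hC1, hC2, hC3⟩ := hC s hs
    have a0 := hV.isH1.summable_amp_zero L
    have a1 := hV.summable_amp L
    have a2 := h2.summable_amp L
    have p1 : ∀ S, _ := sum_inner_le L (hfH.summable_amp L) a0
    obtain ⟨s1, t1⟩ := abs_tsum_le_of_sum_abs_le p1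
    have p2 : ∀ S, _ := sum_inner_bilin_le L hV a1
    have s2 := hasSum_inner_bilin L hV.isH1 hV.div_free hV
    rw [hV.tri_self, Complex.zero_re, neg_zero] at s2
    have s3 := (hasSum_amp L a1).add ((hasSum_amp L a2).mul_left (α ^ 2))
    have n0 := vnorm_nonneg L 0 (u s)
    have n1 := vnorm_nonneg L 1 (u s)
    have n2 := vnorm_nonneg L 2 (u s)
    simp only [energy_density_bardina]
    refine ⟨_, ((s1.hasSum.mul_left 2).sub (s2.mul_left 2)).sub (s3.mul_left (2 * ν)), ?_, ?_⟩
    · have l1 := lam_mul_vnorm_sq_le L hV.mean_zero a0 a1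
      have l2 := lam_mul_vnorm_sq_le L hV.mean_zero a1 a2
      -- Young's inequality. Since 2ν‖∇u‖² ≥ 2νλ₁‖u‖², half of that dissipation pays for the forcing
      -- and the other half gives the decay rate νλ₁.
      have e1 : 2 * (F * vnorm L 0 (u s)) ≤ ν * lam L * vnorm L 0 (u s) ^ 2 +
          F ^ 2 / (ν * lam L) := by
        have hk : 0 < ν * lam L := by positivity
        have : 0 ≤ (ν * lam L * vnorm L 0 (u s) - F) ^ 2 / (ν * lam L) := by positivity
        have e : (ν * lam L * vnorm L 0 (u s) - F) ^ 2 / (ν * lam L) =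
            ν * lam L * vnorm L 0 (u s) ^ 2 - 2 * (F * vnorm L 0 (u s)) + F ^ 2 / (ν * lam L) := by
          field_simp; ring
        linarith
      have e2 := (le_abs_self _).trans (t1.trans (mul_le_mul_of_nonneg_right hfF n0))
      have e3 : ν * (lam L * vnorm L 0 (u s) ^ 2) ≤ ν * vnorm L 1 (u s) ^ 2 := by gcongr
      have e4 : ν * (α ^ 2 * (lam L * vnorm L 1 (u s) ^ 2)) ≤ ν * (α ^ 2 * vnorm L 2 (u s) ^ 2) := by
        gcongr
      have e5 : 0 ≤ ν * (α ^ 2 * vnorm L 2 (u s) ^ 2) := by positivity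
      simp only [mul_zero, sub_zero]
      linarith
    · intro S
      have q1 := (p1 S).trans (mul_le_mul hfF hC1 n0 hF)
      have q2 := (p2 S).trans (mul_le_mul hC3 hC2 n1 hC0)
      have q3 : ∑ K ∈ S, (amp L 1 (u s) K ^ 2 + α ^ 2 * amp L 2 (u s) K ^ 2) ≤
          C ^ 2 + α ^ 2 * vnorm L 2 (u s) ^ 2 :=
        (sum_le_hasSum S (fun _ _ => by positivity) s3).trans (by gcongr)
      have q0 : 0 ≤ ∑ K ∈ S, (amp L 1 (u s) K ^ 2 + α ^ 2 * amp L 2 (u s) K ^ 2) :=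
        Finset.sum_nonneg fun _ _ => by positivity
      have r1 := (Finset.abs_sum_le_sum_abs _ S).trans q1
      have r2 := (Finset.abs_sum_le_sum_abs _ S).trans q2
      rw [Finset.sum_sub_distrib, Finset.sum_sub_distrib, ← Finset.mul_sum S _ (2 : ℝ),
        ← Finset.mul_sum S _ (2 : ℝ), ← Finset.mul_sum S _ (2 * ν)]
      rw [abs_le] at r1 r2 ⊢
      have q4 := mul_le_mul_of_nonneg_left q3 (by positivity : 0 ≤ 2 * ν)
      have q5 := mul_nonneg (by positivity : 0 ≤ 2 * ν) q0
      constructor <;> linarith [r1.1, r1.2, r2.1, r2.2]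

/-- The bound `‖u‖² + α² ‖∇u‖² ≤ M_1²`, propagated forward in time. -/
lemma IsBardinaSolution.energy_le {ν α α₁ MA MB tn t : ℝ} (hν : 0 < ν) (hα : 0 < α) (hαα₁ : α ≤ α₁)
    {f u : ℝ → VField} (hf : IsForcing L f) (hu : IsBardinaSolution L ν α f u)
    (huA : vnorm L 0 (u 0) ≤ MA) (huB : vnorm L 1 (u 0) ≤ MB) (htn : 0 ≤ tn) (ht : tn ≤ t) :
    vnorm L 0 (u t) ^ 2 + α ^ 2 * vnorm L 1 (u t) ^ 2 ≤ M1sq L ν α₁ MA MB (supNorm L f) tn := by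
  have hl := lam_pos L
  have ht0 : 0 ≤ t := htn.trans ht
  -- Solutions are given on [0, T] with T > 0 only, while t may be 0; hence the restriction from [0,
  -- t + 1].
  have hsol : IsSolutionOn L ν α f 0 t u := by
    have h := hu (t + 1) (by linarith)
    have hsub : Set.Icc 0 t ⊆ Set.Icc 0 (t + 1) := Set.Icc_subset_Icc_right (by linarith)
    exact ⟨fun s hs => h.mem_V s (hsub hs), fun s hs => (h.isPath.mono hsub).tendsto s hs,
      ae_restrict_of_ae_restrict_of_subset hsub h.mem_DA, h.sq_integrable_DA.mono_set hsub,
      fun s hs => h.equation s (hsub hs)⟩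
  refine (hsol.energy_bardina_le hν hf ht0).trans ?_
  have n0 := vnorm_nonneg L 0 (u 0)
  have n1 := vnorm_nonneg L 1 (u 0)
  rw [M1sq]
  have hexp : Real.exp (-ν * lam L * t) ≤ Real.exp (-ν * lam L * tn) := by
    refine Real.exp_le_exp.2 ?_
    have : ν * lam L * tn ≤ ν * lam L * t := by gcongr
    linarith
  gcongr

end BardinaBound

/-! ### The nudging term and the energy density of the difference. -/

section Nudging

open Classical in
/-- The indicator of the low wave numbers `0 < |K| < N`. -/
noncomputable def lowIndicator (N : ℕ) (K : Fin 3 → ℤ) : ℝ :=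
  if 0 < kabs K ∧ kabs K < N then 1 else 0

lemma lowIndicator_nonneg (N : ℕ) (K : Fin 3 → ℤ) : 0 ≤ lowIndicator N K := by
  unfold lowIndicator; split_ifs <;> norm_num

lemma lowIndicator_le_one (N : ℕ) (K : Fin 3 → ℤ) : lowIndicator N K ≤ 1 := by
  unfold lowIndicator; split_ifs <;> norm_num

lemma lowModes_sub_apply (N : ℕ) (w u : VField) (K : Fin 3 → ℤ) :
    (lowModes N w - lowModes N u) K = lowIndicator N K • (w - u) K := by
  rw [Pi.sub_apply, lowModes, lowModes, lowIndicator]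
  split_ifs <;> simp

lemma leray_lowModes_sub {w u : VField} (hw : InV 1 w) (hu : InV 1 u) (N : ℕ) (K : Fin 3 → ℤ) :
    leray (lowModes N w - lowModes N u) K = lowIndicator N K • (w - u) K := by
  have hg := hw.sub hu
  rw [leray_eq_self, lowModes_sub_apply]
  · rw [lowModes_sub_apply, hg.mean_zero, smul_zero]
  · rw [lowModes_sub_apply]
    have h : ∀ j, (lowIndicator N K • (w - u) K) j * (K j : ℂ) =
        lowIndicator N K • ((w - u) K j * (K j : ℂ)) := fun j => by
      rw [PiLp.smul_apply, smul_mul_assoc]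
    rw [Finset.sum_congr rfl fun j _ => h j, ← Finset.smul_sum, hg.div_free K, smul_zero]

variable {L : ℝ} [hL : Fact (0 < L)]

lemma nudge_apply {w u : VField} (hw : InV 1 w) (hu : InV 1 u) (f : VField) (β η : ℝ) (N : ℕ)
    (K : Fin 3 → ℤ) :
    (f - η • helm L β (leray (lowModes N w - lowModes N u))) K =
      f K - (η * (1 + β ^ 2 * wave L K ^ 2) * lowIndicator N K) • (w - u) K := by
  rw [Pi.sub_apply, Pi.smul_apply, helm_apply, leray_lowModes_sub hw hu, smul_smul, smul_smul]

/-- The weight 1 + β²k² cancels the filter of the equation for w. On the equation for u it leaves (1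
+ β²k²)/(1 + α²k²) = 1 + (β² - α²)k²/(1 + α²k²): the 1 makes f cancel, and the rest is the residual
due to β ≠ α. -/
lemma energy_density_nudged {w u : VField} (hw : InV 1 w) (hu : InV 1 u) (f : VField)
    (ν α β η : ℝ) (N : ℕ) (K : Fin 3 → ℤ) :
    L ^ 3 * (1 + β ^ 2 * wave L K ^ 2) * (2 * (inner ℂ ((w - u) K)
        (modeRhs L ν β (f - η • helm L β (leray (lowModes N w - lowModes N u))) w K
          - modeRhs L ν α f u K)).re) =
      2 * (L ^ 3 * (inner ℂ ((w - u) K) (bilin L u u K)).re)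
        - 2 * (L ^ 3 * (inner ℂ ((w - u) K) (bilin L w w K)).re)
        - 2 * (β ^ 2 - α ^ 2) * (L ^ 3 * (wave L K ^ 2 / (1 + α ^ 2 * wave L K ^ 2) *
            (inner ℂ ((w - u) K) (f K - bilin L u u K)).re))
        - 2 * (ν * (amp L 1 (w - u) K ^ 2 + β ^ 2 * amp L 2 (w - u) K ^ 2)
          + η * (lowIndicator N K *
            (amp L 0 (w - u) K ^ 2 + β ^ 2 * amp L 1 (w - u) K ^ 2))) := by
  have hp := (one_add_mul_wave_pos L α K).ne'
  have hq := (one_add_mul_wave_pos L β K).ne'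
  have e : modeRhs L ν β (f - η • helm L β (leray (lowModes N w - lowModes N u))) w K
      - modeRhs L ν α f u K =
      (1 + β ^ 2 * wave L K ^ 2)⁻¹ • (f K - bilin L w w K) - (η * lowIndicator N K) • (w - u) K
        - (ν * wave L K ^ 2) • (w - u) K
        - (1 + α ^ 2 * wave L K ^ 2)⁻¹ • (f K - bilin L u u K) := by
    rw [modeRhs, modeRhs, nudge_apply hw hu, sub_right_comm (f K), smul_sub _ (f K - _) (_ • _),
      smul_smul, Pi.sub_apply, smul_sub (ν * _) (w K)]
    have : (1 + β ^ 2 * wave L K ^ 2)⁻¹ * (η * (1 + β ^ 2 * wave L K ^ 2) * lowIndicator N K) =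
        η * lowIndicator N K := by field_simp
    rw [this]
    abel
  rw [e]
  simp only [inner_sub_right, Complex.sub_re, re_inner_real_smul, re_inner_self, amp_sq]
  field_simp
  ring

/-- Modes with |K| ≥ N are not nudged, but there η ≤ νλ₁N²/2 ≤ νk²/2. Half of the viscous
dissipation thus acts as damping with the full rate η. -/
lemma lowIndicator_dissipation {g : VField} (h0 : g 0 = 0) {ν β η : ℝ} (hν : 0 < ν)
    {N : ℕ} (hN : 1 ≤ N) (h_N : η / (N : ℝ) ^ 2 ≤ ν * lam L / 2) (K : Fin 3 → ℤ) :
    η * (amp L 0 g K ^ 2 + β ^ 2 * amp L 1 g K ^ 2)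
        - ν / 2 * (amp L 1 g K ^ 2 + β ^ 2 * amp L 2 g K ^ 2) ≤
      η * (lowIndicator N K * (amp L 0 g K ^ 2 + β ^ 2 * amp L 1 g K ^ 2)) := by
  have hx : 0 ≤ amp L 0 g K ^ 2 + β ^ 2 * amp L 1 g K ^ 2 := by positivity
  have e : amp L 1 g K ^ 2 + β ^ 2 * amp L 2 g K ^ 2 =
      wave L K ^ 2 * (amp L 0 g K ^ 2 + β ^ 2 * amp L 1 g K ^ 2) := by
    simp only [amp_sq]; ring
  rw [e]
  by_cases hK : K = 0
  · subst hK
    simp [amp, h0]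
  have hk : 0 < kabs K := one_pos.trans_le (one_le_kabs hK)
  by_cases hl : kabs K < N
  · rw [lowIndicator, if_pos ⟨hk, hl⟩, one_mul]
    have : 0 ≤ ν / 2 * (wave L K ^ 2 * (amp L 0 g K ^ 2 + β ^ 2 * amp L 1 g K ^ 2)) := by
      positivity
    linarith
  · rw [lowIndicator, if_neg fun h => hl h.2, zero_mul, mul_zero]
    have hN0 : (0 : ℝ) < N := by exact_mod_cast hN
    have h1 : η ≤ ν / 2 * wave L K ^ 2 := by
      rw [div_le_iff₀ (by positivity)] at h_N
      refine h_N.trans ?_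
      have e2 : wave L K ^ 2 = lam L * kabs K ^ 2 := by rw [wave, lam]; ring
      have h3 : (N : ℝ) ^ 2 ≤ kabs K ^ 2 := by gcongr; exact not_lt.1 hl
      have hlam := lam_pos L
      rw [e2]
      calc ν * lam L / 2 * N ^ 2 ≤ ν * lam L / 2 * kabs K ^ 2 := by gcongr
        _ = _ := by ring
    nlinarith

end Nudging

/-! ### Bounds on the nonlinear term and the residual by the energy of u. -/

section Trilinear

variable {L : ℝ} [hL : Fact (0 < L)]

/-- The difference of the nonlinear terms, tested against the difference of the fields. -/
lemma tri_sub_tri_eq {w u : VField} (hw : InV 1 w) (hu : InV 1 u) :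
    tri L w w (w - u) - tri L u u (w - u) = -tri L (w - u) (w - u) u := by
  have w1 := hw.isH1
  have u1 := hu.isH1
  have g1 := w1.sub u1
  have h1 := tri_self L u1 hu.div_free g1
  have h2 := tri_self L w1 hw.div_free u1
  rw [tri_sub_mid L u1 w1 u1, tri_sub_right L u1 w1 w1 u1, tri_sub_right L u1 u1 w1 u1,
    tri_self L u1 hu.div_free w1, hu.tri_self] at h1
  rw [tri_sub_left L w1 u1 g1, tri_sub_mid L w1 w1 u1, tri_sub_mid L u1 w1 u1,
    tri_sub_right L w1 w1 w1 u1, tri_sub_right L u1 u1 w1 u1, h2, hw.tri_self, hu.tri_self]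
  linear_combination h1

/-- The inequality of arithmetic and geometric means for a, a, a, b. -/
lemma le_of_pow_four_le {r a b : ℝ} (ha : 0 ≤ a) (hb : 0 ≤ b)
    (h : r ^ 4 ≤ 256 * a ^ 3 * b) : r ≤ 3 * a + b := by
  have e : (3 * a + b) ^ 4 - 256 * a ^ 3 * b = (a - b) ^ 2 * (81 * a ^ 2 + 14 * a * b + b ^ 2) := by
    ring
  have e' : 0 ≤ (a - b) ^ 2 * (81 * a ^ 2 + 14 * a * b + b ^ 2) := by positivity
  exact le_of_pow_le_pow_left₀ (n := 4) (by norm_num) (by positivity) (by linarith)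

/-- Of the two factors ∫|g|⁴, one is bounded with the constant 1 and the other with c⁴, so the
product carries the c⁴ of `hQη` and not c⁸. -/
lemma norm_tri_le_dissipation {c ν α α₀ η Q : ℝ} (hc : IsGNConst L c) (hν : 0 < ν) (hα₀ : 0 < α₀)
    (hα : α₀ ≤ α) (hη : 0 < η) (hQη : 27 * c ^ 4 * Q ^ 2 / (8 * ν ^ 3 * α₀ ^ 4) ≤ η)
    {g u : VField} (hg : InV 1 g) (hu : InV 1 u)
    (hQ : vnorm L 0 u ^ 2 + α ^ 2 * vnorm L 1 u ^ 2 ≤ Q) :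
    ‖tri L g g u‖ ≤ ν / 2 * vnorm L 1 g ^ 2 + 3 * η / 4 * vnorm L 0 g ^ 2 := by
  have n0 := vnorm_nonneg L 0 g
  have n1 := vnorm_nonneg L 1 g
  have nf := fourth_nonneg L g
  have f1 : fourth L g ≤ vnorm L 0 g * vnorm L 1 g ^ 3 := (hg.isH1.ladyzhenskaya L).2
  have f2 : fourth L g ≤ c ^ 4 * vnorm L 0 g * vnorm L 1 g ^ 3 := hc.integral_pow_four_le L hg
  have hu1 : α₀ ^ 2 * vnorm L 1 u ^ 2 ≤ Q := by
    have : α₀ ^ 2 * vnorm L 1 u ^ 2 ≤ α ^ 2 * vnorm L 1 u ^ 2 := by gcongr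
    nlinarith [sq_nonneg (vnorm L 0 u)]
  have hu2 : vnorm L 1 u ^ 4 ≤ Q ^ 2 / α₀ ^ 4 := by
    rw [le_div_iff₀ (by positivity)]
    calc _ = (α₀ ^ 2 * vnorm L 1 u ^ 2) ^ 2 := by ring
      _ ≤ Q ^ 2 := by gcongr
  have hc4 : c ^ 4 * (Q ^ 2 / α₀ ^ 4) ≤ 8 / 27 * ν ^ 3 * η := by
    rw [div_le_iff₀ (by positivity)] at hQη
    rw [← mul_div_assoc, div_le_iff₀ (by positivity)]
    linarith
  -- With a = ν‖∇g‖²/6 and b = 3η‖g‖²/4 one has 256a³b = (8/9)ν³η‖g‖²‖∇g‖⁶, three times what the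
  -- hypothesis on η provides.
  have h : ‖tri L g g u‖ ≤ 3 * (ν * vnorm L 1 g ^ 2 / 6) + 3 * η * vnorm L 0 g ^ 2 / 4 := by
    refine le_of_pow_four_le (by positivity) (by positivity) ?_
    calc _ ≤ fourth L g * fourth L g * vnorm L 1 u ^ 4 :=
          norm_tri_pow_four_le L hg.isH1 hg.isH1 hu.isH1
      _ ≤ (vnorm L 0 g * vnorm L 1 g ^ 3) * (c ^ 4 * vnorm L 0 g * vnorm L 1 g ^ 3) *
          (Q ^ 2 / α₀ ^ 4) := by gcongr
      _ = (c ^ 4 * (Q ^ 2 / α₀ ^ 4)) * (vnorm L 0 g ^ 2 * vnorm L 1 g ^ 6) := by ring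
      _ ≤ (8 / 9 * ν ^ 3 * η) * (vnorm L 0 g ^ 2 * vnorm L 1 g ^ 6) := by
          refine mul_le_mul_of_nonneg_right (hc4.trans ?_) (by positivity)
          have : 0 ≤ ν ^ 3 * η := by positivity
          linarith
      _ = _ := by ring
  linarith

/-- By Poincaré, ‖u‖^(1/2)‖∇u‖^(3/2) ≤ λ₁^(-1/4)‖∇u‖²; with the √λ₁ of the smoothing this makes
λ₁^(3/4). The second α² comes from ‖∇u‖² ≤ Q/α². The bound is the middle term of `M3`. -/
lemma sqrt_fourth_div_le {c α α₀ Q : ℝ} (hc : IsGNConst L c) (hα₀ : 0 < α₀)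
    (hα : α₀ ≤ α) {u : VField} (hu : InV 1 u)
    (hQ : vnorm L 0 u ^ 2 + α ^ 2 * vnorm L 1 u ^ 2 ≤ Q) :
    √(fourth L u) / (α ^ 2 * √(lam L)) ≤ c ^ 2 / (α₀ ^ 4 * lam L ^ (3 / 4 : ℝ)) * Q := by
  have hl := lam_pos L
  set l := lam L ^ (1 / 4 : ℝ) with hldef
  have l0 : 0 < l := Real.rpow_pos_of_pos hl _
  have l4 : lam L = l ^ 4 := by
    rw [hldef, ← Real.rpow_natCast, ← Real.rpow_mul hl.le]; norm_num
  have l3 : lam L ^ (3 / 4 : ℝ) = l ^ 3 := by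
    rw [hldef, ← Real.rpow_natCast, ← Real.rpow_mul hl.le]; norm_num
  have l2 : √(lam L) = l ^ 2 := by
    rw [l4, show l ^ 4 = (l ^ 2) ^ 2 by ring, Real.sqrt_sq (by positivity)]
  have n0 := vnorm_nonneg L 0 u
  have n1 := vnorm_nonneg L 1 u
  have hv : l ^ 2 * vnorm L 0 u ≤ vnorm L 1 u := by
    refine le_of_sq_le_sq ?_ n1
    have := lam_mul_vnorm_sq_le L hu.mean_zero (hu.isH1.summable_amp_zero L) (hu.summable_amp L)
    rw [l4] at this
    linarith
  have f2 : fourth L u ≤ c ^ 4 * vnorm L 0 u * vnorm L 1 u ^ 3 := hc.integral_pow_four_le L hu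
  have hc0 := hc.pos
  have f3 : √(fourth L u) * l ≤ c ^ 2 * vnorm L 1 u ^ 2 := by
    refine le_of_sq_le_sq ?_ (by positivity)
    rw [mul_pow, Real.sq_sqrt (fourth_nonneg L u)]
    calc _ ≤ c ^ 4 * vnorm L 0 u * vnorm L 1 u ^ 3 * l ^ 2 := by gcongr
      _ = c ^ 4 * (l ^ 2 * vnorm L 0 u) * vnorm L 1 u ^ 3 := by ring
      _ ≤ c ^ 4 * vnorm L 1 u * vnorm L 1 u ^ 3 := by gcongr
      _ = _ := by ring
  have hα' : 0 < α := hα₀.trans_le hα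
  have hQ1 : vnorm L 1 u ^ 2 ≤ Q / α ^ 2 := by
    rw [le_div_iff₀ (by positivity)]
    nlinarith [sq_nonneg (vnorm L 0 u)]
  have hQ0 : 0 ≤ Q := le_trans (by positivity) hQ
  rw [l3, l2]
  calc _ = √(fourth L u) * l / (α ^ 2 * l ^ 3) := by field_simp
    _ ≤ c ^ 2 * (Q / α ^ 2) / (α ^ 2 * l ^ 3) := by
        refine div_le_div_of_nonneg_right (f3.trans ?_) (by positivity)
        gcongr
    _ = c ^ 2 / (α ^ 4 * l ^ 3) * Q := by field_simp
    _ ≤ _ := by gcongr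

end Trilinear

/-! ### The energy inequality for the difference. -/

section NudgedEnergy

variable {L : ℝ} [hL : Fact (0 < L)]

lemma IsNudgedSolution.intervalIntegrable_forcing {ν β η a b : ℝ} {N : ℕ} {f u w : ℝ → VField}
    (hf : IsForcing L f) (ha : 0 ≤ a) (hab : a ≤ b) (hu : IsPath L (Set.Icc a b) u)
    (hw : IsNudgedSolution L ν β η N f u a b w) (K : Fin 3 → ℤ) :
    IntervalIntegrable (fun s =>
      (f s - η • helm L β (leray (lowModes N (w s) - lowModes N (u s)))) K) volume a b := by
  have hwp := IsSolutionOn.isPath hw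
  have h1 := hf.intervalIntegrable K ha hab
  have h2 : IntervalIntegrable (fun s => (w s - u s) K) volume a b := by
    refine ContinuousOn.intervalIntegrable ?_
    rw [Set.uIcc_of_le hab]
    exact (hwp.sub hu).continuousOn_mode K
  have h3 := h1.sub (h2.smul (η * (1 + β ^ 2 * wave L K ^ 2) * lowIndicator N K))
  refine h3.congr fun s hs => ?_
  rw [Set.uIoc_of_le hab] at hs
  have hs' := Set.Ioc_subset_Icc_self hs
  exact (nudge_apply (hwp.mem s hs') (hu.mem s hs') (f s) β η N K).symm

/-- The energy density of the difference of the nudged and the true solution is summable, with the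
sum controlled by the dissipation. -/
lemma exists_hasSum_energy_density {c ν α α₀ β η Q M F : ℝ} (hc : IsGNConst L c) (hν : 0 < ν)
    (hα₀ : 0 < α₀) (hα : α₀ ≤ α) (hβ : 0 < β) (hη : 0 < η) {N : ℕ} (hN : 1 ≤ N)
    (h_N : η / (N : ℝ) ^ 2 ≤ ν * lam L / 2)
    (hQη : 27 * c ^ 4 * Q ^ 2 / (8 * ν ^ 3 * α₀ ^ 4) ≤ η)
    {f u w : VField} (hf : InV 0 f) (hF : vnorm L 0 f ≤ F) (hw : InV 1 w) (hu : InV 1 u)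
    (hg2 : InV 2 (w - u))
    (hQ : vnorm L 0 u ^ 2 + α ^ 2 * vnorm L 1 u ^ 2 ≤ Q)
    (hM : c ^ 2 / (α₀ ^ 4 * lam L ^ (3 / 4 : ℝ)) * Q + F ≤ M) :
    (∃ d, HasSum (fun K => L ^ 3 * (1 + β ^ 2 * wave L K ^ 2) * (2 * (inner ℂ ((w - u) K)
        (modeRhs L ν β (f - η • helm L β (leray (lowModes N w - lowModes N u))) w K
          - modeRhs L ν α f u K)).re)) d ∧
      d ≤ -(η / 2) * (vnorm L 0 (w - u) ^ 2 + β ^ 2 * vnorm L 1 (w - u) ^ 2) +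
        (β ^ 2 - α ^ 2) ^ 2 * M ^ 2 / (ν * β ^ 2)) ∧
    ∀ S : Finset (Fin 3 → ℤ), |∑ K ∈ S, L ^ 3 * (1 + β ^ 2 * wave L K ^ 2) *
        (2 * (inner ℂ ((w - u) K)
        (modeRhs L ν β (f - η • helm L β (leray (lowModes N w - lowModes N u))) w K
          - modeRhs L ν α f u K)).re)| ≤
      2 * (√(fourth L u) * vnorm L 1 (w - u)) + 2 * (√(fourth L w) * vnorm L 1 (w - u))
        + 2 * |β ^ 2 - α ^ 2| * (M * vnorm L 2 (w - u))
        + 2 * (ν * (vnorm L 1 (w - u) ^ 2 + β ^ 2 * vnorm L 2 (w - u) ^ 2)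
          + η * (vnorm L 0 (w - u) ^ 2 + β ^ 2 * vnorm L 1 (w - u) ^ 2)) := by
  have hg := hw.sub hu
  set g := w - u with hgdef
  have a0 := hg.isH1.summable_amp_zero L
  have a1 := hg.summable_amp L
  have a2 := hg2.summable_amp L
  have n0 := vnorm_nonneg L 0 g
  have n1 := vnorm_nonneg L 1 g
  have n2 := vnorm_nonneg L 2 g
  have hMF : vnorm L 0 f + √(fourth L u) / (α ^ 2 * √(lam L)) ≤ M := by
    linarith [sqrt_fourth_div_le hc hα₀ hα hu hQ]
  have s0 := (hasSum_amp L a0).add ((hasSum_amp L a1).mul_left (β ^ 2))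
  have s1 := (hasSum_amp L a1).add ((hasSum_amp L a2).mul_left (β ^ 2))
  have sl : Summable fun K => lowIndicator N K * (amp L 0 g K ^ 2 + β ^ 2 * amp L 1 g K ^ 2) :=
    s0.summable.of_nonneg_of_le (fun K => mul_nonneg (lowIndicator_nonneg N K) (by positivity))
      fun K => mul_le_of_le_one_left (by positivity) (lowIndicator_le_one N K)
  have pr : ∀ S, _ := fun S => (sum_inner_residual_le L (hα₀.trans_le hα) hu a2
    (hf.summable_amp L) S).trans (mul_le_mul_of_nonneg_right hMF n2)
  obtain ⟨sr, tr⟩ := abs_tsum_le_of_sum_abs_le pr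
  have bu := hasSum_inner_bilin L hu.isH1 hu.div_free hg
  have bw := hasSum_inner_bilin L hw.isH1 hw.div_free hg
  have hden := energy_density_nudged (L := L) hw hu f ν α β η N
  rw [← hgdef] at hden
  simp only [hden]
  refine ⟨⟨_, (((bu.mul_left 2).sub (bw.mul_left 2)).sub (sr.hasSum.mul_left _)).sub
    (((s1.mul_left ν).add (sl.hasSum.mul_left η)).mul_left 2), ?_⟩, fun S => ?_⟩
  · have hlow := hasSum_le (lowIndicator_dissipation (L := L) (β := β) hg.mean_zero hν hN h_N)
      ((s0.mul_left η).sub (s1.mul_left (ν / 2))) (sl.hasSum.mul_left η)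
    have htri := congrArg Complex.re (tri_sub_tri_eq (L := L) hw hu)
    rw [Complex.sub_re, Complex.neg_re, ← hgdef] at htri
    have hnl := (abs_le.1 (Complex.abs_re_le_norm (tri L g g u))).1
    have hdis := norm_tri_le_dissipation hc hν hα₀ hα hη hQη hg hu hQ
    set Ψ := ∑' K, L ^ 3 * (wave L K ^ 2 / (1 + α ^ 2 * wave L K ^ 2) *
      (inner ℂ (g K) (f K - bilin L u u K)).re) with hΨ
    have hres : -(2 * (β ^ 2 - α ^ 2) * Ψ) ≤
        ν * (β ^ 2 * vnorm L 2 g ^ 2) + (β ^ 2 - α ^ 2) ^ 2 * M ^ 2 / (ν * β ^ 2) := by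
      have h1 : -(2 * (β ^ 2 - α ^ 2) * Ψ) ≤ 2 * (|β ^ 2 - α ^ 2| * (M * vnorm L 2 g)) := by
        calc _ ≤ |2 * (β ^ 2 - α ^ 2) * Ψ| := neg_le_abs _
          _ = 2 * (|β ^ 2 - α ^ 2| * |Ψ|) := by rw [abs_mul, abs_mul, abs_two]; ring
          _ ≤ _ := by gcongr
      have h2 : 0 ≤ (ν * β ^ 2 * vnorm L 2 g - |β ^ 2 - α ^ 2| * M) ^ 2 / (ν * β ^ 2) := by
        positivity
      have h3 : (ν * β ^ 2 * vnorm L 2 g - |β ^ 2 - α ^ 2| * M) ^ 2 / (ν * β ^ 2) =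
          ν * (β ^ 2 * vnorm L 2 g ^ 2) - 2 * (|β ^ 2 - α ^ 2| * (M * vnorm L 2 g)) +
            |β ^ 2 - α ^ 2| ^ 2 * M ^ 2 / (ν * β ^ 2) := by
        field_simp; ring
      rw [sq_abs] at h3
      linarith
    have h4 : 0 ≤ η * (β ^ 2 * vnorm L 1 g ^ 2) := by positivity
    linarith
  · have q1 := (Finset.abs_sum_le_sum_abs _ S).trans (sum_inner_bilin_le L hu a1 S)
    have q2 := (Finset.abs_sum_le_sum_abs _ S).trans (sum_inner_bilin_le L hw a1 S)
    have q3 := (Finset.abs_sum_le_sum_abs _ S).trans (pr S)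
    have q4 := sum_le_hasSum S (fun _ _ => by positivity) s1
    have q5 := (sl.sum_le_tsum S fun K _ =>
      mul_nonneg (lowIndicator_nonneg N K) (by positivity)).trans
        (hasSum_le (fun K => mul_le_of_le_one_left (by positivity) (lowIndicator_le_one N K))
          sl.hasSum s0)
    have p4 : 0 ≤ ∑ K ∈ S, (amp L 1 g K ^ 2 + β ^ 2 * amp L 2 g K ^ 2) :=
      Finset.sum_nonneg fun _ _ => by positivity
    have p5 : 0 ≤ ∑ K ∈ S, lowIndicator N K * (amp L 0 g K ^ 2 + β ^ 2 * amp L 1 g K ^ 2) :=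
      Finset.sum_nonneg fun K _ => mul_nonneg (lowIndicator_nonneg N K) (by positivity)
    simp only [Finset.sum_sub_distrib, ← Finset.mul_sum S _ (2 : ℝ),
      ← Finset.mul_sum S _ (2 * (β ^ 2 - α ^ 2)), Finset.sum_add_distrib (s := S)
        (f := fun K => ν * _), ← Finset.mul_sum S _ ν, ← Finset.mul_sum S _ η]
    refine (abs_sub _ _).trans (add_le_add ((abs_sub _ _).trans (add_le_add
      ((abs_sub _ _).trans (add_le_add ?_ ?_)) ?_)) ?_)
    · rw [abs_mul, abs_two]; gcongr
    · rw [abs_mul, abs_two]; gcongr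
    · rw [abs_mul, abs_mul, abs_two]; gcongr
    · rw [abs_of_nonneg (by positivity)]; gcongr

/-- The energy estimate for the difference of the nudged and the true solution. -/
lemma IsNudgedSolution.energy_sub_le {c ν α α₀ β η Q M a b : ℝ} (hc : IsGNConst L c) (hν : 0 < ν)
    (hα₀ : 0 < α₀) (hα : α₀ ≤ α) (hβ : 0 < β) (hη : 0 < η) {N : ℕ} (hN : 1 ≤ N)
    (h_N : η / (N : ℝ) ^ 2 ≤ ν * lam L / 2)
    (hQη : 27 * c ^ 4 * Q ^ 2 / (8 * ν ^ 3 * α₀ ^ 4) ≤ η)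
    {f u w : ℝ → VField} (hf : IsForcing L f) (ha : 0 ≤ a) (hab : a < b)
    (hu : IsSolutionOn L ν α f 0 b u) (hw : IsNudgedSolution L ν β η N f u a b w)
    (hQ : ∀ t ∈ Set.Icc a b, vnorm L 0 (u t) ^ 2 + α ^ 2 * vnorm L 1 (u t) ^ 2 ≤ Q)
    (hM : c ^ 2 / (α₀ ^ 4 * lam L ^ (3 / 4 : ℝ)) * Q + supNorm L f ≤ M) :
    ∀ t ∈ Set.Icc a b, vnorm L 0 (w t - u t) ^ 2 + β ^ 2 * vnorm L 1 (w t - u t) ^ 2 ≤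
      Real.exp (-(η / 2) * (t - a)) *
          (vnorm L 0 (w a - u a) ^ 2 + β ^ 2 * vnorm L 1 (w a - u a) ^ 2)
        + (β ^ 2 - α ^ 2) ^ 2 * M ^ 2 / (ν * β ^ 2) / (η / 2) := by
  have hsub : Set.Icc a b ⊆ Set.Icc 0 b := Set.Icc_subset_Icc_left ha
  have hsub' : Set.Icc a b ⊆ Set.Ici (0 : ℝ) := fun s hs => ha.trans hs.1
  have hwp := IsSolutionOn.isPath hw
  have hup := hu.isPath.mono hsub
  have hgp := hwp.sub hup
  obtain ⟨Cu, hCu0, hCu⟩ := hup.exists_bound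
  obtain ⟨Cw, hCw0, hCw⟩ := hwp.exists_bound
  obtain ⟨Cg, hCg0, hCg⟩ := hgp.exists_bound
  have hfi := fun K => hf.intervalIntegrable (L := L) K le_rfl (ha.trans hab.le)
  have hGi := fun K => hw.intervalIntegrable_forcing hf ha hab.le hup K
  have hbnd : ∀ᵐ s ∂volume.restrict (Set.Icc a b), InV 2 (w s) ∧ InV 2 (u s) ∧ InV 0 (f s) ∧
      vnorm L 0 (f s) ≤ supNorm L f := by
    filter_upwards [hw.mem_DA, ae_restrict_of_ae_restrict_of_subset hsub hu.mem_DA,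
      ae_restrict_of_ae_restrict_of_subset hsub' hf.mem_H,
      ae_restrict_of_ae_restrict_of_subset hsub' hf.ae_le_supNorm] with s h1 h2 h3 h4
    exact ⟨h1, h2, h3, h4⟩
  have hM0 : 0 ≤ M := by
    have h1 := hf.supNorm_nonneg
    have h2 : 0 ≤ Q := le_trans (by positivity) (hQ a ⟨le_rfl, hab.le⟩)
    have h3 := lam_pos L
    exact le_trans (by positivity) hM
  refine energy_le (by positivity) (by positivity)
    (m := fun K => L ^ 3 * (1 + β ^ 2 * wave L K ^ 2)) (y := fun K s => (w s - u s) K)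
    (h := fun K s => modeRhs L ν β
        (f s - η • helm L β (leray (lowModes N (w s) - lowModes N (u s)))) (w s) K
      - modeRhs L ν α (f s) (u s) K)
    (fun K => (IsSolutionOn.intervalIntegrable_modeRhs hw (hGi K) le_rfl hab.le le_rfl).sub
      (hu.intervalIntegrable_modeRhs (hfi K) ha hab.le le_rfl))
    (fun K t ht => ?_)
    (E := fun t => vnorm L 0 (w t - u t) ^ 2 + β ^ 2 * vnorm L 1 (w t - u t) ^ 2)
    (fun t ht => (hgp.mem t ht).hasSum_energy β)
    ((hgp.continuousOn_vnorm_zero.pow 2).add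
      (continuousOn_const.mul (hgp.continuousOn_vnorm_one.pow 2)))
    (Φ := fun s => 2 * (Cu * Cg) + 2 * (Cw * Cg)
        + 2 * |β ^ 2 - α ^ 2| * (M * (1 + (2 * vnorm L 2 (w s) ^ 2 + 2 * vnorm L 2 (u s) ^ 2)))
        + 2 * (ν * (Cg ^ 2 + β ^ 2 * (2 * vnorm L 2 (w s) ^ 2 + 2 * vnorm L 2 (u s) ^ 2))
          + η * (Cg ^ 2 + β ^ 2 * Cg ^ 2)))
    ?_ ?_
  · have e1 := IsSolutionOn.mode_sub_eq hw (hGi K) le_rfl ht.1 ht.2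
    have e2 := hu.mode_sub_eq (hfi K) ha ht.1 ht.2
    rw [intervalIntegral.integral_sub
      (IsSolutionOn.intervalIntegrable_modeRhs hw (hGi K) le_rfl ht.1 ht.2)
      (hu.intervalIntegrable_modeRhs (hfi K) ha ht.1 ht.2), ← e1, ← e2]
    simp only [Pi.sub_apply]
    abel
  · have h1 : ∀ c : ℝ, IntegrableOn (fun _ : ℝ => c) (Set.Icc a b) := fun c =>
      integrableOn_const (by simp) (by simp)
    have h2 : IntegrableOn (fun s => 2 * vnorm L 2 (w s) ^ 2 + 2 * vnorm L 2 (u s) ^ 2)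
        (Set.Icc a b) :=
      (hw.sq_integrable_DA.const_mul _).add ((hu.sq_integrable_DA.mono_set hsub).const_mul _)
    exact (((h1 _).add (h1 _)).add ((((h1 _).add h2).const_mul _).const_mul _)).add
      (((((h1 _).add (h2.const_mul _)).const_mul _).add (h1 _)).const_mul _)
  · filter_upwards [hbnd, ae_restrict_mem measurableSet_Icc] with s ⟨hw2, hu2, hf0, hfF⟩ hs
    obtain ⟨⟨d, hd, hd'⟩, hS⟩ := exists_hasSum_energy_density hc hν hα₀ hα hβ hη hN h_N hQη hf0 hfF
      (hwp.mem s hs) (hup.mem s hs) (hw2.sub hu2) (hQ s hs) hM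
    refine ⟨d, hd, hd', fun S => (hS S).trans ?_⟩
    obtain ⟨g0, g1, -⟩ := hCg s hs
    obtain ⟨-, -, u4⟩ := hCu s hs
    obtain ⟨-, -, w4⟩ := hCw s hs
    have n0 := vnorm_nonneg L 0 (w s - u s)
    have n1 := vnorm_nonneg L 1 (w s - u s)
    have n2 := vnorm_nonneg L 2 (w s - u s)
    have g2 : vnorm L 2 (w s - u s) ^ 2 ≤ 2 * vnorm L 2 (w s) ^ 2 + 2 * vnorm L 2 (u s) ^ 2 := by
      have h := pow_le_pow_left₀ n2 (vnorm_sub_le L (hw2.summable_amp L) (hu2.summable_amp L)) 2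
      nlinarith [sq_nonneg (vnorm L 2 (w s) - vnorm L 2 (u s))]
    -- Only the square of the norm in D(A) is known to be integrable in time, so its first power is
    -- bounded by 1 plus the square.
    have g3 : vnorm L 2 (w s - u s) ≤
        1 + (2 * vnorm L 2 (w s) ^ 2 + 2 * vnorm L 2 (u s) ^ 2) := by
      nlinarith [sq_nonneg (vnorm L 2 (w s - u s) - 1)]
    gcongr

end NudgedEnergy

end Bardina

/-! ### Conclusion. -/

theorem proposition5p5 (L : ℝ) [Fact (0 < L)]
    (ν α α₀ α₁ MA MB MC c : ℝ) (hν : 0 < ν)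
    (hα₀ : 0 < α₀) (hα₀α : α₀ ≤ α) (hαα₁ : α ≤ α₁)
    (hMA : 0 < MA) (hMB : 0 < MB) (hMC : 0 < MC)
    (hc : IsGNConst L c)
    (f : ℝ → VField) (hf : IsForcing L f)
    (u : ℝ → VField) (hu : IsBardinaSolution L ν α f u)
    (hu0 : InV 2 (u 0)) (huA : vnorm L 0 (u 0) ≤ MA) (huB : vnorm L 1 (u 0) ≤ MB)
    (huC : vnorm L 2 (u 0) ≤ MC)
    (tn tn1 : ℝ) (htn : 0 ≤ tn) (htn1 : tn < tn1)
    (β η : ℝ) (hβ : 0 < β) (hη : 0 < η) (N : ℕ) (hN : 1 ≤ N)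
    (w : ℝ → VField) (hw : IsNudgedSolution L ν β η N f u tn tn1 w)
    (h_eta : 27 * c ^ 4 * M1sq L ν α₁ MA MB (supNorm L f) tn ^ 2 / (8 * ν ^ 3 * α₀ ^ 4) ≤ η)
    (h_N : η / (N : ℝ) ^ 2 ≤ ν * lam L / 2) :
    ∀ t ∈ Set.Icc tn tn1,
      vnorm L 0 (w t - u t) ^ 2 + β ^ 2 * vnorm L 1 (w t - u t) ^ 2 ≤
        Real.exp (-(η / 2) * (t - tn)) *
            (vnorm L 0 (w tn - u tn) ^ 2 + β ^ 2 * vnorm L 1 (w tn - u tn) ^ 2)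
          + 4 * (1 / ν * M3 L ν c α₀ α₁ MA MB MC (supNorm L f) tn ^ 2
              + ν / α₀ ^ 2 * M2sq L ν c α₀ α₁ MA MB MC (supNorm L f) tn)
            * (|β ^ 2 - α ^ 2| ^ 2 / (η * β ^ 2)) := by
  intro t ht
  have hα : 0 < α := hα₀.trans_le hα₀α
  have hl := lam_pos L
  have hF := hf.supNorm_nonneg
  have hM2 : 0 ≤ M2sq L ν c α₀ α₁ MA MB MC (supNorm L f) tn := by
    unfold M2sq; positivity
  have h := hw.energy_sub_le hc hν hα₀ hα₀α hβ hη hN h_N h_eta hf htn htn1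
    (hu tn1 (htn.trans_lt htn1))
    (fun s hs => hu.energy_le hν hα hαα₁ hf huA huB htn hs.1)
    (M := M3 L ν c α₀ α₁ MA MB MC (supNorm L f) tn) ?_ t ht
  · refine h.trans (add_le_add_right ?_ _)
    set M := M3 L ν c α₀ α₁ MA MB MC (supNorm L f) tn
    rw [sq_abs]
    -- Gronwall gives the constant 2M²/ν, so half of the factor 4 and the whole `M2sq` term are
    -- slack.
    calc (β ^ 2 - α ^ 2) ^ 2 * M ^ 2 / (ν * β ^ 2) / (η / 2)
        = 2 * (1 / ν * M ^ 2 + 0) * ((β ^ 2 - α ^ 2) ^ 2 / (η * β ^ 2)) := by field_simp; ring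
      _ ≤ _ := by
        gcongr
        · norm_num
        · positivity
  -- The residual is already bounded by the last two terms of `M3`; the first is only nonnegative.
  · have : 0 ≤ ν / α₀ * √(M2sq L ν c α₀ α₁ MA MB MC (supNorm L f) tn) := by positivity
    rw [M3]
    linarith
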